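/- **Proposition.** Let $N\ge 2$, $\omega=e^{2i\pi/N}$, and write $z=e^{i\pi\xi}$, $q=e^{i\pi\mu}$, $p=e^{2i\pi\tau}$, $p^{*}=pq^{-2c}=e^{2i\pi\tau^*}$ with $\tau^*=\tau-c\mu$; all powers (for instance $p^{1/2}=e^{i\pi\tau}$, $q^{1/N}=e^{i\pi\mu/N}$) are taken through these logarithms, functions of $z$ are regarded as functions of $\xi\in\mathbb C$, and multiplication of $z$ by $-p^{1/2}$, $-p^{*1/2}$, $q^N$ means the shift of $\xi$ by $\tau+1$, $\tau^*+1$, $N\mu$. The parameters $(\mu,\tau,c)\in\mathbb C^3$ are *admissible* if $\mu,\tau,\tau^*$ lie in the upper half-plane and $\mu\notin\mathbb Z+\mathbb Z\tau$, $\mu\notin\mathbb Z+\mathbb Z\tau^*$. Let $(x;a)_\infty=\prod_{n\ge0}(1-xa^n)$, $(x;a,b)_\infty=\prod_{n,m\ge0}(1-xa^nb^m)$, $\Theta_a(x)=(x;a)_\infty(ax^{-1};a)_\infty(a;a)_\infty$, $\vartheta{\gamma_1\brack\gamma_2}(\xi,\tau)=\sum_{m\in\mathbb Z}e^{i\pi(m+\gamma_1)^2\tau+2i\pi(m+\gamma_1)(\xi+\gamma_2)}$.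 Let $g^{1/2}=\mathrm{diag}(\omega^{i/2})_{0\le i<N}$, $g=\mathrm{diag}(\omega^i)$, $h_{ij}=\delta_{i+1,j}$ (indices modulo $N$), $a=g^{1/2}hg^{1/2}$, $I_{\alpha}=g^{1/2}g^{\alpha_2}h^{\alpha_1}g^{-1/2}$ for $\alpha=(\alpha_1,\alpha_2)\in\{0,\dots,N-1\}^2$. The matrix of the $\mathbb Z_N$-vertex model is $$\mathcal W(z,q,p)=\frac{z^{2/N-2}}{\kappa(z^2)}\,\frac{\vartheta{1/2\brack 1/2}(\mu,\tau)}{\vartheta{1/2\brack 1/2}(\xi+\mu,\tau)}\sum_{\alpha}\frac{\vartheta{1/2+\alpha_1/N\brack 1/2+\alpha_2/N}(\xi+\mu/N,\tau)}{N\,\vartheta{1/2+\alpha_1/N\brack 1/2+\alpha_2/N}(\mu/N,\tau)}\;I_\alpha\otimes I_\alpha^{-1},$$ $$\frac1{\kappa(y)}=\frac{(q^{2N}y^{-1};p,q^{2N})_\infty(q^2y;p,q^{2N})_\infty(py^{-1};p,q^{2N})_\infty(pq^{2N-2}y;p,q^{2N})_\infty}{(q^{2N}y;p,q^{2N})_\infty(q^2y^{-1};p,q^{2N})_\infty(py;p,q^{2N})_\infty(pq^{2N-2}y^{-1};p,q^{2N})_\infty},$$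 and $R_{12}(z)=R_{12}(z,q,p)=\tau_N(q^{1/2}z^{-1})\,\mathcal W(z,q,p)$, $R^*_{12}(z)=R_{12}(z,q,p^*)$, with $\tau_N(z)=z^{2/N-2}\,\Theta_{q^{2N}}(qz^2)/\Theta_{q^{2N}}(qz^{-2})$. Put $\widetilde\tau_N(z)=\tau_N(q^{1/2}z^{-1})\tau_N(q^{1/2}z)$, $$F(\ell,z)=\prod_{s=1}^{\ell}\widetilde\tau_N\big((-p^{1/2})^{-s}z\big),\qquad F(-\ell,z)=\frac1{F(\ell,(-p^{1/2})^{\ell}z)}\qquad(\ell\ge0),$$ and let $F^*$ be $F$ with $p$ replaced by $p^*$. The elliptic algebra $\mathcal A_{q,p}(\widehat{gl}_N)_c$ is the unital associative $\mathbb C$-algebra generated by the entries of $N\times N$ matrices $L(z)$ and $L(z)^{-1}$ (one pair for every $\xi\in\mathbb C$), subject to $L(z)L(z)^{-1}=L(z)^{-1}L(z)=1$ and $$R_{12}(z_1/z_2)\,L_1(z_1)\,L_2(z_2)=L_2(z_2)\,L_1(z_1)\,R^*_{12}(z_1/z_2),$$ $L_1=L\otimes 1$, $L_2=1\otimes L$,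 whenever $(z_1/z_2)^2\notin q^{2\mathbb Z}p^{\mathbb Z}\cup q^{2\mathbb Z}p^{*\mathbb Z}$. For $\ell,\ell'\in\mathbb Z$ the surface $\mathcal P^{(N)}_{\ell\ell'}$ is the set of $(\mu,\tau,c)$ with $$(-p^{1/2})^{-\ell}=(-p^{*1/2})^{-\ell'}q^{N},\quad\text{that is}\quad -\ell(\tau+1)\equiv-\ell'(\tau^*+1)+N\mu\ \text{ modulo } 2\mathbb Z\cap N\mathbb Z .$$ On $\mathcal P^{(N)}_{\ell\ell'}$ put, with $\gamma_{\ell\ell'}=(-p^{1/2})^{-\ell}$, $$T_{\ell\ell'}(z)=\mathrm{Tr}\big(L(\gamma_{\ell\ell'}z)^{-1}\,a^{\ell}\,L(z)\,a^{-\ell'}\big),$$ and on $\mathcal P^{(N)}_{-\ell,-\ell'}$ put, with $\gamma=(-p^{1/2})^{\ell}$, $$S_{\ell\ell'}(z)=\mathrm{Tr}\big(a^{\ell}\,L(z)\,a^{-\ell'}\,L(\gamma^{-1}q^{N}z)^{-1}\big).$$ 1. When $c$ is rational, several surfaces have a non-trivial intersection: there is an infinite set $D\subset\mathbb Z^2$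 such that for every $\mu$ in the upper half-plane there is $\tau$ with $(\mu,\tau,c)$ admissible and $(\mu,\tau,c)\in\bigcap_{(\ell,\ell')\in D}\mathcal P^{(N)}_{\ell\ell'}$. 2. Let $(\mu,\tau,c)$ be admissible, $\ell,\ell',\lambda,\lambda'\in\mathbb Z$, and let $z_1,z_2$ be such that $(z_1/z_2)^2\notin q^{2\mathbb Z}p^{\mathbb Z}p^{*\mathbb Z}$. Put $$\mathbf F_{\ell\ell'}^{\lambda\lambda'}(z)=\frac{F(\ell,z)}{F^*(\ell',z)}\;\frac{F^*(\ell',\gamma_{\lambda\lambda'}^{-1}z)}{F(\ell,\gamma_{\lambda\lambda'}^{-1}z)},\qquad\gamma_{\lambda\lambda'}=(-p^{1/2})^{-\lambda}.$$ Then in $\mathcal A_{q,p}(\widehat{gl}_N)_c$: - on $\mathcal P^{(N)}_{\ell\ell'}\cap\mathcal P^{(N)}_{\lambda\lambda'}$: $\;T_{\ell\ell'}(z_1)T_{\lambda\lambda'}(z_2)=\mathbf F_{\ell\ell'}^{\lambda\lambda'}(z_1/z_2)\,T_{\lambda\lambda'}(z_2)T_{\ell\ell'}(z_1)$; - on $\mathcal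 P^{(N)}_{-\ell,-\ell'}\cap\mathcal P^{(N)}_{-\lambda,-\lambda'}$: $\;S_{\ell\ell'}(z_1)S_{\lambda\lambda'}(z_2)=\mathbf F_{\ell\ell'}^{\lambda\lambda'}(z_1/z_2)\,S_{\lambda\lambda'}(z_2)S_{\ell\ell'}(z_1)$; - on $\mathcal P^{(N)}_{\ell\ell'}\cap\mathcal P^{(N)}_{-\lambda,-\lambda'}$: $\;T_{\ell\ell'}(z_1)S_{\lambda\lambda'}(z_2)=\mathbf F_{\ell\ell'}^{\lambda\lambda'}(z_1/z_2)\,S_{\lambda\lambda'}(z_2)T_{\ell\ell'}(z_1)$. -/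

import Mathlib

open scoped Kronecker

noncomputable section

namespace EllipticGLN

/-! ### Parameters and special functions

All parameters are written additively: `z = exp (iπξ)`, `q = exp (iπμ)`, `p = exp (2iπτ)`,
`p^{1/2} = exp (iπτ)`. Multiplying `z` by `-p^{1/2}` is the shift `ξ ↦ ξ + (τ + 1)`,
multiplying `z` by `q^N` is the shift `ξ ↦ ξ + N μ`. -/

/-- `x ↦ exp (iπx)`. -/
def ex (x : ℂ) : ℂ := Complex.exp (Real.pi * Complex.I * x)

/-- `(x; a)_∞ = ∏_{n ≥ 0} (1 - x a^n)`. -/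
def poch (x a : ℂ) : ℂ := ∏' n : ℕ, (1 - x * a ^ n)

/-- `(x; a, b)_∞ = ∏_{n, m ≥ 0} (1 - x a^n b^m)`. -/
def poch₂ (x a b : ℂ) : ℂ := ∏' n : ℕ × ℕ, (1 - x * a ^ n.1 * b ^ n.2)

/-- `Θ_a(x) = (x; a)_∞ (a x⁻¹; a)_∞ (a; a)_∞`. -/
def Theta (a x : ℂ) : ℂ := poch x a * poch (a * x⁻¹) a * poch a a

/-- The Jacobi theta function with characteristics `(γ₁, γ₂)`. -/
def thetaChar (γ₁ γ₂ ξ τ : ℂ) : ℂ :=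
  ∑' m : ℤ, Complex.exp (Real.pi * Complex.I * ((m : ℂ) + γ₁) ^ 2 * τ
    + 2 * Real.pi * Complex.I * ((m : ℂ) + γ₁) * (ξ + γ₂))

/-- The shifted modulus: `p* = p q^{-2c} = exp (2iπτ*)`. -/
def tauStar (μ τ c : ℂ) : ℂ := τ - c * μ

/-! ### The `ℤ_N`-vertex model -/

/-- `1 / κ(y)`, with `y = z²`. -/
def kappaInv (N : ℕ) (q p y : ℂ) : ℂ :=
  (poch₂ (q ^ (2 * N) * y⁻¹) p (q ^ (2 * N)) * poch₂ (q ^ 2 * y) p (q ^ (2 * N))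
    * poch₂ (p * y⁻¹) p (q ^ (2 * N)) * poch₂ (p * q ^ (2 * N) * (q ^ 2)⁻¹ * y) p (q ^ (2 * N)))
  / (poch₂ (q ^ (2 * N) * y) p (q ^ (2 * N)) * poch₂ (q ^ 2 * y⁻¹) p (q ^ (2 * N))
    * poch₂ (p * y) p (q ^ (2 * N)) * poch₂ (p * q ^ (2 * N) * (q ^ 2)⁻¹ * y⁻¹) p (q ^ (2 * N)))

/-- `g = diag (ω^i)` with `ω = exp (2iπ/N)`. -/
def gMat (N : ℕ) : Matrix (Fin N) (Fin N) ℂ :=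
  Matrix.diagonal fun i => ex (2 * (i.val : ℂ) / N)

/-- `g^{1/2} = diag (ω^{i/2})`. -/
def gHalf (N : ℕ) : Matrix (Fin N) (Fin N) ℂ :=
  Matrix.diagonal fun i => ex ((i.val : ℂ) / N)

/-- `h_{ij} = δ_{i+1, j}`, indices modulo `N`. -/
def hMat (N : ℕ) [NeZero N] : Matrix (Fin N) (Fin N) ℂ :=
  Matrix.of fun i j => if i + 1 = j then 1 else 0

/-- `I_{(α₁, α₂)} = g^{1/2} (g^{α₂} h^{α₁}) g^{-1/2}`. -/
def iMat (N : ℕ) [NeZero N] (α : Fin N × Fin N) : Matrix (Fin N) (Fin N) ℂ :=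
  gHalf N * (gMat N ^ α.2.val * hMat N ^ α.1.val) * (gHalf N)⁻¹

/-- The matrix `g^{1/2} h g^{1/2}`. -/
def aMat (N : ℕ) [NeZero N] : Matrix (Fin N) (Fin N) ℂ :=
  gHalf N * hMat N * gHalf N

/-- The weight functions `W_{(α₁, α₂)}(ξ, μ, τ)`. -/
def weight (N : ℕ) (μ τ : ℂ) (α : Fin N × Fin N) (ξ : ℂ) : ℂ :=
  thetaChar (1 / 2 + (α.1.val : ℂ) / N) (1 / 2 + (α.2.val : ℂ) / N) (ξ + μ / N) τ
    / (N * thetaChar (1 / 2 + (α.1.val : ℂ) / N) (1 / 2 + (α.2.val : ℂ) / N) (μ / N) τ)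

/-- The matrix `W(z, q, p)` of Boltzmann weights of the `ℤ_N`-vertex model. -/
def wMat (N : ℕ) [NeZero N] (μ τ ξ : ℂ) : Matrix (Fin N × Fin N) (Fin N × Fin N) ℂ :=
  (ex (ξ * (2 / N - 2)) * kappaInv N (ex μ) (ex (2 * τ)) (ex (2 * ξ))
      * (thetaChar (1 / 2) (1 / 2) μ τ / thetaChar (1 / 2) (1 / 2) (ξ + μ) τ))
    • ∑ α : Fin N × Fin N, weight N μ τ α ξ • (iMat N α ⊗ₖ (iMat N α)⁻¹)

/-- `τ_N(z) = z^{2/N - 2} Θ_{q^{2N}}(q z²) / Θ_{q^{2N}}(q z^{-2})`. -/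
def tauN (N : ℕ) (μ ξ : ℂ) : ℂ :=
  ex (ξ * (2 / N - 2))
    * (Theta (ex μ ^ (2 * N)) (ex μ * ex (2 * ξ)) / Theta (ex μ ^ (2 * N)) (ex μ * ex (-(2 * ξ))))

/-- The matrix `R₁₂(z, q, p) = τ_N(q^{1/2} z⁻¹) W₁₂(z, q, p)`. -/
def rMat (N : ℕ) [NeZero N] (μ τ ξ : ℂ) : Matrix (Fin N × Fin N) (Fin N × Fin N) ℂ :=
  tauN N μ (μ / 2 - ξ) • wMat N μ τ ξ

/-- `τ̃_N(z) = τ_N(q^{1/2} z⁻¹) τ_N(q^{1/2} z)`. -/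
def tauTilde (N : ℕ) (μ ξ : ℂ) : ℂ := tauN N μ (μ / 2 - ξ) * tauN N μ (μ / 2 + ξ)

/-- `F(n, z) = ∏_{s=1}^n τ̃_N((-p^{1/2})^{-s} z)` for `n ≥ 0`. -/
def fNat (N : ℕ) (μ τ : ℂ) (n : ℕ) (ξ : ℂ) : ℂ :=
  ∏ s ∈ Finset.Icc 1 n, tauTilde N μ (ξ - (s : ℂ) * (τ + 1))

/-- `F(ℓ, z)` for `ℓ ∈ ℤ`, where `F(-n, z) = 1 / F(n, (-p^{1/2})^n z)` for `n > 0`. -/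
def fInt (N : ℕ) (μ τ : ℂ) : ℤ → ℂ → ℂ
  | Int.ofNat n, ξ => fNat N μ τ n ξ
  | Int.negSucc n, ξ => (fNat N μ τ (n + 1) (ξ + ((n + 1 : ℕ) : ℂ) * (τ + 1)))⁻¹

/-- The shift of `ξ` given by `γ_{ℓℓ'} = (-p^{1/2})^{-ℓ}`. -/
def gammaShift (τ : ℂ) (ℓ : ℤ) : ℂ := -(ℓ : ℂ) * (τ + 1)

/-- The exchange function with lower indices `(ℓ, ℓ')` and upper indices `(m, m')`; it does not
depend on `m'`. -/
def exchangeF (N : ℕ) (μ τ c : ℂ) (ℓ ℓ' m : ℤ) (ξ : ℂ) : ℂ :=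
  fInt N μ τ ℓ ξ / fInt N μ (tauStar μ τ c) ℓ' ξ
    * (fInt N μ (tauStar μ τ c) ℓ' (ξ - gammaShift τ m) / fInt N μ τ ℓ (ξ - gammaShift τ m))

/-! ### Parameter space and surfaces -/

/-- `|q|, |p|, |p*| < 1`, and the denominators in the definitions of `R` and `R*` that do not
involve the spectral parameter do not vanish (`q²` is an integral power neither of `p` nor of
`p*`, in additive form). -/
structure Admissible (μ τ c : ℂ) : Prop where
  im_mu : 0 < μ.im
  im_tau : 0 < τ.im
  im_tauStar : 0 < (tauStar μ τ c).im
  mu_ne : ∀ a b : ℤ, μ ≠ a + b * τ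
  mu_ne_star : ∀ a b : ℤ, μ ≠ a + b * tauStar μ τ c

/-- The surface `(-p^{1/2})^{-ℓ} = (-p*^{1/2})^{-ℓ'} q^N`, as an identity between shifts of `ξ`.
The shifts are compared modulo `2` (so that they agree on `z`) and modulo `N`
(the period in `ξ` of the matrix `R`). -/
def OnSurface (N : ℕ) (μ τ c : ℂ) (ℓ ℓ' : ℤ) : Prop :=
  ∃ k : ℤ, (2 : ℤ) ∣ k ∧ (N : ℤ) ∣ k ∧
    gammaShift τ ℓ = gammaShift (tauStar μ τ c) ℓ' + N * μ + k

/-- `z²` is not of the form `q^{2b} p^d`: this keeps `ξ` away from all zeros and poles of the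
scalar factors of `R`. -/
def Regular (μ τ ξ : ℂ) : Prop := ∀ a b d : ℤ, ξ ≠ a + b * μ + d * τ

/-- `z²` is not of the form `q^{2b} p^d p*^e`. -/
def Generic (μ τ c ξ : ℂ) : Prop :=
  ∀ a b d e : ℤ, ξ ≠ a + b * μ + d * τ + e * tauStar μ τ c

/-! ### The elliptic algebra -/

/-- Generators: the entries of `L(z)` and of `L(z)⁻¹`, for every spectral parameter. -/
inductive Gen (N : ℕ) : Type
  | L (ξ : ℂ) (i j : Fin N) : Gen N
  | Linv (ξ : ℂ) (i j : Fin N) : Gen N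

/-- The free algebra on the generators. -/
abbrev Free (N : ℕ) : Type := FreeAlgebra ℂ (Gen N)

/-- The matrix `L(z)` over the free algebra. -/
def freeL (N : ℕ) (ξ : ℂ) : Matrix (Fin N) (Fin N) (Free N) :=
  Matrix.of fun i j => FreeAlgebra.ι ℂ (Gen.L ξ i j)

/-- The matrix `L(z)⁻¹` over the free algebra. -/
def freeLinv (N : ℕ) (ξ : ℂ) : Matrix (Fin N) (Fin N) (Free N) :=
  Matrix.of fun i j => FreeAlgebra.ι ℂ (Gen.Linv ξ i j)

/-- A scalar matrix seen over a `ℂ`-algebra. -/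
def scal {n : Type} (A : Type) [Semiring A] [Algebra ℂ A] (M : Matrix n n ℂ) : Matrix n n A :=
  M.map (algebraMap ℂ A)

/-- Defining relations:
`R₁₂(z₁/z₂) L₁(z₁) L₂(z₂) = L₂(z₂) L₁(z₁) R*₁₂(z₁/z₂)` wherever `R` and `R*` are regular, and
`L(z) L(z)⁻¹ = 1 = L(z)⁻¹ L(z)`. -/
inductive Rel (N : ℕ) [NeZero N] (μ τ c : ℂ) : Free N → Free N → Prop
  | rll (ξ₁ ξ₂ : ℂ) (h : Regular μ τ (ξ₁ - ξ₂)) (hs : Regular μ (tauStar μ τ c) (ξ₁ - ξ₂))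
      (i j : Fin N × Fin N) :
      Rel N μ τ c
        ((scal (Free N) (rMat N μ τ (ξ₁ - ξ₂))
          * (freeL N ξ₁ ⊗ₖ (1 : Matrix (Fin N) (Fin N) (Free N)))
          * ((1 : Matrix (Fin N) (Fin N) (Free N)) ⊗ₖ freeL N ξ₂)) i j)
        ((((1 : Matrix (Fin N) (Fin N) (Free N)) ⊗ₖ freeL N ξ₂)
          * (freeL N ξ₁ ⊗ₖ (1 : Matrix (Fin N) (Fin N) (Free N)))
          * scal (Free N) (rMat N μ (tauStar μ τ c) (ξ₁ - ξ₂))) i j)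
  | mul_inv (ξ : ℂ) (i j : Fin N) :
      Rel N μ τ c ((freeL N ξ * freeLinv N ξ) i j) ((1 : Matrix (Fin N) (Fin N) (Free N)) i j)
  | inv_mul (ξ : ℂ) (i j : Fin N) :
      Rel N μ τ c ((freeLinv N ξ * freeL N ξ) i j) ((1 : Matrix (Fin N) (Fin N) (Free N)) i j)

/-- The elliptic quantum algebra `A_{q,p}(gl_N)` at central charge `c`. -/
abbrev EllAlg (N : ℕ) [NeZero N] (μ τ c : ℂ) : Type := RingQuot (Rel N μ τ c)

/-- The matrix `L(z)`. -/
def LMat (N : ℕ) [NeZero N] (μ τ c ξ : ℂ) : Matrix (Fin N) (Fin N) (EllAlg N μ τ c) :=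
  (freeL N ξ).map (RingQuot.mkAlgHom ℂ (Rel N μ τ c))

/-- The matrix `L(z)⁻¹`. -/
def LInvMat (N : ℕ) [NeZero N] (μ τ c ξ : ℂ) : Matrix (Fin N) (Fin N) (EllAlg N μ τ c) :=
  (freeLinv N ξ).map (RingQuot.mkAlgHom ℂ (Rel N μ τ c))

/-- `T_{ℓℓ'}(z) = Tr (L(γz)⁻¹ a^ℓ L(z) a^{-ℓ'})`, with `a = g^{1/2} h g^{1/2}` and
`γ = (-p^{1/2})^{-ℓ}`. -/
def opT (N : ℕ) [NeZero N] (μ τ c : ℂ) (ℓ ℓ' : ℤ) (ξ : ℂ) : EllAlg N μ τ c :=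
  Matrix.trace (LInvMat N μ τ c (ξ + gammaShift τ ℓ) * scal _ (aMat N ^ ℓ)
    * LMat N μ τ c ξ * scal _ (aMat N ^ (-ℓ')))

/-- `S_{ℓℓ'}(z) = Tr (a^ℓ L(z) a^{-ℓ'} L(γ⁻¹ q^N z)⁻¹)`, with `a = g^{1/2} h g^{1/2}` and
`γ = (-p^{1/2})^ℓ`. -/
def opS (N : ℕ) [NeZero N] (μ τ c : ℂ) (ℓ ℓ' : ℤ) (ξ : ℂ) : EllAlg N μ τ c :=
  Matrix.trace (scal _ (aMat N ^ ℓ) * LMat N μ τ c ξ * scal _ (aMat N ^ (-ℓ'))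
    * LInvMat N μ τ c (ξ - gammaShift τ (-ℓ) + N * μ))

end EllipticGLN

end

open scoped Kronecker

noncomputable section

namespace EllipticGLN

open Filter Topology Complex

/-! The exchange relations need no Yang–Baxter equation. Besides the defining relation they use
three properties of `R`: its inverse is proportional to the vertex matrix with `μ` replaced by `-μ`
(`rMat_mul_rInv`); conjugation by `a ⊗ 1` realises the shift of `ξ` by `τ + 1` up to the scalar
`τ̃_N`, so powers of `a` produce the functions `F` (`rMat_mul_aPow`); and after transposition in the
first tensor factor, `R(ξ)` and `R⁻¹(ξ + Nμ)` become mutually inverse (`crossed_rInv_rMat`).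

To carry `L₂(z₂)` through `T(z₁)`, insert `R⁻¹ R` before `L₁(z₁)`, apply the relation for `L` and
the one for `L⁻¹`, and push the matrices past `a^ℓ` and `a^{-ℓ'}`; this costs `F / F*`. Two matrices
`R*⁻¹` and `R*` remain on either side of the traced product. The equation of the surface says
exactly that their arguments differ by `Nμ`, up to a period, so crossing removes them under the
partial trace. Thus `T(z₁) L(z₂) = f(z₁/z₂) L(z₂) T(z₁)` with `f = F / F*` (`opT_mul_LMat`), and the
same `f` occurs for `S` (`opS_mul_LMat`). A second trace contains one `L` and one shifted `L⁻¹`,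
which contribute `f` and a shifted `f⁻¹`: this is the exchange function (`mul_opT`, `mul_opS`).

The properties of `R` are theta function identities. The matrices `I_α ⊗ I_α⁻¹` span a twisted group
algebra of `(ℤ/N)²`, and a lattice translation multiplies the weight of index `α` by a character of
`α`. Hence the lattice translates of the sum of all weights are their finite Fourier transform, and
this sum is a quotient of products of theta functions (`weightSum_mul_th`). Crossing is a plain
convolution, whose transform is then a constant (`crossCoeff_eq`). Unitarity is a twisted
convolution, settled by counting zeros and Liouville's theorem (`unitCoeff_eq_zero`,
`unitCoeff_zero_mul`). The double product `κ` is symmetric in its two moduli and turns a shift by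
either into theta quotients (`kappaAdd_shift`), which supplies the scalars.

For rational `c`, on the slice `τ = tμ - 1` with `t` an integer, the surfaces become one linear
Diophantine equation in `(ℓ, ℓ')` with infinitely many solutions. -/

/-! ### Entire functions on a complex torus -/

/-- An entire function with unimodular multipliers along a lattice is constant. -/
lemma const_of_unimodular_multipliers {τ : ℂ} (hτ : 0 < τ.im) {f : ℂ → ℂ}
    (hf : Differentiable ℂ f) {a b : ℂ} (ha : ‖a‖ = 1) (hb : ‖b‖ = 1)
    (h1 : ∀ x, f (x + 1) = a * f x) (h2 : ∀ x, f (x + τ) = b * f x) (x y : ℂ) :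
    f x = f y := by
  have p1 : Function.Periodic (fun x => ‖f x‖) 1 := fun x => by simp [h1, ha]
  have p2 : Function.Periodic (fun x => ‖f x‖) τ := fun x => by simp [h2, hb]
  -- Liouville: `‖f‖` is doubly periodic, hence bounded by its maximum on the compact fundamental
  -- parallelogram `K`.
  refine hf.apply_eq_apply_of_bounded ?_ x y
  set K : Set ℂ := (fun s : ℝ × ℝ => (s.1 : ℂ) + s.2 * τ) '' (Set.Icc 0 1 ×ˢ Set.Icc 0 1) with hK
  have hKc : IsCompact K := (isCompact_Icc.prod isCompact_Icc).image (by fun_prop)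
  have hb : Bornology.IsBounded (f '' K) := (hKc.image hf.continuous).isBounded
  obtain ⟨C, hC⟩ := hb.exists_norm_le
  refine isBounded_iff_forall_norm_le.2 ⟨C, ?_⟩
  rintro _ ⟨x, rfl⟩
  set t : ℝ := x.im / τ.im with ht
  set s : ℝ := x.re - t * τ.re with hs
  have hx : x = s + t * τ := by
    apply Complex.ext
    · simp [hs]
    · simp [ht, hτ.ne']
  have e : ‖f x‖ = ‖f ((Int.fract s : ℝ) + (Int.fract t : ℝ) * τ)‖ := by
    have e1 := p2.sub_zsmul_eq (x := x) ⌊t⌋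
    have e2 := p1.sub_zsmul_eq (x := x - ⌊t⌋ • τ) ⌊s⌋
    rw [← e1, ← e2]
    congr 2
    rw [Int.fract, Int.fract, hx]
    push_cast
    simp only [zsmul_eq_mul]
    ring
  rw [e]
  apply hC
  exact ⟨_, ⟨(Int.fract s, Int.fract t), ⟨⟨Int.fract_nonneg _, (Int.fract_lt_one _).le⟩,
    ⟨Int.fract_nonneg _, (Int.fract_lt_one _).le⟩⟩, rfl⟩, rfl⟩

/-- An entire function with unimodular multipliers, not both trivial, vanishes. -/
lemma eq_zero_of_unimodular_multipliers {τ : ℂ} (hτ : 0 < τ.im) {f : ℂ → ℂ}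
    (hf : Differentiable ℂ f) {a b : ℂ} (ha : ‖a‖ = 1) (hb : ‖b‖ = 1)
    (h1 : ∀ x, f (x + 1) = a * f x) (h2 : ∀ x, f (x + τ) = b * f x) (hab : a ≠ 1 ∨ b ≠ 1)
    (x : ℂ) : f x = 0 := by
  have hc := const_of_unimodular_multipliers hτ hf ha hb h1 h2
  by_contra h0
  rcases hab with h | h
  · exact h (mul_right_cancel₀ h0 (by rw [one_mul, ← h1, hc (x + 1) x]))
  · exact h (mul_right_cancel₀ h0 (by rw [one_mul, ← h2, hc (x + τ) x]))

/-- An entire function is divisible by an entire function with simple zeros if it vanishes at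
each of them. -/
lemma exists_entire_quotient {f g : ℂ → ℂ} (hf : Differentiable ℂ f) (hg : Differentiable ℂ g)
    (hfg : ∀ x, g x = 0 → f x = 0) (hg' : ∀ x, g x = 0 → deriv g x ≠ 0) :
    ∃ k : ℂ → ℂ, Differentiable ℂ k ∧ ∀ x, f x = g x * k x := by
  classical
  -- At a zero of `g` the quotient takes the value given by L'Hôpital's rule, which is meaningful
  -- because the zero is simple.
  let k : ℂ → ℂ := fun x => if g x = 0 then deriv f x / deriv g x else f x / g x
  have kd : ∀ x, g x ≠ 0 → DifferentiableAt ℂ k x := by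
    intro x hx
    have : k =ᶠ[𝓝 x] fun y => f y / g y := by
      filter_upwards [hg.continuous.continuousAt.eventually_ne hx] with y hy
      simp [k, hy]
    exact ((hf x).div (hg x) hx).congr_of_eventuallyEq this
  refine ⟨k, fun x => ?_, fun x => ?_⟩
  · by_cases hx : g x = 0
    · have cf : ContinuousAt (dslope f x) x := continuousAt_dslope_same.2 (hf x)
      have cg : ContinuousAt (dslope g x) x := continuousAt_dslope_same.2 (hg x)
      have hne : ∀ᶠ y in 𝓝 x, dslope g x y ≠ 0 :=
        cg.eventually_ne (by rw [dslope_same]; exact hg' x hx)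
      have hgy : ∀ y, g y = (y - x) * dslope g x y := fun y => by
        have := sub_smul_dslope g x y
        rw [smul_eq_mul] at this
        rw [this, hx, sub_zero]
      have hfy : ∀ y, f y = (y - x) * dslope f x y := fun y => by
        have := sub_smul_dslope f x y
        rw [smul_eq_mul] at this
        rw [this, hfg x hx, sub_zero]
      have kk : k =ᶠ[𝓝 x] fun y => dslope f x y / dslope g x y := by
        filter_upwards [hne] with y hy
        by_cases hyx : y = x
        · subst hyx; simp [k, hx, dslope_same]
        · have h0 : y - x ≠ 0 := sub_ne_zero.2 hyx
          have : g y ≠ 0 := by rw [hgy]; exact mul_ne_zero h0 hy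
          simp only [k, this, if_false]
          rw [hfy, hgy, mul_div_mul_left _ _ h0]
      -- Removable singularity: `k` is differentiable on a punctured neighbourhood, and continuous
      -- at `x` as a quotient of the slopes of `f` and `g`.
      refine (Complex.analyticAt_of_differentiable_on_punctured_nhds_of_continuousAt ?_
        ?_).differentiableAt
      · rw [eventually_nhdsWithin_iff]
        filter_upwards [hne] with y hy hyx
        exact kd y (by rw [hgy]; exact mul_ne_zero (sub_ne_zero.2 hyx) hy)
      · exact (cf.div cg (by rw [dslope_same]; exact hg' x hx)).congr kk.symm
    · exact kd x hx
  · by_cases hx : g x = 0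
    · simp [hx, hfg x hx]
    · simp [k, hx]; field_simp

/-! ### The exponential `ex` -/

lemma ex_add (x y : ℂ) : ex (x + y) = ex x * ex y := by
  simp only [ex, mul_add, Complex.exp_add]

lemma ex_zero : ex 0 = 1 := by simp [ex]

lemma ex_ne_zero (x : ℂ) : ex x ≠ 0 := Complex.exp_ne_zero _

lemma ex_neg (x : ℂ) : ex (-x) = (ex x)⁻¹ := by
  simp only [ex, mul_neg, Complex.exp_neg]

lemma ex_nat_mul (n : ℕ) (x : ℂ) : ex (n * x) = ex x ^ n := by
  simp only [ex, ← Complex.exp_nat_mul]; congr 1; ring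

lemma ex_int_mul (n : ℤ) (x : ℂ) : ex (n * x) = ex x ^ n := by
  simp only [ex, ← Complex.exp_int_mul]; congr 1; ring

lemma ex_one : ex 1 = -1 := by simp [ex]

lemma ex_two_int (n : ℤ) : ex (2 * n) = 1 := by
  rw [mul_comm, ex_int_mul, show (2 : ℂ) = 1 + 1 by norm_num, ex_add, ex_one]; simp

lemma ex_eq_one_iff (x : ℂ) : ex x = 1 ↔ ∃ n : ℤ, x = 2 * n := by
  rw [ex, Complex.exp_eq_one_iff]
  have : (Real.pi * I : ℂ) ≠ 0 := by simp [Real.pi_ne_zero]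
  refine exists_congr fun n => ⟨fun h => mul_left_cancel₀ this (by rw [h]; ring), fun h => ?_⟩
  rw [h]; ring

lemma norm_ex (x : ℂ) : ‖ex x‖ = Real.exp (-(Real.pi * x.im)) := by
  simp [ex, Complex.norm_exp]

lemma norm_ex_lt_one {x : ℂ} (hx : 0 < x.im) : ‖ex x‖ < 1 := by
  rw [norm_ex]; simp; positivity

lemma differentiable_ex : Differentiable ℂ ex := by unfold ex; fun_prop

@[fun_prop]
lemma Differentiable.ex_comp {f : ℂ → ℂ} (hf : Differentiable ℂ f) :
    Differentiable ℂ fun x => ex (f x) := differentiable_ex.comp hf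

/-! ### Infinite products -/

lemma summable_poch {a : ℂ} (ha : ‖a‖ < 1) (x : ℂ) : Summable fun n : ℕ => ‖-(x * a ^ n)‖ := by
  simp only [norm_neg, norm_mul, norm_pow]
  exact (summable_geometric_of_lt_one (norm_nonneg _) ha).mul_left _

lemma multipliable_poch {a : ℂ} (ha : ‖a‖ < 1) (x : ℂ) :
    Multipliable fun n : ℕ => (1 - x * a ^ n) := by
  simpa [sub_eq_add_neg] using multipliable_one_add_of_summable (summable_poch ha x)

lemma poch_ne_zero {a : ℂ} (ha : ‖a‖ < 1) {x : ℂ} (h : ∀ n : ℕ, x * a ^ n ≠ 1) :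
    poch x a ≠ 0 := by
  have := tprod_one_add_ne_zero_of_summable (f := fun n : ℕ => -(x * a ^ n))
    (fun n => by rw [← sub_eq_add_neg]; exact sub_ne_zero.2 (h n).symm) (summable_poch ha x)
  simpa [poch, sub_eq_add_neg] using this

lemma poch_eq {a : ℂ} (ha : ‖a‖ < 1) (x : ℂ) : poch x a = (1 - x) * poch (x * a) a := by
  have h : ∀ n : ℕ, 1 - x * a ^ (n + 1) = 1 - x * a * a ^ n := fun n => by ring
  have hm : Multipliable fun n : ℕ => 1 - x * a ^ (n + 1) :=
    (multipliable_poch ha (x * a)).congr fun n => (h n).symm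
  calc poch x a = (1 - x * a ^ 0) * ∏' n : ℕ, (1 - x * a ^ (n + 1)) :=
        tprod_eq_zero_mul' (f := fun n : ℕ => 1 - x * a ^ n) hm
    _ = (1 - x) * poch (x * a) a := by
        rw [pow_zero, mul_one, tprod_congr h]; rfl

lemma differentiable_poch {a : ℂ} (ha : ‖a‖ < 1) : Differentiable ℂ fun x => poch x a := by
  intro x
  have hK : IsOpen (Metric.ball (0 : ℂ) (‖x‖ + 1)) := Metric.isOpen_ball
  have hu : Summable fun n : ℕ => (‖x‖ + 1) * ‖a‖ ^ n :=
    (summable_geometric_of_lt_one (norm_nonneg _) ha).mul_left _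
  have := hu.hasProdLocallyUniformlyOn_nat_one_add hK (f := fun n y => -(y * a ^ n))
    (.of_forall fun n y hy => by
      simp only [norm_neg, norm_mul, norm_pow]
      gcongr
      exact (mem_ball_zero_iff.1 hy).le) (fun n => by fun_prop)
  have hd := this.differentiableOn (.of_forall fun _ => by
    simpa [Finset.prod_fn] using DifferentiableOn.finsetProd (fun _ _ => by fun_prop)) hK
  have := hd.differentiableAt (hK.mem_nhds (by simp : x ∈ _))
  simpa [poch, sub_eq_add_neg] using this

lemma summable_poch₂ {a b : ℂ} (ha : ‖a‖ < 1) (hb : ‖b‖ < 1) (x : ℂ) :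
    Summable fun n : ℕ × ℕ => ‖-(x * a ^ n.1 * b ^ n.2)‖ := by
  simp only [norm_neg, norm_mul, norm_pow, mul_assoc]
  exact ((summable_geometric_of_lt_one (norm_nonneg _) ha).mul_of_nonneg
    (summable_geometric_of_lt_one (norm_nonneg _) hb) (fun _ => by positivity)
    (fun _ => by positivity)).mul_left _

lemma multipliable_poch₂ {a b : ℂ} (ha : ‖a‖ < 1) (hb : ‖b‖ < 1) (x : ℂ) :
    Multipliable fun n : ℕ × ℕ => (1 - x * a ^ n.1 * b ^ n.2) := by
  simpa [sub_eq_add_neg] using multipliable_one_add_of_summable (summable_poch₂ ha hb x)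

lemma poch₂_ne_zero {a b : ℂ} (ha : ‖a‖ < 1) (hb : ‖b‖ < 1) {x : ℂ}
    (h : ∀ n m : ℕ, x * a ^ n * b ^ m ≠ 1) : poch₂ x a b ≠ 0 := by
  have := tprod_one_add_ne_zero_of_summable (f := fun n : ℕ × ℕ => -(x * a ^ n.1 * b ^ n.2))
    (fun n => by rw [← sub_eq_add_neg]; exact sub_ne_zero.2 (h n.1 n.2).symm)
    (summable_poch₂ ha hb x)
  simpa [poch₂, sub_eq_add_neg] using this

lemma poch₂_comm (x a b : ℂ) : poch₂ x a b = poch₂ x b a := by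
  unfold poch₂
  rw [← (Equiv.prodComm ℕ ℕ).tprod_eq]
  refine tprod_congr fun n => ?_
  simp [mul_right_comm]

/-- Splitting off the first row of the double product. -/
lemma poch₂_eq_left {a b : ℂ} (ha : ‖a‖ < 1) (hb : ‖b‖ < 1) (x : ℂ) :
    poch₂ x a b = poch x b * poch₂ (x * a) a b := by
  have slice : ∀ y n, HasProd (fun m : ℕ => 1 - y * a ^ n * b ^ m) (poch (y * a ^ n) b) :=
    fun y n => (multipliable_poch hb (y * a ^ n)).hasProd
  have H : ∀ y, HasProd (fun n => poch (y * a ^ n) b) (poch₂ y a b) := fun y =>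
    (multipliable_poch₂ ha hb y).hasProd.prod_fiberwise (slice y)
  have h : ∀ n : ℕ, poch (x * a ^ (n + 1)) b = poch (x * a * a ^ n) b := fun n => by
    rw [pow_succ']; ring_nf
  have hm : Multipliable fun n : ℕ => poch (x * a ^ (n + 1)) b :=
    (H (x * a)).multipliable.congr fun n => (h n).symm
  calc poch₂ x a b = ∏' n, poch (x * a ^ n) b := (H x).tprod_eq.symm
    _ = poch (x * a ^ 0) b * ∏' n : ℕ, poch (x * a ^ (n + 1)) b :=
        tprod_eq_zero_mul' (f := fun n : ℕ => poch (x * a ^ n) b) hm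
    _ = poch x b * poch₂ (x * a) a b := by
        rw [pow_zero, mul_one, tprod_congr h, (H (x * a)).tprod_eq]

/-! ### The product `Theta` -/

lemma Theta_mul_self {a : ℂ} (ha : ‖a‖ < 1) (ha0 : a ≠ 0) {x : ℂ} (hx : x ≠ 0) :
    Theta a (a * x) = -x⁻¹ * Theta a x := by
  unfold Theta
  have e : a * (a * x)⁻¹ = x⁻¹ := by field_simp
  rw [e, poch_eq ha x⁻¹, poch_eq ha x, mul_comm x a, mul_comm x⁻¹ a]
  field_simp
  ring

lemma Theta_ne_zero {a : ℂ} (ha : ‖a‖ < 1) (ha0 : a ≠ 0) {x : ℂ} (hx : x ≠ 0)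
    (h : ∀ n : ℤ, x * a ^ n ≠ 1) : Theta a x ≠ 0 := by
  unfold Theta
  refine mul_ne_zero (mul_ne_zero (poch_ne_zero ha fun n => ?_) (poch_ne_zero ha fun n hn => ?_))
    (poch_ne_zero ha fun n hn => ?_)
  · exact_mod_cast h n
  · apply h (-(n + 1))
    rw [zpow_neg, mul_inv_eq_one₀ (zpow_ne_zero _ ha0)]
    rw [zpow_add₀ ha0, zpow_natCast, zpow_one]
    field_simp at hn
    rw [← hn]; ring
  · have h1 : ‖a * a ^ n‖ < 1 := by
      rw [norm_mul, norm_pow]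
      exact mul_lt_one_of_nonneg_of_lt_one_left (norm_nonneg _) ha
        (pow_le_one₀ (norm_nonneg _) ha.le)
    rw [hn] at h1
    simp at h1

/-- A continuous function killed by an entire function with simple zeros vanishes. -/
lemma eq_zero_of_mul_eq_zero_of_simple_zeros {g F : ℂ → ℂ} (hg : Differentiable ℂ g)
    (hg' : ∀ x, g x = 0 → deriv g x ≠ 0) (hF : Continuous F) (h : ∀ x, g x * F x = 0) (x : ℂ) :
    F x = 0 := by
  by_cases hx : g x = 0
  · have hne : ∀ᶠ y in 𝓝[≠] x, g y ≠ 0 := by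
      simpa [hx] using (hg x).hasDerivAt.eventually_ne (c := 0) (hg' x hx)
    have h0 : ∀ᶠ y in 𝓝[≠] x, F y = 0 := hne.mono fun y hy => (mul_eq_zero.1 (h y)).resolve_left hy
    have t1 : Tendsto F (𝓝[≠] x) (𝓝 (F x)) := hF.continuousAt.tendsto.mono_left nhdsWithin_le_nhds
    have t2 : Tendsto F (𝓝[≠] x) (𝓝 0) := tendsto_const_nhds.congr' (h0.mono fun y hy => hy.symm)
    exact tendsto_nhds_unique t1 t2
  · exact (mul_eq_zero.1 (h x)).resolve_left hx

/-- Induction along the lattice `ℤ + ℤτ`. -/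
lemma lattice_induction {τ : ℂ} {S : ℂ → Prop} (h0 : S 0) (h1 : ∀ x, S (x + 1) ↔ S x)
    (h2 : ∀ x, S (x + τ) ↔ S x) (a b : ℤ) : S (a + b * τ) := by
  have p1 : Function.Periodic S 1 := fun x => propext (h1 x)
  have p2 : Function.Periodic S τ := fun x => propext (h2 x)
  have e1 := p1.int_mul a 0
  have e2 := p2.int_mul b (0 + a * 1)
  rw [e1] at e2
  have : S (0 + a * 1 + b * τ) := by rw [e2]; exact h0
  simpa using this

/-! ### A product model of the odd theta function -/

/-- The product form of the odd theta function, up to normalisation. -/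
def thetaProd (τ x : ℂ) : ℂ := ex (-x) * Theta (ex (2 * τ)) (ex (2 * x))

section
variable {τ : ℂ} (hτ : 0 < τ.im)
include hτ

lemma norm_ex_two_mul_lt_one : ‖ex (2 * τ)‖ < 1 := norm_ex_lt_one (by simpa using hτ)

lemma differentiable_thetaProd : Differentiable ℂ (thetaProd τ) := by
  have hp := differentiable_poch (norm_ex_two_mul_lt_one hτ)
  unfold thetaProd Theta
  simp only [← ex_neg]
  have d1 : Differentiable ℂ fun x : ℂ => poch (ex (2 * x)) (ex (2 * τ)) :=
    hp.comp (Differentiable.ex_comp (by fun_prop))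
  have d2 : Differentiable ℂ fun x : ℂ => poch (ex (2 * τ) * ex (-(2 * x))) (ex (2 * τ)) :=
    hp.comp ((Differentiable.ex_comp (by fun_prop)).const_mul _)
  exact (Differentiable.ex_comp (by fun_prop)).mul ((d1.mul d2).mul_const _)

omit hτ in
lemma thetaProd_add_one (x : ℂ) : thetaProd τ (x + 1) = -thetaProd τ x := by
  unfold thetaProd
  have : ex (2 * (x + 1)) = ex (2 * x) := by
    have := ex_two_int 1
    rw [mul_add, ex_add]; push_cast at this; rw [this, mul_one]
  rw [this, neg_add, ex_add, ex_neg 1, ex_one]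
  ring

lemma thetaProd_add_tau (x : ℂ) : thetaProd τ (x + τ) = -ex (-τ - 2 * x) * thetaProd τ x := by
  unfold thetaProd
  rw [mul_add, add_comm (2 * x), ex_add (2 * τ),
    Theta_mul_self (norm_ex_two_mul_lt_one hτ) (ex_ne_zero _) (ex_ne_zero _), neg_add, ex_add,
    sub_eq_add_neg, ex_add, ← ex_neg]
  ring

lemma thetaProd_zero : thetaProd τ 0 = 0 := by
  have : poch 1 (ex (2 * τ)) = 0 := by rw [poch_eq (norm_ex_two_mul_lt_one hτ)]; simp
  simp [thetaProd, Theta, ex_zero, this]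

lemma exists_of_thetaProd_eq_zero {x : ℂ} (h : thetaProd τ x = 0) :
    ∃ a b : ℤ, x = a + b * τ := by
  by_contra hc
  push Not at hc
  refine mul_ne_zero (ex_ne_zero _) (Theta_ne_zero (norm_ex_two_mul_lt_one hτ) (ex_ne_zero _)
    (ex_ne_zero _) fun n hn => ?_) h
  rw [← ex_int_mul, ← ex_add, ex_eq_one_iff] at hn
  obtain ⟨m, hm⟩ := hn
  apply hc m (-n)
  push_cast
  linear_combination hm / 2

/-- The factor `1 - e^{2iπx}` carries the zero at the origin; the cofactor `G` takes there the value
`(p; p)_∞³ ≠ 0`. -/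
lemma deriv_thetaProd_zero : deriv (thetaProd τ) 0 ≠ 0 := by
  have hp := differentiable_poch (norm_ex_two_mul_lt_one hτ)
  set G : ℂ → ℂ := fun x => ex (-x) * (poch (ex (2 * x) * ex (2 * τ)) (ex (2 * τ))
    * poch (ex (2 * τ) * ex (-(2 * x))) (ex (2 * τ)) * poch (ex (2 * τ)) (ex (2 * τ))) with hG
  have e : thetaProd τ = fun x => (1 - ex (2 * x)) * G x := by
    funext x
    simp only [thetaProd, Theta, hG, ← ex_neg]
    rw [poch_eq (norm_ex_two_mul_lt_one hτ) (ex (2 * x))]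
    ring
  have d1 : Differentiable ℂ fun x : ℂ => poch (ex (2 * x) * ex (2 * τ)) (ex (2 * τ)) :=
    hp.comp ((Differentiable.ex_comp (by fun_prop)).mul_const _)
  have d2 : Differentiable ℂ fun x : ℂ => poch (ex (2 * τ) * ex (-(2 * x))) (ex (2 * τ)) :=
    hp.comp ((Differentiable.ex_comp (by fun_prop)).const_mul _)
  have dG : Differentiable ℂ G :=
    (Differentiable.ex_comp (by fun_prop)).mul ((d1.mul d2).mul_const _)
  have G0 : G 0 ≠ 0 := by
    have key : poch (ex (2 * τ)) (ex (2 * τ)) ≠ 0 := by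
      refine poch_ne_zero (norm_ex_two_mul_lt_one hτ) fun n hn => ?_
      rw [← pow_succ', ← ex_nat_mul] at hn
      have h1 : ‖ex (((n + 1 : ℕ) : ℂ) * (2 * τ))‖ < 1 := norm_ex_lt_one (by
        rw [← ofReal_natCast, im_ofReal_mul, ← ofReal_ofNat, im_ofReal_mul]; positivity)
      rw [hn] at h1
      simp at h1
    simp only [hG, mul_zero, neg_zero, ex_zero, one_mul, mul_one]
    exact mul_ne_zero (mul_ne_zero key key) key
  have d3 : HasDerivAt (fun x : ℂ => 1 - ex (2 * x)) (-(2 * (Real.pi * I))) 0 := by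
    have : HasDerivAt (fun x : ℂ => Complex.exp (Real.pi * I * (2 * x)))
        (Complex.exp (Real.pi * I * (2 * 0)) * (Real.pi * I * (2 * 1))) 0 :=
      ((((hasDerivAt_id (0 : ℂ)).const_mul 2).const_mul (Real.pi * I))).cexp
    have h := this.const_sub 1
    have e : -(2 * (Real.pi * I)) = -(Complex.exp (Real.pi * I * (2 * 0)) * (Real.pi * I * (2 * 1)))
      := by rw [mul_zero, mul_zero, Complex.exp_zero]; ring
    rw [e]
    exact h
  have := d3.fun_mul (dG 0).hasDerivAt
  rw [e, HasDerivAt.deriv this]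
  simp [ex_zero, G0, Real.pi_ne_zero]

lemma deriv_thetaProd_ne_zero {x : ℂ} (h : thetaProd τ x = 0) : deriv (thetaProd τ) x ≠ 0 := by
  obtain ⟨a, b, rfl⟩ := exists_of_thetaProd_eq_zero hτ h
  have hd := differentiable_thetaProd hτ
  -- Vanishing and simplicity are propagated together: in the derivative of the `τ`-multiplier
  -- relation, the term with the differentiated multiplier disappears only where the function
  -- vanishes.
  refine (lattice_induction (τ := τ) (S := fun x => thetaProd τ x = 0 ∧ deriv (thetaProd τ) x ≠ 0)
    ⟨thetaProd_zero hτ, deriv_thetaProd_zero hτ⟩ (fun x => ?_) (fun x => ?_) a b).2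
  · have : deriv (thetaProd τ) (x + 1) = -deriv (thetaProd τ) x := by
      rw [← deriv_comp_add_const, funext fun x => thetaProd_add_one (τ := τ) x, deriv.fun_neg]
    rw [this, thetaProd_add_one]; simp
  · have : deriv (thetaProd τ) (x + τ) = deriv (fun x => -ex (-τ - 2 * x)) x * thetaProd τ x
        + -ex (-τ - 2 * x) * deriv (thetaProd τ) x := by
      rw [← deriv_comp_add_const, funext fun x => thetaProd_add_tau hτ x]
      refine deriv_fun_mul (Differentiable.neg (Differentiable.ex_comp ?_) x) (hd x)
      fun_prop
    rw [thetaProd_add_tau hτ, this]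
    constructor
    · rintro ⟨u, v⟩
      have u' : thetaProd τ x = 0 := by simpa [ex_ne_zero] using u
      rw [u'] at v
      exact ⟨u', fun hh => v (by rw [hh]; simp)⟩
    · rintro ⟨u, v⟩
      rw [u]
      simp [ex_ne_zero, v]

/-- Entire functions with the multipliers of the odd theta function are proportional to it. -/
lemma eq_const_mul_thetaProd {h : ℂ → ℂ} (hd : Differentiable ℂ h)
    (h1 : ∀ x, h (x + 1) = -h x) (h2 : ∀ x, h (x + τ) = -ex (-τ - 2 * x) * h x) :
    ∃ c, ∀ x, h x = c * thetaProd τ x := by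
  have dP := differentiable_thetaProd hτ
  have h1n : ∀ x, h (-(x + 1)) = -h (-x) := fun x => by
    have := h1 (-(x + 1)); rw [show -(x + 1) + 1 = -x by ring] at this; rw [this, neg_neg]
  have h2n : ∀ x, h (-(x + τ)) = -ex (-τ - 2 * x) * h (-x) := fun x => by
    have := h2 (-(x + τ))
    rw [show -(x + τ) + τ = -x by ring] at this
    rw [this, show -ex (-τ - 2 * x) * (-ex (-τ - 2 * -(x + τ)) * h (-(x + τ)))
      = (ex (-τ - 2 * x) * ex (-τ - 2 * -(x + τ))) * h (-(x + τ)) by ring, ← ex_add,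
      show -τ - 2 * x + (-τ - 2 * -(x + τ)) = 0 by ring, ex_zero, one_mul]
  -- the even part vanishes
  have hodd : ∀ x, h x + h (-x) = 0 := by
    set he : ℂ → ℂ := fun x => h x + h (-x) with hhe
    have dhe : Differentiable ℂ he := hd.add (hd.comp differentiable_neg)
    have e1 : ∀ x, he (x + 1) = -he x := fun x => by simp only [hhe]; rw [h1, h1n]; ring
    have e2 : ∀ x, he (x + τ) = -ex (-τ - 2 * x) * he x := fun x => by
      simp only [hhe]; rw [h2, h2n]; ring
    -- Antiperiodicity and evenness force the even part to vanish at `1/2`, hence on the zeros of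
    -- this translate. The `τ`-multipliers of the two differ by a sign, so the quotient has
    -- multipliers `1` and `-1` and is zero.
    set g : ℂ → ℂ := fun x => thetaProd τ (x - 1 / 2) with hg
    have dg : Differentiable ℂ g := dP.comp (by fun_prop)
    have g' : ∀ x, g x = 0 → deriv g x ≠ 0 := fun x hx => by
      rw [hg, deriv_comp_sub_const]; exact deriv_thetaProd_ne_zero hτ hx
    obtain ⟨k, dk, hk⟩ := exists_entire_quotient dhe dg (fun x hx => by
      obtain ⟨a, b, hab⟩ := exists_of_thetaProd_eq_zero hτ hx
      have := lattice_induction (τ := τ) (S := fun x => he (x + 1 / 2) = 0) ?_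
        (fun x => by
          rw [show x + 1 + 1 / 2 = x + 1 / 2 + 1 by ring, e1, neg_eq_zero])
        (fun x => by
          rw [show x + τ + 1 / 2 = x + 1 / 2 + τ by ring, e2]; simp [ex_ne_zero]) a b
      · rw [← hab] at this; simpa using this
      · have h3 := e1 (-(1 / 2))
        have h4 : he (-(1 / 2)) = he (1 / 2) := by simp only [hhe, neg_neg]; ring
        rw [show -(1 / 2 : ℂ) + 1 = 1 / 2 by norm_num, h4] at h3
        rw [zero_add]
        linear_combination h3 / 2) g'
    have g1 : ∀ x, g (x + 1) = -g x := fun x => by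
      simp only [hg]; rw [show x + 1 - 1 / 2 = x - 1 / 2 + 1 by ring, thetaProd_add_one]
    have g2 : ∀ x, g (x + τ) = ex (-τ - 2 * x) * g x := fun x => by
      simp only [hg]
      rw [show x + τ - 1 / 2 = x - 1 / 2 + τ by ring, thetaProd_add_tau hτ,
        show -τ - 2 * (x - 1 / 2) = -τ - 2 * x + 1 by ring, ex_add, ex_one]
      ring
    have k1 : ∀ x, k (x + 1) = 1 * k x := fun x => by
      have := eq_zero_of_mul_eq_zero_of_simple_zeros dg g' (F := fun x => k (x + 1) - k x)
        ((dk.continuous.comp (by fun_prop)).sub dk.continuous) (fun x => by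
          have u := hk (x + 1); rw [g1, e1, hk x] at u
          linear_combination u) x
      linear_combination this
    have k2 : ∀ x, k (x + τ) = -1 * k x := fun x => by
      have := eq_zero_of_mul_eq_zero_of_simple_zeros dg g' (F := fun x => k (x + τ) + k x)
        ((dk.continuous.comp (by fun_prop)).add dk.continuous) (fun x => by
          have u := hk (x + τ); rw [g2, e2, hk x] at u
          refine (mul_eq_zero.1 (?_ : ex (-τ - 2 * x) * _ = 0)).resolve_left (ex_ne_zero _)
          linear_combination -u) x
      linear_combination this
    intro x
    have := hk x
    rw [eq_zero_of_unimodular_multipliers hτ dk (by simp) (by simp) k1 k2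
      (Or.inr (by norm_num)), mul_zero] at this
    exact this
  -- Being odd, `h` vanishes at the origin, hence on the whole lattice; its quotient by `thetaProd`
  -- has trivial multipliers.
  have h0 : h 0 = 0 := by have := hodd 0; rw [neg_zero] at this; linear_combination this / 2
  obtain ⟨k, dk, hk⟩ := exists_entire_quotient hd dP (fun x hx => by
      obtain ⟨a, b, rfl⟩ := exists_of_thetaProd_eq_zero hτ hx
      exact lattice_induction (τ := τ) (S := fun x => h x = 0) h0
        (fun x => by rw [h1, neg_eq_zero]) (fun x => by rw [h2]; simp [ex_ne_zero]) a b)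
    (fun x hx => deriv_thetaProd_ne_zero hτ hx)
  have k1 : ∀ x, k (x + 1) = 1 * k x := fun x => by
    have := eq_zero_of_mul_eq_zero_of_simple_zeros dP (fun x hx => deriv_thetaProd_ne_zero hτ hx)
      (F := fun x => k (x + 1) - k x)
      ((dk.continuous.comp (by fun_prop)).sub dk.continuous) (fun x => by
        have u := hk (x + 1); rw [thetaProd_add_one, h1, hk x] at u
        linear_combination u) x
    linear_combination this
  have k2 : ∀ x, k (x + τ) = 1 * k x := fun x => by
    have := eq_zero_of_mul_eq_zero_of_simple_zeros dP (fun x hx => deriv_thetaProd_ne_zero hτ hx)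
      (F := fun x => k (x + τ) - k x)
      ((dk.continuous.comp (by fun_prop)).sub dk.continuous) (fun x => by
        have u := hk (x + τ); rw [thetaProd_add_tau hτ, h2, hk x] at u
        refine (mul_eq_zero.1 (?_ : ex (-τ - 2 * x) * _ = 0)).resolve_left (ex_ne_zero _)
        linear_combination u) x
    linear_combination this
  refine ⟨k 0, fun x => ?_⟩
  rw [hk x, const_of_unimodular_multipliers hτ dk (by simp) (by simp) k1 k2 x 0, mul_comm]

end

/-! ### Theta functions with characteristics -/

lemma thetaChar_eq_jacobiTheta₂ (γ₁ γ₂ ξ τ : ℂ) :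
    thetaChar γ₁ γ₂ ξ τ
      = ex (γ₁ ^ 2 * τ + 2 * γ₁ * (ξ + γ₂)) * jacobiTheta₂ (ξ + γ₂ + γ₁ * τ) τ := by
  unfold thetaChar jacobiTheta₂
  rw [← tsum_mul_left]
  refine tsum_congr fun m => ?_
  rw [ex, jacobiTheta₂_term, ← Complex.exp_add]
  congr 1; ring

lemma differentiable_thetaChar (γ₁ γ₂ : ℂ) {τ : ℂ} (hτ : 0 < τ.im) :
    Differentiable ℂ fun ξ => thetaChar γ₁ γ₂ ξ τ := by
  simp only [thetaChar_eq_jacobiTheta₂]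
  have h : Differentiable ℂ fun z => jacobiTheta₂ z τ :=
    fun z => differentiableAt_jacobiTheta₂_fst z hτ
  exact (Differentiable.ex_comp (by fun_prop)).mul
    (h.comp (f := fun ξ : ℂ => ξ + γ₂ + γ₁ * τ) (by fun_prop))

lemma thetaChar_add_lattice (γ₁ γ₂ ξ τ : ℂ) (a b : ℤ) :
    thetaChar γ₁ γ₂ (ξ + (a + b * τ)) τ
      = ex (2 * a * γ₁ - b ^ 2 * τ - 2 * b * (ξ + γ₂)) * thetaChar γ₁ γ₂ ξ τ := by
  unfold thetaChar
  conv_rhs => rw [← (Equiv.addRight b).tsum_eq]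
  rw [← tsum_mul_left]
  refine tsum_congr fun m => ?_
  rw [ex, ← Complex.exp_add, ← mul_one (Complex.exp (_ + _)),
    ← Complex.exp_int_mul_two_pi_mul_I (-(m * a)), ← Complex.exp_add]
  congr 1
  simp only [Equiv.coe_addRight]
  push_cast
  ring

lemma thetaChar_neg (γ₁ γ₂ ξ τ : ℂ) : thetaChar (-γ₁) (-γ₂) (-ξ) τ = thetaChar γ₁ γ₂ ξ τ := by
  unfold thetaChar
  rw [← (Equiv.neg ℤ).tsum_eq]
  refine tsum_congr fun m => ?_
  congr 1
  simp only [Equiv.neg_apply]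
  push_cast
  ring

lemma thetaChar_add_int_left (γ₁ γ₂ ξ τ : ℂ) (n : ℤ) :
    thetaChar (γ₁ + n) γ₂ ξ τ = thetaChar γ₁ γ₂ ξ τ := by
  unfold thetaChar
  conv_rhs => rw [← (Equiv.addRight n).tsum_eq]
  refine tsum_congr fun m => ?_
  congr 1
  simp only [Equiv.coe_addRight]
  push_cast
  ring

lemma thetaChar_add_int_right (γ₁ γ₂ ξ τ : ℂ) (n : ℤ) :
    thetaChar γ₁ (γ₂ + n) ξ τ = ex (2 * n * γ₁) * thetaChar γ₁ γ₂ ξ τ := by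
  unfold thetaChar
  rw [← tsum_mul_left]
  refine tsum_congr fun m => ?_
  rw [ex, ← Complex.exp_add, ← mul_one (Complex.exp (_ + _)),
    ← Complex.exp_int_mul_two_pi_mul_I (-(m * n)), ← Complex.exp_add]
  congr 1
  push_cast
  ring

/-- The odd theta function. -/
def th (τ x : ℂ) : ℂ := thetaChar (1 / 2) (1 / 2) x τ

/-- Theta functions with all characteristics are translates of the odd one up to an exponential, so
that their zeros are known once those of `th` are. -/
lemma thetaChar_eq_th (s t x τ : ℂ) :
    thetaChar (1 / 2 + s) (1 / 2 + t) x τ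
      = ex (s ^ 2 * τ + 2 * s * (x + 1 / 2 + t)) * th τ (x + t + s * τ) := by
  unfold th thetaChar
  rw [← tsum_mul_left]
  refine tsum_congr fun m => ?_
  rw [ex, ← Complex.exp_add]
  congr 1; ring

lemma th_add_lattice (τ x : ℂ) (a b : ℤ) :
    th τ (x + (a + b * τ)) = ex (a + b - b ^ 2 * τ - 2 * b * x) * th τ x := by
  unfold th
  have e : (a + b - b ^ 2 * τ - 2 * b * x : ℂ)
      = 2 * a * (1 / 2) - b ^ 2 * τ - 2 * b * (x + 1 / 2) + 2 * b := by ring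
  rw [thetaChar_add_lattice, e, ex_add, ex_two_int, mul_one]

lemma th_add_one (τ x : ℂ) : th τ (x + 1) = -th τ x := by
  have := th_add_lattice τ x 1 0
  simp [ex_one] at this
  exact this

lemma th_add_tau (τ x : ℂ) : th τ (x + τ) = -ex (-τ - 2 * x) * th τ x := by
  have := th_add_lattice τ x 0 1
  simp only [Int.cast_zero, Int.cast_one, one_mul, zero_add, one_pow, mul_one] at this
  rw [this, show 1 - τ - 2 * x = 1 + (-τ - 2 * x) by ring, ex_add, ex_one]
  ring

lemma th_neg (τ x : ℂ) : th τ (-x) = -th τ x := by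
  unfold th
  have h := thetaChar_neg (1 / 2) (1 / 2) x τ
  have h1 := thetaChar_add_int_left (-(1 / 2)) (1 / 2) (-x) τ 1
  have h2 := thetaChar_add_int_right (-(1 / 2)) (-(1 / 2)) (-x) τ 1
  rw [h] at h2
  push_cast at h1 h2
  rw [show -(1 / 2 : ℂ) + 1 = 1 / 2 by norm_num] at h1 h2
  rw [h1, h2, show 2 * 1 * -(1 / 2 : ℂ) = -1 by norm_num, ex_neg, ex_one]
  norm_num

section
variable {τ : ℂ} (hτ : 0 < τ.im)
include hτ

lemma differentiable_th : Differentiable ℂ (th τ) := differentiable_thetaChar _ _ hτ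

/-- On the real segment `[0, 1]` the defining series is a Fourier series whose zeroth coefficient is
`1`. This excludes the constant `0` when `th` is compared with its product form. -/
lemma exists_jacobiTheta₂_ne_zero : ∃ z, jacobiTheta₂ z τ ≠ 0 := by
  by_contra hc
  push Not at hc
  set μ := MeasureTheory.volume.restrict (Set.Ioc (0 : ℝ) 1) with hμ
  have hcont : ∀ n : ℤ, Continuous fun x : ℝ => jacobiTheta₂_term n x τ := fun n => by
    unfold jacobiTheta₂_term; fun_prop
  have hnorm : ∀ (n : ℤ) (x : ℝ), ‖jacobiTheta₂_term n x τ‖ = ‖jacobiTheta₂_term n 0 τ‖ :=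
    fun n x => by simp [norm_jacobiTheta₂_term]
  have hterm : ∀ n : ℤ, MeasureTheory.Integrable (fun x : ℝ => jacobiTheta₂_term n x τ) μ :=
    fun n => (hcont n).integrableOn_Ioc
  have hsum := MeasureTheory.hasSum_integral_of_summable_integral_norm hterm (by
    simp only [hnorm]
    simp only [hμ, MeasureTheory.integral_const]
    simpa using ((summable_jacobiTheta₂_term_iff 0 τ).2 hτ).norm)
  have hz : (∫ x : ℝ, ∑' n : ℤ, jacobiTheta₂_term n x τ ∂μ) = 0 := by
    have : ∀ x : ℝ, ∑' n : ℤ, jacobiTheta₂_term n x τ = 0 := fun x => hc x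
    simp [this]
  have h0 : (∫ x : ℝ, jacobiTheta₂_term 0 x τ ∂μ) = 1 := by simp [jacobiTheta₂_term, hμ]
  have hn : ∀ n : ℤ, n ≠ 0 → (∫ x : ℝ, jacobiTheta₂_term n x τ ∂μ) = 0 := fun n hn => by
    have h2 : (2 * Real.pi * I * n : ℂ) ≠ 0 := by
      simp [Real.pi_ne_zero, hn]
    rw [hμ, ← intervalIntegral.integral_of_le zero_le_one]
    simp only [jacobiTheta₂_term, Complex.exp_add]
    rw [intervalIntegral.integral_mul_const, integral_exp_mul_complex h2]
    have : Complex.exp (2 * Real.pi * I * n * (1 : ℝ)) = 1 := by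
      rw [← Complex.exp_int_mul_two_pi_mul_I n]; congr 1; push_cast; ring
    rw [this]
    simp
  rw [hz] at hsum
  have h1 := hasSum_single (f := fun n : ℤ => ∫ x : ℝ, jacobiTheta₂_term n x τ ∂μ) 0
    (fun n h => hn n h)
  rw [h0] at h1
  exact one_ne_zero (h1.unique hsum)

/-- The odd theta function is a non-zero multiple of its product form. -/
lemma exists_th_eq_thetaProd : ∃ c, c ≠ 0 ∧ ∀ x, th τ x = c * thetaProd τ x := by
  obtain ⟨c, hc⟩ := eq_const_mul_thetaProd hτ (differentiable_th hτ) (th_add_one τ) (th_add_tau τ)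
  refine ⟨c, fun h0 => ?_, hc⟩
  obtain ⟨z, hz⟩ := exists_jacobiTheta₂_ne_zero hτ
  have := hc (z - 1 / 2 - 1 / 2 * τ)
  rw [h0, zero_mul, th, thetaChar_eq_jacobiTheta₂] at this
  have e : z - 1 / 2 - 1 / 2 * τ + 1 / 2 + 1 / 2 * τ = z := by ring
  rw [e] at this
  exact (mul_ne_zero (ex_ne_zero _) hz) this

lemma th_eq_zero_iff (x : ℂ) : th τ x = 0 ↔ ∃ a b : ℤ, x = a + b * τ := by
  obtain ⟨c, hc, h⟩ := exists_th_eq_thetaProd hτ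
  constructor
  · intro hx
    rw [h] at hx
    exact exists_of_thetaProd_eq_zero hτ ((mul_eq_zero.1 hx).resolve_left hc)
  · rintro ⟨a, b, rfl⟩
    have := th_add_lattice τ 0 a b
    rw [zero_add] at this
    rw [this, h 0, thetaProd_zero hτ]
    simp

lemma th_zero : th τ 0 = 0 := (th_eq_zero_iff hτ 0).2 ⟨0, 0, by simp⟩

lemma deriv_th_ne_zero {x : ℂ} (hx : th τ x = 0) : deriv (th τ) x ≠ 0 := by
  obtain ⟨c, hc, h⟩ := exists_th_eq_thetaProd hτ
  have e : th τ = fun x => c * thetaProd τ x := funext h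
  rw [e, deriv_const_mul_field]
  rw [h] at hx
  exact mul_ne_zero hc (deriv_thetaProd_ne_zero hτ ((mul_eq_zero.1 hx).resolve_left hc))

/-- Entire functions with the multipliers of a translate of the odd theta function are
proportional to this translate. -/
lemma eq_const_mul_th {h : ℂ → ℂ} (hd : Differentiable ℂ h) (s : ℂ)
    (h1 : ∀ x, h (x + 1) = -h x) (h2 : ∀ x, h (x + τ) = -ex (-τ - 2 * (x + s)) * h x) :
    ∃ c, ∀ x, h x = c * th τ (x + s) := by
  obtain ⟨c, hc⟩ := eq_const_mul_thetaProd hτ (h := fun x => h (x - s)) (hd.comp (by fun_prop))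
    (fun x => by rw [← h1]; congr 1; ring)
    (fun x => by rw [show x + τ - s = x - s + τ by ring, h2]; simp)
  obtain ⟨c', hc', h'⟩ := exists_th_eq_thetaProd hτ
  refine ⟨c / c', fun x => ?_⟩
  have := hc (x + s)
  rw [add_sub_cancel_right] at this
  rw [this, h']
  field_simp

/-- Entire functions vanishing where a translate of the odd theta function does are divisible by
it; multipliers can be divided as well. -/
lemma exists_eq_th_mul {f : ℂ → ℂ} (hf : Differentiable ℂ f) (s : ℂ)
    (h0 : ∀ x, th τ (x + s) = 0 → f x = 0) :
    ∃ k : ℂ → ℂ, Differentiable ℂ k ∧ ∀ x, f x = th τ (x + s) * k x :=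
  exists_entire_quotient hf ((differentiable_th hτ).comp (by fun_prop)) h0 fun x hx => by
    rw [show (fun x => th τ (x + s)) = fun x => th τ (x + s) from rfl, deriv_comp_add_const]
    exact deriv_th_ne_zero hτ hx

lemma eq_of_th_mul_eq {f g : ℂ → ℂ} (hf : Continuous f) (hg : Continuous g) (s : ℂ)
    (h : ∀ x, th τ (x + s) * f x = th τ (x + s) * g x) (x : ℂ) : f x = g x :=
  sub_eq_zero.1 <| eq_zero_of_mul_eq_zero_of_simple_zeros (g := fun x => th τ (x + s))
    (F := fun x => f x - g x)
    ((differentiable_th hτ).comp (by fun_prop))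
    (fun x hx => by rw [deriv_comp_add_const]; exact deriv_th_ne_zero hτ hx)
    (hf.sub hg) (fun x => by rw [mul_sub, h, sub_self]) x

end

/-! ### Roots of unity and the characters of `(ℤ/N)²` -/

section
variable {N : ℕ} [NeZero N]

/-- `ω^n` with `ω = exp (2iπ/N)`. -/
def om (N : ℕ) (n : ℤ) : ℂ := ex (2 * n / N)

omit [NeZero N] in
lemma om_add (m n : ℤ) : om N (m + n) = om N m * om N n := by
  simp only [om, ← ex_add]; congr 1; push_cast; ring

omit [NeZero N] in
lemma om_zero : om N 0 = 1 := by simp [om, ex_zero]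

omit [NeZero N] in
lemma om_ne_zero (n : ℤ) : om N n ≠ 0 := ex_ne_zero _

lemma om_eq_one_iff (n : ℤ) : om N n = 1 ↔ (N : ℤ) ∣ n := by
  have hN : (N : ℂ) ≠ 0 := NeZero.ne _
  rw [om, ex_eq_one_iff]
  constructor
  · rintro ⟨k, hk⟩
    refine ⟨k, ?_⟩
    field_simp at hk
    exact_mod_cast hk
  · rintro ⟨k, rfl⟩
    refine ⟨k, ?_⟩
    push_cast
    field_simp

lemma om_congr {m n : ℤ} (h : m ≡ n [ZMOD N]) : om N m = om N n := by
  have h1 : om N (n - m) = 1 := (om_eq_one_iff _).2 h.dvd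
  have := om_add (N := N) (n - m) m
  rw [sub_add_cancel, h1, one_mul] at this
  exact this.symm

omit [NeZero N] in
lemma om_neg (n : ℤ) : om N (-n) = (om N n)⁻¹ := by
  refine eq_inv_of_mul_eq_one_left ?_
  rw [← om_add, neg_add_cancel, om_zero]

omit [NeZero N] in
lemma norm_om (n : ℤ) : ‖om N n‖ = 1 := by
  rw [om, norm_ex]
  have : (2 * (n : ℂ) / N).im = 0 := by
    rw [show (2 * (n : ℂ) / N) = ((2 * n / N : ℝ) : ℂ) by push_cast; rfl, ofReal_im]
  simp [this]

omit [NeZero N] in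
lemma val_add_modEq (i j : Fin N) : (((i + j : Fin N) : ℕ) : ℤ) ≡ i + j [ZMOD N] := by
  rw [Fin.val_add]
  push_cast
  exact Int.mod_modEq _ _

lemma val_sub_modEq (i j : Fin N) : (((i - j : Fin N) : ℕ) : ℤ) ≡ i - j [ZMOD N] := by
  have h := val_add_modEq (i - j) j
  rw [sub_add_cancel] at h
  simpa using (h.symm.sub_right (j : ℤ))

lemma val_neg_modEq (i : Fin N) : (((-i : Fin N) : ℕ) : ℤ) ≡ -i [ZMOD N] := by
  have h := val_sub_modEq 0 i
  simpa using h

lemma val_eq_zero_of_dvd {i : Fin N} (h : (N : ℤ) ∣ (i : ℕ)) : i = 0 := by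
  have h1 : N ∣ (i : ℕ) := by exact_mod_cast h
  exact Fin.ext (by simpa using Nat.eq_zero_of_dvd_of_lt h1 i.2)

lemma sum_om_mul {a : ℤ} (ha : ¬ (N : ℤ) ∣ a) : ∑ i : Fin N, om N (a * (i : ℕ)) = 0 := by
  have h1 : ∀ i : ℕ, om N (a * i) = om N a ^ i := fun i => by
    rw [om, om, ← ex_nat_mul]; congr 1; push_cast; ring
  rw [Fin.sum_univ_eq_sum_range (fun i => om N (a * i)) N]
  simp only [h1]
  have h2 : om N a ≠ 1 := fun h => ha ((om_eq_one_iff a).1 h)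
  rw [geom_sum_eq h2, ← h1, (om_eq_one_iff _).2 ⟨a, by ring⟩, sub_self, zero_div]

lemma sum_om_mul_sub {a b : ℤ} (h : ¬ ((N : ℤ) ∣ a ∧ (N : ℤ) ∣ b)) :
    ∑ α : Fin N × Fin N, om N (a * (α.1 : ℕ) - b * (α.2 : ℕ)) = 0 := by
  have e : ∀ α : Fin N × Fin N, om N (a * (α.1 : ℕ) - b * (α.2 : ℕ))
      = om N (a * (α.1 : ℕ)) * om N (-b * (α.2 : ℕ)) := fun α => by
    rw [← om_add]; congr 1; ring
  simp only [e]
  rw [Fintype.sum_prod_type]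
  simp only [← Finset.mul_sum, ← Finset.sum_mul]
  rw [not_and_or] at h
  rcases h with h | h
  · rw [sum_om_mul h, zero_mul]
  · rw [sum_om_mul (a := -b) (by rwa [dvd_neg]), mul_zero]

/-- The symplectic pairing on `(ℤ/N)²`. -/
def chi (α β : Fin N × Fin N) : ℂ :=
  om N ((α.1 : ℕ) * (β.2 : ℕ) - (α.2 : ℕ) * (β.1 : ℕ))

omit [NeZero N] in
lemma chi_ne_zero (α β : Fin N × Fin N) : chi α β ≠ 0 := om_ne_zero _

omit [NeZero N] in
lemma chi_self (α : Fin N × Fin N) : chi α α = 1 := by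
  rw [chi, show ((α.1 : ℕ) * (α.2 : ℕ) - (α.2 : ℕ) * (α.1 : ℕ) : ℤ) = 0 by ring, om_zero]

lemma chi_add_left (α β γ : Fin N × Fin N) : chi (α + β) γ = chi α γ * chi β γ := by
  rw [chi, chi, chi, ← om_add]
  refine om_congr ?_
  have h := ((val_add_modEq α.1 β.1).mul_right ((γ.2 : ℕ) : ℤ)).sub
    ((val_add_modEq α.2 β.2).mul_right ((γ.1 : ℕ) : ℤ))
  convert! h using 1
  ring

lemma chi_add_right (α β γ : Fin N × Fin N) : chi α (β + γ) = chi α β * chi α γ := by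
  rw [chi, chi, chi, ← om_add]
  refine om_congr ?_
  have h := ((val_add_modEq β.2 γ.2).mul_left ((α.1 : ℕ) : ℤ)).sub
    ((val_add_modEq β.1 γ.1).mul_left ((α.2 : ℕ) : ℤ))
  convert! h using 1
  ring

lemma chi_zero_right (α : Fin N × Fin N) : chi α 0 = 1 := by simp [chi, om_zero]

omit [NeZero N] in
lemma chi_swap (α β : Fin N × Fin N) : chi α β = (chi β α)⁻¹ := by
  rw [chi, chi, ← om_neg]; congr 1; ring

lemma chi_sub_right_self (α γ : Fin N × Fin N) : chi α (γ - α) = chi α γ := by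
  have := chi_add_right α (γ - α) α
  rw [sub_add_cancel, chi_self, mul_one] at this
  exact this.symm

lemma sum_chi {γ : Fin N × Fin N} (hγ : γ ≠ 0) : ∑ α, chi α γ = 0 := by
  have h := sum_om_mul_sub (N := N) (a := (γ.2 : ℕ)) (b := (γ.1 : ℕ)) (fun h => hγ
    (Prod.ext (val_eq_zero_of_dvd h.2) (val_eq_zero_of_dvd h.1)))
  rw [← h]
  refine Finset.sum_congr rfl fun α _ => ?_
  rw [chi]; congr 1; ring

/-- Functions on `(ℤ/N)²` with constant Fourier transform are supported at the origin. -/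
lemma eq_zero_of_fourier_const {c : Fin N × Fin N → ℂ} {v : ℂ}
    (h : ∀ a b : ℤ, ∑ δ : Fin N × Fin N, om N (a * (δ.1 : ℕ) - b * (δ.2 : ℕ)) * c δ = v)
    (γ : Fin N × Fin N) : c γ = if γ = 0 then v else 0 := by
  have hN : (N : ℂ) ≠ 0 := NeZero.ne _
  have hcard : ∑ β : Fin N × Fin N, (1 : ℂ) = N * N := by simp
  have key : ∀ γ' : Fin N × Fin N,
      ∑ β : Fin N × Fin N, chi β γ' = if γ' = 0 then (N * N : ℂ) else 0 := by
    intro γ'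
    split_ifs with h0
    · subst h0; simp only [chi_zero_right, hcard]
    · exact sum_chi h0
  -- Fourier inversion, by orthogonality of the characters `chi β`; the same sum is then computed
  -- with the transform replaced by the constant `v`.
  have e1 : ∑ β : Fin N × Fin N, chi β (-γ) * (∑ δ, chi β δ * c δ) = N * N * c γ := by
    simp only [Finset.mul_sum, ← mul_assoc, ← chi_add_right]
    rw [Finset.sum_comm]
    simp only [← Finset.sum_mul, key]
    rw [Finset.sum_eq_single γ]
    · simp
    · intro δ _ hδ
      rw [if_neg (fun h0 => hδ ?_), zero_mul]
      rw [neg_add_eq_zero] at h0; exact h0.symm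
    · simp
  have e2 : ∀ β : Fin N × Fin N, ∑ δ, chi β δ * c δ = v := fun β => by
    rw [← h (-(β.2 : ℕ)) (-(β.1 : ℕ))]
    refine Finset.sum_congr rfl fun δ _ => ?_
    rw [chi]; congr 2; ring
  simp only [e2, ← Finset.sum_mul, key, neg_eq_zero] at e1
  have hNN : (N * N : ℂ) ≠ 0 := mul_ne_zero hN hN
  split_ifs at e1 ⊢ with h0
  · exact (mul_left_cancel₀ hNN e1).symm
  · rw [zero_mul] at e1
    exact (mul_eq_zero.1 e1.symm).resolve_left hNN

end

/-! ### The weight functions -/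

/-- Integer shifts of the characteristics only produce a factor independent of the argument, which
cancels in the quotient. The weights therefore depend on `α` modulo `N` only, although they are
written with representatives. -/
lemma thetaChar_div_add_int (γ₁ γ₂ x y τ : ℂ) (m n : ℤ) :
    thetaChar (γ₁ + m) (γ₂ + n) x τ / thetaChar (γ₁ + m) (γ₂ + n) y τ
      = thetaChar γ₁ γ₂ x τ / thetaChar γ₁ γ₂ y τ := by
  rw [thetaChar_add_int_left, thetaChar_add_int_left, thetaChar_add_int_right,
    thetaChar_add_int_right, mul_div_mul_left _ _ (ex_ne_zero _)]

lemma weight_eq_div {N : ℕ} (μ τ : ℂ) (α : Fin N × Fin N) (ξ : ℂ) :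
    weight N μ τ α ξ = thetaChar (1 / 2 + (α.1.val : ℂ) / N) (1 / 2 + (α.2.val : ℂ) / N)
      (ξ + μ / N) τ
      / thetaChar (1 / 2 + (α.1.val : ℂ) / N) (1 / 2 + (α.2.val : ℂ) / N) (μ / N) τ / N := by
  rw [weight, mul_comm (N : ℂ), div_div]

section
variable {N : ℕ} [NeZero N] {μ τ : ℂ}

lemma weight_neg (μ τ : ℂ) (α : Fin N × Fin N) (ξ : ℂ) :
    weight N (-μ) τ (-α) (-ξ) = weight N μ τ α ξ := by
  have hN : (N : ℂ) ≠ 0 := NeZero.ne _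
  obtain ⟨m, hm⟩ := (val_neg_modEq α.1).symm.dvd
  obtain ⟨n, hn⟩ := (val_neg_modEq α.2).symm.dvd
  have em : (((-α).1 : ℕ) : ℂ) = -(α.1 : ℕ) + N * m := by
    have : (((-α.1 : Fin N) : ℕ) : ℤ) = -((α.1 : ℕ) : ℤ) + N * m := by linarith
    exact_mod_cast this
  have en : (((-α).2 : ℕ) : ℂ) = -(α.2 : ℕ) + N * n := by
    have : (((-α.2 : Fin N) : ℕ) : ℤ) = -((α.2 : ℕ) : ℤ) + N * n := by linarith
    exact_mod_cast this
  rw [weight_eq_div, weight_eq_div, em, en]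
  have e1 : (1 / 2 + (-((α.1 : ℕ) : ℂ) + N * m) / N) = -(1 / 2 + ((α.1 : ℕ) : ℂ) / N)
      + ((m + 1 : ℤ) : ℂ) := by push_cast; field_simp; ring
  have e2 : (1 / 2 + (-((α.2 : ℕ) : ℂ) + N * n) / N) = -(1 / 2 + ((α.2 : ℕ) : ℂ) / N)
      + ((n + 1 : ℤ) : ℂ) := by push_cast; field_simp; ring
  rw [e1, e2, thetaChar_div_add_int, show -ξ + -μ / N = -(ξ + μ / N) by ring,
    show -μ / N = -(μ / N) by ring, thetaChar_neg, thetaChar_neg]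

lemma weight_neg' (μ τ : ℂ) (α : Fin N × Fin N) (ξ : ℂ) :
    weight N (-μ) τ α ξ = weight N μ τ (-α) (-ξ) := by
  have := weight_neg μ τ (-α) (-ξ)
  rwa [neg_neg, neg_neg] at this

-- The multiplier splits into a part independent of `α` and a character of `α`. Both the Fourier
-- analysis and the quasi-periodicity of `R` rest on this splitting.
omit [NeZero N] in
lemma weight_add_lattice (μ τ : ℂ) (α : Fin N × Fin N) (ξ : ℂ) (a b : ℤ) :
    weight N μ τ α (ξ + (a + b * τ))
      = ex (a - b - b ^ 2 * τ - 2 * b * (ξ + μ / N)) * om N (a * (α.1 : ℕ) - b * (α.2 : ℕ))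
        * weight N μ τ α ξ := by
  rw [weight, weight, show ξ + (a + b * τ) + μ / N = ξ + μ / N + (a + b * τ) by ring,
    thetaChar_add_lattice, om, ← ex_add, mul_div_assoc]
  congr 2
  push_cast
  ring

omit [NeZero N] in
lemma differentiable_weight (hτ : 0 < τ.im) (μ : ℂ) (α : Fin N × Fin N) :
    Differentiable ℂ (weight N μ τ α) := by
  unfold weight
  exact ((differentiable_thetaChar _ _ hτ).comp (f := fun ξ : ℂ => ξ + μ / N)
    (by fun_prop)).div_const _

lemma thetaChar_ne_zero (hτ : 0 < τ.im) (hμ : ∀ a b : ℤ, μ ≠ a + b * τ) (i j : ℕ) :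
    thetaChar (1 / 2 + (i : ℂ) / N) (1 / 2 + (j : ℂ) / N) (μ / N) τ ≠ 0 := by
  have hN : (N : ℂ) ≠ 0 := NeZero.ne _
  rw [thetaChar_eq_th]
  refine mul_ne_zero (ex_ne_zero _) fun h => ?_
  obtain ⟨a, b, h⟩ := (th_eq_zero_iff hτ _).1 h
  apply hμ (N * a - j) (N * b - i)
  field_simp at h
  push_cast
  linear_combination h

lemma weight_zero (hτ : 0 < τ.im) (hμ : ∀ a b : ℤ, μ ≠ a + b * τ) (α : Fin N × Fin N) :
    weight N μ τ α 0 = 1 / N := by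
  rw [weight_eq_div, zero_add, div_self (thetaChar_ne_zero hτ hμ _ _)]

end

section
variable {N : ℕ} [NeZero N] {μ τ : ℂ}

/-! ### The sum of the weights -/

/-- The sum of all weight functions. -/
def weightSum (N : ℕ) (μ τ ξ : ℂ) : ℂ := ∑ α : Fin N × Fin N, weight N μ τ α ξ

-- Each value of the finite Fourier transform of the weights is a lattice translate of their plain
-- sum; one closed formula for the sum thus gives the whole transform.
omit [NeZero N] in
lemma sum_om_mul_weight (μ τ ξ : ℂ) (a b : ℤ) :
    weightSum N μ τ (ξ + (a + b * τ)) = ex (a - b - b ^ 2 * τ - 2 * b * (ξ + μ / N))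
      * ∑ α : Fin N × Fin N, om N (a * (α.1 : ℕ) - b * (α.2 : ℕ)) * weight N μ τ α ξ := by
  rw [weightSum, Finset.mul_sum]
  refine Finset.sum_congr rfl fun α _ => ?_
  rw [weight_add_lattice, mul_assoc]

/-- The zeros of `th(Nx)` are the points of the lattice divided by `N`. At such a point the sum of
weights is a character sum, since all weights equal `1/N` at the origin; it vanishes unless the
point is in the lattice, and there `th x` vanishes. The quotient by `th(Nx)` is entire with the
multipliers of `th(x + μ)`, hence proportional to it. -/
lemma weightSum_mul_th (hτ : 0 < τ.im) (hμ : ∀ a b : ℤ, μ ≠ a + b * τ) (x : ℂ) :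
    weightSum N μ τ (N * x) * (th τ μ * th τ x) = th τ (N * x) * th τ (μ + x) := by
  have hN : (N : ℂ) ≠ 0 := NeZero.ne _
  have dth := differentiable_th hτ
  have dw : Differentiable ℂ fun x : ℂ => weightSum N μ τ (N * x) := by
    unfold weightSum
    refine Differentiable.fun_sum fun α _ => ?_
    exact (differentiable_weight hτ μ α).comp (f := fun x : ℂ => (N : ℂ) * x) (by fun_prop)
  have dg : Differentiable ℂ fun x : ℂ => th τ (N * x) :=
    dth.comp (f := fun x : ℂ => (N : ℂ) * x) (by fun_prop)
  have hgd : ∀ x, HasDerivAt (fun x : ℂ => th τ (N * x)) (deriv (th τ) (N * x) * (N * 1)) x :=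
    fun x => (dth (N * x)).hasDerivAt.comp x ((hasDerivAt_id x).const_mul (N : ℂ))
  have hg' : ∀ x, th τ (N * x) = 0 → deriv (fun x : ℂ => th τ (N * x)) x ≠ 0 := fun x hx => by
    rw [(hgd x).deriv]
    exact mul_ne_zero (deriv_th_ne_zero hτ hx) (by simpa using hN)
  have hw0 : weightSum N μ τ 0 = N := by
    simp only [weightSum, weight_zero hτ hμ]
    simp
  obtain ⟨k, dk, hk⟩ := exists_entire_quotient (f := fun x => weightSum N μ τ (N * x) * th τ x)
    (dw.mul dth) dg (fun x hx => by
      obtain ⟨a, b, hab⟩ := (th_eq_zero_iff hτ _).1 hx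
      by_cases h : (N : ℤ) ∣ a ∧ (N : ℤ) ∣ b
      · obtain ⟨⟨a', rfl⟩, ⟨b', rfl⟩⟩ := h
        have : th τ x = 0 := (th_eq_zero_iff hτ x).2 ⟨a', b', by
          apply mul_left_cancel₀ hN
          rw [hab]; push_cast; ring⟩
        rw [this, mul_zero]
      · have : weightSum N μ τ (N * x) = 0 := by
          rw [hab, ← zero_add ((a : ℂ) + b * τ), sum_om_mul_weight]
          simp only [weight_zero hτ hμ, ← Finset.sum_mul, sum_om_mul_sub h, zero_mul, mul_zero]
        rw [this, zero_mul]) hg'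
  have cancel : ∀ {F G : ℂ → ℂ}, Continuous F → Continuous G →
      (∀ x, th τ (N * x) * F x = th τ (N * x) * G x) → ∀ x, F x = G x := fun {F G} hF hG h x =>
    sub_eq_zero.1 <| eq_zero_of_mul_eq_zero_of_simple_zeros dg hg' (F := fun x => F x - G x)
      (hF.sub hG) (fun x => by rw [mul_sub, h, sub_self]) x
  have ck := dk.continuous
  have k1 : ∀ x, k (x + 1) = -k x := cancel (ck.comp (by fun_prop)) ck.neg fun x => by
    have u := hk (x + 1)
    have e : (N : ℂ) * (x + 1) = N * x + ((N : ℤ) + (0 : ℤ) * τ) := by push_cast; ring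
    rw [e, th_add_lattice, sum_om_mul_weight, th_add_one] at u
    have eo : ∀ α : Fin N × Fin N, om N ((N : ℤ) * (α.1 : ℕ) - 0 * (α.2 : ℕ)) = 1 := fun α =>
      (om_eq_one_iff _).2 ⟨(α.1 : ℕ), by ring⟩
    simp only [eo, one_mul] at u
    rw [← weightSum] at u
    have v := hk x
    apply mul_left_cancel₀ (ex_ne_zero (N : ℂ))
    simp only [Int.cast_natCast, Int.cast_zero, add_zero, sub_zero, ne_eq, OfNat.ofNat_ne_zero,
      not_false_eq_true, zero_pow, zero_mul, mul_zero] at u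
    linear_combination -u - ex (N : ℂ) * v
  have k2 : ∀ x, k (x + τ) = -ex (-τ - 2 * (x + μ)) * k x :=
    cancel (ck.comp (by fun_prop)) (Continuous.mul (Continuous.neg
      (differentiable_ex.continuous.comp (by fun_prop))) ck) fun x => by
    have u := hk (x + τ)
    have e : (N : ℂ) * (x + τ) = N * x + ((0 : ℤ) + (N : ℤ) * τ) := by push_cast; ring
    rw [e, th_add_lattice, sum_om_mul_weight, th_add_tau] at u
    have eo : ∀ α : Fin N × Fin N, om N (0 * (α.1 : ℕ) - (N : ℤ) * (α.2 : ℕ)) = 1 := fun α =>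
      (om_eq_one_iff _).2 ⟨-(α.2 : ℕ), by ring⟩
    simp only [eo, one_mul] at u
    rw [← weightSum] at u
    have v := hk x
    simp only [Int.cast_natCast, Int.cast_zero] at u
    have e1 : (0 - (N : ℂ) - (N : ℂ) ^ 2 * τ - 2 * N * (N * x + μ / N))
        = (0 + N - (N : ℂ) ^ 2 * τ - 2 * N * (N * x)) + (-(2 * μ) + 2 * ((-N : ℤ) : ℂ)) := by
      push_cast; field_simp; ring
    rw [e1, ex_add, ex_add (-(2 * μ)), ex_two_int, mul_one] at u
    apply mul_left_cancel₀ (ex_ne_zero (0 + N - (N : ℂ) ^ 2 * τ - 2 * N * (N * x)))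
    rw [show -τ - 2 * (x + μ) = -(2 * μ) + (-τ - 2 * x) by ring, ex_add]
    linear_combination -u - ex (0 + N - (N : ℂ) ^ 2 * τ - 2 * N * (N * x)) * ex (-(2 * μ))
      * ex (-τ - 2 * x) * v
  obtain ⟨c, hc⟩ := eq_const_mul_th hτ dk μ k1 k2
  -- Both sides vanish at the origin, so the constant is read off from first derivatives.
  have hc1 : c * th τ μ = 1 := by
    have d1 : HasDerivAt (fun x => weightSum N μ τ (N * x) * th τ x)
        (N * deriv (th τ) 0) 0 := by
      have := (dw 0).hasDerivAt.fun_mul (dth 0).hasDerivAt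
      simpa [hw0, th_zero hτ] using this
    have d2 : HasDerivAt (fun x => th τ (N * x) * k x) (deriv (th τ) 0 * N * k 0) 0 := by
      have := (hgd 0).fun_mul (dk 0).hasDerivAt
      simpa [th_zero hτ] using this
    have e : (fun x => weightSum N μ τ (N * x) * th τ x) = fun x => th τ (N * x) * k x := funext hk
    rw [e] at d1
    have := d1.unique d2
    rw [hc 0, zero_add] at this
    have h0 := deriv_th_ne_zero hτ (th_zero hτ)
    apply mul_left_cancel₀ (mul_ne_zero hN h0)
    linear_combination -this
  have := hk x
  rw [hc x] at this
  rw [add_comm μ x]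
  linear_combination th τ μ * this + th τ (N * x) * th τ (x + μ) * hc1

/-! ### Unitarity of the weights -/

/-- The coefficients of the product of the vertex matrices with parameters `μ` and `-μ`. -/
def unitCoeff (N : ℕ) [NeZero N] (μ τ : ℂ) (γ : Fin N × Fin N) (ξ : ℂ) : ℂ :=
  ∑ α, chi α γ * (weight N μ τ α ξ * weight N (-μ) τ (γ - α) ξ)

lemma differentiable_unitCoeff (hτ : 0 < τ.im) (μ : ℂ) (γ : Fin N × Fin N) :
    Differentiable ℂ (unitCoeff N μ τ γ) := by
  unfold unitCoeff
  exact Differentiable.fun_sum fun α _ => ((differentiable_weight hτ μ α).mul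
    (differentiable_weight hτ (-μ) (γ - α))).const_mul _

lemma unitCoeff_add_lattice (μ τ : ℂ) (γ : Fin N × Fin N) (ξ : ℂ) (a b : ℤ) :
    unitCoeff N μ τ γ (ξ + (a + b * τ))
      = ex (-(2 * b ^ 2 * τ) - 4 * b * ξ) * om N (a * (γ.1 : ℕ) - b * (γ.2 : ℕ))
        * unitCoeff N μ τ γ ξ := by
  rw [unitCoeff, unitCoeff, Finset.mul_sum]
  refine Finset.sum_congr rfl fun α _ => ?_
  rw [weight_add_lattice, weight_add_lattice]
  have e1 : om N (a * (γ.1 : ℕ) - b * (γ.2 : ℕ)) = om N (a * (α.1 : ℕ) - b * (α.2 : ℕ))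
      * om N (a * ((γ - α).1 : ℕ) - b * ((γ - α).2 : ℕ)) := by
    rw [← om_add]
    refine (om_congr ?_).symm
    have h := (((val_sub_modEq γ.1 α.1).mul_left a).sub
      ((val_sub_modEq γ.2 α.2).mul_left b)).add_left (a * (α.1 : ℕ) - b * (α.2 : ℕ))
    convert! h using 1
    ring
  have e2 : ex (-(2 * b ^ 2 * τ) - 4 * b * ξ) = ex (a - b - b ^ 2 * τ - 2 * b * (ξ + μ / N))
      * ex (a - b - b ^ 2 * τ - 2 * b * (ξ + -μ / N)) := by
    rw [← ex_add]
    have : a - b - b ^ 2 * τ - 2 * b * (ξ + μ / N) + (a - b - b ^ 2 * τ - 2 * b * (ξ + -μ / N))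
      = -(2 * b ^ 2 * τ) - 4 * b * ξ + 2 * ((a - b : ℤ) : ℂ) := by push_cast; ring
    rw [this, ex_add _ (2 * _), ex_two_int, mul_one]
  rw [e1, e2]
  ring

lemma neg_notMem_lattice (hμ : ∀ a b : ℤ, μ ≠ a + b * τ) (a b : ℤ) : -μ ≠ a + b * τ :=
  fun h => hμ (-a) (-b) (by push_cast; linear_combination -h)

/-- A zero of a quasi-periodic function spreads over a coset of the lattice; this is the
divisibility condition of `exists_eq_th_mul`. -/
lemma th_eq_zero_of_lattice {f : ℂ → ℂ} (hτ : 0 < τ.im) (s : ℂ) (e : ℂ → ℤ → ℤ → ℂ)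
    (h : ∀ x (a b : ℤ), f (x + (a + b * τ)) = e x a b * f x) (h0 : f s = 0) (x : ℂ)
    (hx : th τ (x + -s) = 0) : f x = 0 := by
  obtain ⟨a, b, hab⟩ := (th_eq_zero_iff hτ _).1 hx
  have := h s a b
  rw [← hab, h0, mul_zero, show s + (x + -s) = x by ring] at this
  exact this

/-- The coefficient has the multipliers of `th²` twisted by the character attached to `γ`, and a
double zero at the origin. Dividing twice by `th` leaves an entire function with unimodular
multipliers, not both trivial when `γ ≠ 0`. -/
lemma unitCoeff_eq_zero (hτ : 0 < τ.im) (hμ : ∀ a b : ℤ, μ ≠ a + b * τ) {γ : Fin N × Fin N}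
    (hγ : γ ≠ 0) (ξ : ℂ) : unitCoeff N μ τ γ ξ = 0 := by
  have hN : (N : ℂ) ≠ 0 := NeZero.ne _
  have dth := differentiable_th hτ
  have df := differentiable_unitCoeff hτ μ γ
  have f0 : unitCoeff N μ τ γ 0 = 0 := by
    simp only [unitCoeff, weight_zero hτ hμ, weight_zero hτ (neg_notMem_lattice hμ),
      ← Finset.sum_mul, sum_chi hγ, zero_mul]
  -- After the reflection `weight_neg'`, the derivative at `0` is `1/N` times the sum of `chi α γ *
  -- (D α - D (α - γ))`. As `chi α γ = chi (α - γ) γ`, translating the index by `γ` shows that it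
  -- vanishes.
  have fd : HasDerivAt (unitCoeff N μ τ γ) 0 0 := by
    have e : unitCoeff N μ τ γ
        = fun ξ => ∑ α, chi α γ * (weight N μ τ α ξ * weight N μ τ (α - γ) (-ξ)) := by
      funext ξ
      rw [unitCoeff]
      refine Finset.sum_congr rfl fun α _ => ?_
      rw [weight_neg', neg_sub]
    rw [e]
    set D : Fin N × Fin N → ℂ := fun α => deriv (weight N μ τ α) 0 with hD
    have h1 : ∀ α : Fin N × Fin N, HasDerivAt (weight N μ τ α) (D α) 0 := fun α =>
      (differentiable_weight hτ μ α 0).hasDerivAt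
    have h2 : ∀ α : Fin N × Fin N, HasDerivAt (fun ξ => weight N μ τ α (-ξ)) (-D α) 0 := fun α => by
      have h := h1 α
      rw [← neg_zero] at h
      have h4 := h.comp (0 : ℂ) (hasDerivAt_neg (0 : ℂ))
      rw [mul_neg_one] at h4
      exact h4
    have h3 := HasDerivAt.fun_sum (u := Finset.univ) fun α _ =>
      ((h1 α).fun_mul (h2 (α - γ))).const_mul (chi α γ)
    convert! h3 using 1
    simp only [neg_zero, weight_zero hτ hμ]
    have e1 : ∀ α : Fin N × Fin N, chi α γ * (D α * (1 / N) + 1 / N * -D (α - γ))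
        = 1 / N * (chi α γ * D α - chi (α - γ) γ * D (α - γ)) := fun α => by
      have : chi α γ = chi (α - γ) γ := by
        have := chi_add_left (α - γ) γ γ
        rwa [sub_add_cancel, chi_self, mul_one] at this
      rw [← this]; ring
    simp only [e1]
    have e2 : ∑ α, chi (α - γ) γ * D (α - γ) = ∑ α, chi α γ * D α :=
      Equiv.sum_comp (Equiv.subRight γ) (fun α => chi α γ * D α)
    rw [← Finset.mul_sum, Finset.sum_sub_distrib, e2, sub_self, mul_zero]
  have z1 := unitCoeff_add_lattice (N := N) μ τ γ
  obtain ⟨k, dk, hk⟩ := exists_eq_th_mul hτ df (-0)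
    (th_eq_zero_of_lattice hτ 0 _ z1 f0)
  have hk' : ∀ x, unitCoeff N μ τ γ x = th τ x * k x := fun x => by simpa using hk x
  have k0 : k 0 = 0 := by
    have d2 := (dth 0).hasDerivAt.fun_mul (dk 0).hasDerivAt
    rw [← funext hk', th_zero hτ, zero_mul, add_zero] at d2
    exact (mul_eq_zero.1 (d2.unique fd)).resolve_left (deriv_th_ne_zero hτ (th_zero hτ))
  have kl : ∀ x (a b : ℤ), k (x + (a + b * τ))
      = ex (-(a + b) - b ^ 2 * τ - 2 * b * x) * om N (a * (γ.1 : ℕ) - b * (γ.2 : ℕ)) * k x := by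
    intro x a b
    have ck := dk.continuous
    refine eq_of_th_mul_eq hτ (f := fun x => k (x + (a + b * τ)))
      (g := fun x => ex (-(a + b) - b ^ 2 * τ - 2 * b * x)
        * om N (a * (γ.1 : ℕ) - b * (γ.2 : ℕ)) * k x)
      (ck.comp (by fun_prop)) (Continuous.mul (Continuous.mul
      (differentiable_ex.continuous.comp (by fun_prop)) continuous_const) ck) 0 (fun x => ?_) x
    have u := z1 x a b
    rw [hk', hk', th_add_lattice] at u
    simp only [add_zero]
    apply mul_left_cancel₀ (ex_ne_zero (a + b - b ^ 2 * τ - 2 * b * x))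
    rw [show -(2 * b ^ 2 * τ) - 4 * b * x = a + b - b ^ 2 * τ - 2 * b * x
      + (-(a + b) - b ^ 2 * τ - 2 * b * x) by ring, ex_add] at u
    linear_combination u
  obtain ⟨k₂, dk₂, hk₂⟩ := exists_eq_th_mul hτ dk (-0) (th_eq_zero_of_lattice hτ 0 _ kl k0)
  have hk₂' : ∀ x, k x = th τ x * k₂ x := fun x => by simpa using hk₂ x
  have kl₂ : ∀ x (a b : ℤ), k₂ (x + (a + b * τ))
      = om N (a * (γ.1 : ℕ) - b * (γ.2 : ℕ)) * k₂ x := by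
    intro x a b
    have ck := dk₂.continuous
    refine eq_of_th_mul_eq hτ (f := fun x => k₂ (x + (a + b * τ)))
      (g := fun x => om N (a * (γ.1 : ℕ) - b * (γ.2 : ℕ)) * k₂ x)
      (ck.comp (by fun_prop)) (continuous_const.mul ck) 0 (fun x => ?_) x
    have u := kl x a b
    rw [hk₂', hk₂', th_add_lattice] at u
    simp only [add_zero]
    apply mul_left_cancel₀ (ex_ne_zero (a + b - b ^ 2 * τ - 2 * b * x))
    rw [show -(a + b) - b ^ 2 * τ - 2 * b * x = a + b - b ^ 2 * τ - 2 * b * x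
      + 2 * ((-(a + b) : ℤ) : ℂ) by push_cast; ring, ex_add, ex_two_int, mul_one] at u
    linear_combination u
  have kz := eq_zero_of_unimodular_multipliers hτ dk₂ (norm_om (N := N) (γ.1 : ℕ))
    (norm_om (N := N) (-(γ.2 : ℕ))) (fun x => by simpa using kl₂ x 1 0)
    (fun x => by simpa using kl₂ x 0 1) (by
      by_contra hc
      push Not at hc
      refine hγ (Prod.ext (val_eq_zero_of_dvd ((om_eq_one_iff _).1 hc.1)) (val_eq_zero_of_dvd ?_))
      simpa using (om_eq_one_iff _).1 hc.2)
  rw [hk', hk₂', kz, mul_zero, mul_zero]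

end

section
variable {N : ℕ} [NeZero N] {μ τ : ℂ}

lemma weightSum_eq (hτ : 0 < τ.im) (hμ : ∀ a b : ℤ, μ ≠ a + b * τ) {ξ : ℂ}
    (hξ : th τ (ξ / N) ≠ 0) :
    weightSum N μ τ ξ = th τ ξ * th τ (μ + ξ / N) / (th τ μ * th τ (ξ / N)) := by
  have hN : (N : ℂ) ≠ 0 := NeZero.ne _
  have h := weightSum_mul_th (N := N) hτ hμ (ξ / N)
  rw [mul_div_cancel₀ _ hN] at h
  have hμ' : th τ μ ≠ 0 := fun h0 => by
    obtain ⟨a, b, hab⟩ := (th_eq_zero_iff hτ _).1 h0; exact hμ a b hab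
  rw [eq_div_iff (mul_ne_zero hμ' hξ), h]

/-- At `ξ = μ` the weights are, up to a factor, their own Fourier transform. -/
lemma sum_chi_mul_weight_self (hτ : 0 < τ.im) (hμ : ∀ a b : ℤ, μ ≠ a + b * τ)
    (γ : Fin N × Fin N) : ∑ α, chi α γ * weight N μ τ α μ = N * weight N μ τ γ μ := by
  have hN : (N : ℂ) ≠ 0 := NeZero.ne _
  have h := sum_om_mul_weight (N := N) μ τ μ ((γ.2 : ℕ) : ℤ) ((γ.1 : ℕ) : ℤ)
  set a : ℤ := ((γ.2 : ℕ) : ℤ) with ha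
  set b : ℤ := ((γ.1 : ℕ) : ℤ) with hb
  have e : ∑ α : Fin N × Fin N, om N (a * (α.1 : ℕ) - b * (α.2 : ℕ)) * weight N μ τ α μ
      = ∑ α, chi α γ * weight N μ τ α μ := by
    refine Finset.sum_congr rfl fun α _ => ?_
    rw [chi]; congr 2; rw [ha, hb]; ring
  rw [e] at h
  have hμ' : th τ μ ≠ 0 := fun h0 => by
    obtain ⟨a, b, hab⟩ := (th_eq_zero_iff hτ _).1 h0; exact hμ a b hab
  have hz : th τ ((μ + (a + b * τ)) / N) ≠ 0 := fun h0 => by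
    obtain ⟨a', b', hab⟩ := (th_eq_zero_iff hτ _).1 h0
    apply hμ (N * a' - a) (N * b' - b)
    field_simp at hab
    push_cast
    linear_combination hab
  have ca : ((γ.2 : ℕ) : ℂ) = a := by rw [ha]; norm_cast
  have cb : ((γ.1 : ℕ) : ℂ) = b := by rw [hb]; norm_cast
  -- At `ξ = μ` the factor `th ξ / th μ` of the sum reduces to the lattice multiplier. What remains
  -- is the quotient of two translates of `th` that defines the weight of index `γ` at `μ`.
  rw [weightSum_eq hτ hμ hz, th_add_lattice] at h
  rw [weight_eq_div, ca, cb, thetaChar_eq_th, thetaChar_eq_th]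
  have e1 : μ + μ / N + a / N + b / N * τ = μ + (μ + (a + b * τ)) / N := by field_simp; ring
  have e2 : μ / N + a / N + b / N * τ = (μ + (a + b * τ)) / N := by ring
  rw [e1, e2]
  set A := th τ (μ + (μ + (a + b * τ)) / N)
  set B := th τ ((μ + (a + b * τ)) / N)
  have e3 : ((b : ℂ) / N) ^ 2 * τ + 2 * (b / N) * (μ + μ / N + 1 / 2 + a / N)
      = (((b : ℂ) / N) ^ 2 * τ + 2 * (b / N) * (μ / N + 1 / 2 + a / N)) + 2 * b * μ / N := by
    field_simp; ring
  have e4 : (a : ℂ) + b - b ^ 2 * τ - 2 * b * μ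
      = (a - b - b ^ 2 * τ - 2 * b * (μ + μ / N)) + 2 * b * μ / N + 2 * b := by
    field_simp; ring
  rw [e3, ex_add _ (2 * b * μ / N)]
  rw [e4, ex_add _ (2 * (b : ℂ)), ex_two_int, mul_one, ex_add _ (2 * b * μ / N)] at h
  apply mul_left_cancel₀ (ex_ne_zero (a - b - b ^ 2 * τ - 2 * b * (μ + μ / N)))
  rw [← h]
  have hne := ex_ne_zero (((b : ℂ) / N) ^ 2 * τ + 2 * (b / N) * (μ / N + 1 / 2 + a / N))
  generalize ex (((b : ℂ) / N) ^ 2 * τ + 2 * (b / N) * (μ / N + 1 / 2 + a / N)) = E at hne ⊢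
  generalize ex (2 * b * μ / N) = E'
  generalize ex (a - b - b ^ 2 * τ - 2 * b * (μ + μ / N)) = E''
  clear_value A B
  field_simp

lemma unitCoeff_zero_eq_neg (μ τ ξ : ℂ) : unitCoeff N μ τ 0 ξ = unitCoeff N (-μ) τ 0 ξ := by
  simp only [unitCoeff, chi_zero_right, one_mul, zero_sub, neg_neg]
  rw [← Equiv.sum_comp (Equiv.neg _)]
  refine Finset.sum_congr rfl fun α _ => ?_
  simp [mul_comm]

/-- Self-duality of the weights at `μ` makes the family of coefficients at `μ` self-dual too: `N u_γ
= ∑ chi(ε, γ) u_ε`. For some `γ ≠ 0`, available since `N ≥ 2`, the left side vanishes and only `u_0`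
survives on the right. -/
lemma unitCoeff_zero_self (hN2 : 2 ≤ N) (hτ : 0 < τ.im) (hμ : ∀ a b : ℤ, μ ≠ a + b * τ) :
    unitCoeff N μ τ 0 μ = 0 := by
  have hN : (N : ℂ) ≠ 0 := NeZero.ne _
  have hμ' := neg_notMem_lattice hμ
  have key : ∀ γ, N * unitCoeff N (-μ) τ γ μ = ∑ ε, chi ε γ * unitCoeff N (-μ) τ ε μ := by
    intro γ
    simp only [unitCoeff, neg_neg, Finset.mul_sum]
    rw [Finset.sum_comm (γ := Fin N × Fin N)]
    refine Finset.sum_congr rfl fun α _ => ?_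
    have h := sum_chi_mul_weight_self hτ hμ (γ - α)
    calc _ = chi α γ * weight N (-μ) τ α μ * (N * weight N μ τ (γ - α) μ) := by ring
      _ = ∑ δ, chi α γ * weight N (-μ) τ α μ * (chi δ (γ - α) * weight N μ τ δ μ) := by
        rw [← h, Finset.mul_sum]
      _ = _ := by
        rw [← Equiv.sum_comp (Equiv.subRight α)]
        refine Finset.sum_congr rfl fun ε _ => ?_
        simp only [Equiv.subRight_apply]
        have e1 : chi ε γ = chi (ε - α) γ * chi α γ := by rw [← chi_add_left, sub_add_cancel]
        have e2 : chi (ε - α) γ = chi (ε - α) (γ - α) * chi (ε - α) α := by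
          rw [← chi_add_right, sub_add_cancel]
        have e3 : chi (ε - α) α * chi α ε = 1 := by
          rw [← chi_sub_right_self α ε, chi_swap]
          exact inv_mul_cancel₀ (chi_ne_zero _ _)
        rw [e1, e2]
        linear_combination -(chi (ε - α) (γ - α) * chi α γ * weight N (-μ) τ α μ
          * weight N μ τ (ε - α) μ) * e3
  obtain ⟨γ, hγ⟩ : ∃ γ : Fin N × Fin N, γ ≠ 0 := by
    refine ⟨(⟨1, hN2⟩, 0), fun h => ?_⟩
    have := congrArg (fun x : Fin N × Fin N => (x.1 : ℕ)) h
    simp at this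
  have h := key γ
  rw [unitCoeff_eq_zero hτ hμ' hγ, mul_zero, Finset.sum_eq_single 0
    (fun ε _ hε => by rw [unitCoeff_eq_zero hτ hμ' hε, mul_zero]) (by simp), chi_swap,
    chi_zero_right] at h
  rw [unitCoeff_zero_eq_neg]
  simpa using h.symm

/-- The scalar in the unitarity relation. -/
lemma unitCoeff_zero_mul (hN2 : 2 ≤ N) (hτ : 0 < τ.im) (hμ : ∀ a b : ℤ, μ ≠ a + b * τ) (ξ : ℂ) :
    unitCoeff N μ τ 0 ξ * th τ μ ^ 2 = -(th τ (ξ - μ) * th τ (ξ + μ)) := by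
  have hN : (N : ℂ) ≠ 0 := NeZero.ne _
  have z1 := unitCoeff_add_lattice (N := N) μ τ 0
  obtain ⟨k, dk, hk⟩ := exists_eq_th_mul hτ (differentiable_unitCoeff (N := N) hτ μ 0) (-μ)
    (th_eq_zero_of_lattice hτ μ _ z1 (unitCoeff_zero_self hN2 hτ hμ))
  have ck := dk.continuous
  obtain ⟨c, hc⟩ := eq_const_mul_th hτ dk μ
    (eq_of_th_mul_eq hτ (f := fun x => k (x + 1)) (g := fun x => -k x)
      (ck.comp (by fun_prop)) ck.neg (-μ) fun x => by
        have u := hk (x + 1)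
        have z := z1 x 1 0
        simp only [Int.cast_one, Int.cast_zero, zero_mul, add_zero, ne_eq, OfNat.ofNat_ne_zero,
          not_false_eq_true, zero_pow, mul_zero, neg_zero, sub_zero, ex_zero, Prod.fst_zero,
          Prod.snd_zero, Fin.val_zero, Nat.cast_zero, om_zero, one_mul] at z
        rw [z, hk x, show x + 1 + -μ = x + -μ + 1 by ring, th_add_one] at u
        linear_combination u)
    (eq_of_th_mul_eq hτ (f := fun x => k (x + τ)) (g := fun x => -ex (-τ - 2 * (x + μ)) * k x)
      (ck.comp (by fun_prop)) (Continuous.mul (Continuous.neg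
      (differentiable_ex.continuous.comp (by fun_prop))) ck) (-μ) fun x => by
        have u := hk (x + τ)
        have z := z1 x 0 1
        simp only [Int.cast_one, Int.cast_zero, zero_add, one_mul, one_pow, mul_one, Prod.fst_zero,
          Prod.snd_zero, Fin.val_zero, Nat.cast_zero, mul_zero, sub_zero, om_zero] at z
        rw [z, hk x, show x + τ + -μ = x + -μ + τ by ring, th_add_tau,
          show -(2 * τ) - 4 * x = (-τ - 2 * (x + -μ)) + (-τ - 2 * (x + μ)) by ring, ex_add] at u
        apply mul_left_cancel₀ (ex_ne_zero (-τ - 2 * (x + -μ)))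
        linear_combination u)
  -- At the origin each of the `N²` terms is `1/N²`; this fixes the constant `c`.
  have h0 : unitCoeff N μ τ 0 0 = 1 := by
    simp only [unitCoeff, chi_zero_right, weight_zero hτ hμ,
      weight_zero hτ (neg_notMem_lattice hμ)]
    simp
    field_simp
  have h1 := hk 0
  rw [h0, hc 0, zero_add, zero_add, th_neg] at h1
  rw [hk, hc, ← sub_eq_add_neg]
  linear_combination (th τ (ξ - μ) * th τ (ξ + μ)) * h1

/-! ### Crossing symmetry of the weights -/

/-- The coefficients of the product of partially transposed vertex matrices. -/
def crossCoeff (N : ℕ) [NeZero N] (μ τ : ℂ) (γ : Fin N × Fin N) (ξ : ℂ) : ℂ :=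
  ∑ α, weight N (-μ) τ α (ξ + N * μ) * weight N μ τ (γ - α) ξ

/-- The Fourier transform of a convolution is a product, here of two translated sums of weights. The
shift by `Nμ` is chosen so that the numerator `th(μ + x/N)` of one is the denominator of the other
and conversely; the product no longer depends on the frequency `(a, b)`. -/
lemma crossCoeff_eq (hτ : 0 < τ.im) (hμ : ∀ a b : ℤ, μ ≠ a + b * τ) {ξ : ℂ}
    (hξ : Regular μ τ ξ) (γ : Fin N × Fin N) :
    crossCoeff N μ τ γ ξ
      = if γ = 0 then -(th τ (ξ + N * μ) * th τ ξ) / th τ μ ^ 2 else 0 := by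
  have hN : (N : ℂ) ≠ 0 := NeZero.ne _
  refine eq_zero_of_fourier_const (c := fun γ => crossCoeff N μ τ γ ξ) (fun a b => ?_) γ
  have hμ' : th τ μ ≠ 0 := fun h0 => by
    obtain ⟨a, b, hab⟩ := (th_eq_zero_iff hτ _).1 h0; exact hμ a b hab
  have n1 : th τ ((ξ + (a + b * τ)) / N) ≠ 0 := fun h0 => by
    obtain ⟨a', b', hab⟩ := (th_eq_zero_iff hτ _).1 h0
    apply hξ (N * a' - a) 0 (N * b' - b)
    field_simp at hab
    push_cast
    linear_combination hab
  have e0 : (ξ + N * μ + (a + b * τ)) / N = μ + (ξ + (a + b * τ)) / N := by field_simp; ring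
  have n2 : th τ (μ + (ξ + (a + b * τ)) / N) ≠ 0 := fun h0 => by
    obtain ⟨a', b', hab⟩ := (th_eq_zero_iff hτ _).1 h0
    apply hξ (N * a' - a) (-N) (N * b' - b)
    field_simp at hab
    push_cast
    linear_combination hab
  have h1 := sum_om_mul_weight (N := N) μ τ ξ a b
  have h2 := sum_om_mul_weight (N := N) (-μ) τ (ξ + N * μ) a b
  rw [weightSum_eq hτ hμ n1, th_add_lattice] at h1
  rw [weightSum_eq hτ (neg_notMem_lattice hμ) (by rwa [e0]), th_add_lattice, e0, th_neg,
    neg_add_cancel_left] at h2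
  have conv : ∑ δ : Fin N × Fin N, om N (a * (δ.1 : ℕ) - b * (δ.2 : ℕ)) * crossCoeff N μ τ δ ξ
      = (∑ α : Fin N × Fin N, om N (a * (α.1 : ℕ) - b * (α.2 : ℕ)) * weight N (-μ) τ α (ξ + N * μ))
        * ∑ α : Fin N × Fin N, om N (a * (α.1 : ℕ) - b * (α.2 : ℕ)) * weight N μ τ α ξ := by
    simp only [crossCoeff, Finset.mul_sum, Finset.sum_mul]
    rw [Finset.sum_comm]
    conv_rhs => rw [Finset.sum_comm]
    refine Finset.sum_congr rfl fun α _ => ?_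
    rw [← Equiv.sum_comp (Equiv.addRight α)]
    refine Finset.sum_congr rfl fun β _ => ?_
    simp only [Equiv.coe_addRight, add_sub_cancel_right]
    have : om N (a * ((β + α).1 : ℕ) - b * ((β + α).2 : ℕ))
        = om N (a * (α.1 : ℕ) - b * (α.2 : ℕ)) * om N (a * (β.1 : ℕ) - b * (β.2 : ℕ)) := by
      rw [← om_add]
      refine om_congr ?_
      have h := ((val_add_modEq β.1 α.1).mul_left a).sub ((val_add_modEq β.2 α.2).mul_left b)
      convert! h using 1
      ring
    rw [this]; ring
  rw [conv]
  set X := ∑ α : Fin N × Fin N, om N (a * (α.1 : ℕ) - b * (α.2 : ℕ)) * weight N μ τ α ξ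
  set Y := ∑ α : Fin N × Fin N, om N (a * (α.1 : ℕ) - b * (α.2 : ℕ))
    * weight N (-μ) τ α (ξ + N * μ)
  have e1 : ex (a + b - b ^ 2 * τ - 2 * b * ξ) * ex (a + b - b ^ 2 * τ - 2 * b * (ξ + N * μ))
      = ex (a - b - b ^ 2 * τ - 2 * b * (ξ + μ / N))
        * ex (a - b - b ^ 2 * τ - 2 * b * (ξ + N * μ + -μ / N)) := by
    rw [← ex_add, ← ex_add]
    have : (a + b - b ^ 2 * τ - 2 * b * ξ + (a + b - b ^ 2 * τ - 2 * b * (ξ + N * μ)) : ℂ)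
      = a - b - b ^ 2 * τ - 2 * b * (ξ + μ / N) + (a - b - b ^ 2 * τ - 2 * b * (ξ + N * μ + -μ / N))
        + 2 * ((2 * b : ℤ) : ℂ) := by push_cast; ring
    rw [this, ex_add _ (2 * _), ex_two_int, mul_one]
  apply mul_left_cancel₀ (mul_ne_zero (ex_ne_zero (a - b - b ^ 2 * τ - 2 * b * (ξ + μ / N)))
    (ex_ne_zero (a - b - b ^ 2 * τ - 2 * b * (ξ + N * μ + -μ / N))))
  rw [← e1]
  have e2 : ex (a - b - b ^ 2 * τ - 2 * b * (ξ + μ / N))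
      * ex (a - b - b ^ 2 * τ - 2 * b * (ξ + N * μ + -μ / N)) * (Y * X)
      = (ex (a - b - b ^ 2 * τ - 2 * b * (ξ + μ / N)) * X)
        * (ex (a - b - b ^ 2 * τ - 2 * b * (ξ + N * μ + -μ / N)) * Y) := by ring
  rw [e1, e2, ← h1, ← h2, ← e1]
  generalize th τ (μ + (ξ + (a + b * τ)) / N) = A at n2 ⊢
  generalize th τ ((ξ + (a + b * τ)) / N) = B at n1 ⊢
  field_simp

end

/-! ### The matrices `I_α` -/

section
variable {N : ℕ} [NeZero N] {μ τ : ℂ}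

omit [NeZero N] in
lemma gMat_eq : gMat N = Matrix.diagonal fun i : Fin N => om N (i : ℕ) := by
  rw [gMat]; congr 1

omit [NeZero N] in
lemma gHalf_mul_gHalf : gHalf N * gHalf N = gMat N := by
  rw [gHalf, gMat, Matrix.diagonal_mul_diagonal]
  congr 1; funext i
  rw [← ex_add]; congr 1; ring

omit [NeZero N] in
lemma isUnit_gHalf : IsUnit (gHalf N) := by
  rw [Matrix.isUnit_iff_isUnit_det, gHalf, Matrix.det_diagonal, isUnit_iff_ne_zero]
  exact Finset.prod_ne_zero_iff.2 fun i _ => ex_ne_zero _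

omit [NeZero N] in
lemma gMat_pow (n : ℕ) : gMat N ^ n = Matrix.diagonal fun i : Fin N => om N (n * (i : ℕ)) := by
  rw [gMat_eq, Matrix.diagonal_pow]
  congr 1; funext i
  rw [Pi.pow_apply, om, om, ← ex_nat_mul]; congr 1; push_cast; ring

lemma gMat_pow_card : gMat N ^ N = 1 := by
  rw [gMat_pow, ← Matrix.diagonal_one]
  congr 1; funext i
  exact (om_eq_one_iff _).2 ⟨_, rfl⟩

lemma hMat_apply (i j : Fin N) : hMat N i j = if i + 1 = j then 1 else 0 := rfl

lemma hMat_pow_apply (n : ℕ) (i j : Fin N) :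
    (hMat N ^ n) i j = if (i + n) % N = (j : ℕ) then 1 else 0 := by
  induction n generalizing j with
  | zero =>
    rw [pow_zero, Matrix.one_apply, add_zero, Nat.mod_eq_of_lt i.2]
    simp only [Fin.ext_iff]
  | succ n ih =>
    rw [pow_succ, Matrix.mul_apply]
    simp only [ih, hMat_apply]
    have hlt : (i + n) % N < N := Nat.mod_lt _ (NeZero.pos N)
    rw [Finset.sum_eq_single ⟨(i + n) % N, hlt⟩]
    · simp only [Fin.ext_iff, Fin.val_add, if_true, one_mul, Fin.val_one']
      congr 2
      rw [← Nat.add_mod, add_assoc]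
    · intro l _ hl
      rw [if_neg (fun h => hl (Fin.ext h.symm)), zero_mul]
    · simp

lemma hMat_pow_card : hMat N ^ N = 1 := by
  ext i j
  rw [hMat_pow_apply, Matrix.one_apply, Nat.add_mod_right, Nat.mod_eq_of_lt i.2]
  simp only [Fin.ext_iff]

lemma hMat_pow_mul_gMat_pow (m n : ℕ) :
    hMat N ^ m * gMat N ^ n = om N (m * n) • (gMat N ^ n * hMat N ^ m) := by
  ext i j
  rw [gMat_pow, Matrix.mul_diagonal, Matrix.smul_apply, Matrix.diagonal_mul, hMat_pow_apply]
  split_ifs with h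
  · rw [one_mul, mul_one, smul_eq_mul, ← om_add]
    refine om_congr ?_
    rw [← h]
    push_cast
    have h1 : ((i + m : ℤ) % N) ≡ i + m [ZMOD N] := Int.mod_modEq _ _
    convert! h1.mul_left n using 1
    ring
  · simp

lemma gMat_pow_val_add (i j : Fin N) :
    gMat N ^ ((i + j : Fin N) : ℕ) = gMat N ^ (i : ℕ) * gMat N ^ (j : ℕ) := by
  rw [Fin.val_add, ← pow_add, ← pow_eq_pow_mod _ gMat_pow_card]

lemma hMat_pow_val_add (i j : Fin N) :
    hMat N ^ ((i + j : Fin N) : ℕ) = hMat N ^ (i : ℕ) * hMat N ^ (j : ℕ) := by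
  rw [Fin.val_add, ← pow_add, ← pow_eq_pow_mod _ hMat_pow_card]

omit [NeZero N] in
lemma gHalf_inv_mul : (gHalf N)⁻¹ * gHalf N = 1 :=
  Matrix.nonsing_inv_mul _ ((Matrix.isUnit_iff_isUnit_det _).1 isUnit_gHalf)

omit [NeZero N] in
lemma gHalf_mul_inv : gHalf N * (gHalf N)⁻¹ = 1 :=
  Matrix.mul_nonsing_inv _ ((Matrix.isUnit_iff_isUnit_det _).1 isUnit_gHalf)

lemma iMat_mul (α β : Fin N × Fin N) :
    iMat N α * iMat N β = om N ((α.1 : ℕ) * (β.2 : ℕ)) • iMat N (α + β) := by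
  have e : iMat N α * iMat N β = gHalf N * (gMat N ^ (α.2 : ℕ) * (hMat N ^ (α.1 : ℕ)
      * gMat N ^ (β.2 : ℕ)) * hMat N ^ (β.1 : ℕ)) * (gHalf N)⁻¹ := by
    simp only [iMat, mul_assoc]
    rw [← mul_assoc (gHalf N)⁻¹ (gHalf N), gHalf_inv_mul, one_mul]
  rw [e, hMat_pow_mul_gMat_pow, iMat, Prod.snd_add, Prod.fst_add, gMat_pow_val_add,
    hMat_pow_val_add]
  simp only [Matrix.mul_smul, Matrix.smul_mul, mul_assoc]

lemma iMat_zero : iMat N 0 = 1 := by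
  simp [iMat, gHalf_mul_inv]

lemma isUnit_iMat (α : Fin N × Fin N) : IsUnit (iMat N α) := by
  have h := iMat_mul α (-α)
  rw [add_neg_cancel, iMat_zero] at h
  rw [Matrix.isUnit_iff_isUnit_det, isUnit_iff_ne_zero]
  intro h0
  have h1 := congrArg Matrix.det h
  rw [Matrix.det_mul, h0, zero_mul, Matrix.det_smul, Matrix.det_one, mul_one] at h1
  exact pow_ne_zero _ (om_ne_zero _) h1.symm

lemma iMat_inv_mul (α β : Fin N × Fin N) :
    (iMat N α)⁻¹ * (iMat N β)⁻¹ = (om N ((β.1 : ℕ) * (α.2 : ℕ)))⁻¹ • (iMat N (α + β))⁻¹ := by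
  rw [← Matrix.mul_inv_rev, iMat_mul, add_comm β α]
  have := om_ne_zero (N := N) ((β.1 : ℕ) * (α.2 : ℕ))
  refine Matrix.inv_eq_left_inv ?_
  rw [Matrix.smul_mul, Matrix.mul_smul, smul_smul, inv_mul_cancel₀ this, one_smul,
    Matrix.nonsing_inv_mul _ ((Matrix.isUnit_iff_isUnit_det _).1 (isUnit_iMat _))]

/-- `I_α ⊗ I_α⁻¹`. -/
def eMat (α : Fin N × Fin N) : Matrix (Fin N × Fin N) (Fin N × Fin N) ℂ :=
  iMat N α ⊗ₖ (iMat N α)⁻¹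

/-- The phases from `I_α I_β` and from the inverses combine into the symplectic pairing, so products
of vertex matrices are twisted convolutions of weights. -/
lemma eMat_mul (α β : Fin N × Fin N) : eMat α * eMat β = chi α β • eMat (α + β) := by
  rw [eMat, eMat, ← Matrix.mul_kronecker_mul, iMat_mul, iMat_inv_mul, Matrix.smul_kronecker,
    Matrix.kronecker_smul, smul_smul, chi, eMat, sub_eq_add_neg, om_add, om_neg,
    mul_comm ((α.2 : ℕ) : ℤ)]

lemma eMat_zero : eMat (N := N) 0 = 1 := by
  rw [eMat, iMat_zero, inv_one, Matrix.one_kronecker_one]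

/-! ### The matrix `a` -/

/-- The root of unity obtained here is inverse to the character by which `ξ ↦ ξ + 1 + τ` acts on the
weight of index `α`. This is why `a` implements that shift on the vertex matrix. -/
lemma aMat_mul_iMat (α : Fin N × Fin N) :
    aMat N * iMat N α = om N ((α.2 : ℕ) - (α.1 : ℕ)) • (iMat N α * aMat N) := by
  have gg : gHalf N = gMat N * (gHalf N)⁻¹ := by
    rw [← gHalf_mul_gHalf, mul_assoc, gHalf_mul_inv, mul_one]
  have e1 : aMat N * iMat N α = gHalf N * ((hMat N ^ 1 * gMat N ^ ((α.2 : ℕ) + 1))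
      * hMat N ^ (α.1 : ℕ)) * (gHalf N)⁻¹ := by
    simp only [aMat, iMat, mul_assoc]
    rw [← mul_assoc (gHalf N) (gHalf N), gHalf_mul_gHalf, pow_succ' (gMat N)]
    simp only [pow_one, mul_assoc]
  have e2 : iMat N α * aMat N = gHalf N * (gMat N ^ (α.2 : ℕ) * (hMat N ^ ((α.1 : ℕ) + 1)
      * gMat N ^ 1)) * (gHalf N)⁻¹ := by
    simp only [aMat, iMat, mul_assoc]
    rw [← mul_assoc (gHalf N)⁻¹ (gHalf N), gHalf_inv_mul, one_mul]
    rw [pow_one, ← gg, pow_succ, mul_assoc]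
  rw [e1, e2, hMat_pow_mul_gMat_pow, hMat_pow_mul_gMat_pow]
  simp only [Matrix.mul_smul, Matrix.smul_mul, smul_smul, ← om_add]
  congr 1
  · congr 1; push_cast; ring
  · rw [pow_succ (gMat N), pow_succ' (hMat N) (α.1 : ℕ), pow_one, pow_one]
    simp only [mul_assoc]

lemma isUnit_hMat : IsUnit (hMat N) :=
  IsUnit.of_pow_eq_one hMat_pow_card (NeZero.ne N)

lemma isUnit_aMat : IsUnit (aMat N) := (isUnit_gHalf.mul isUnit_hMat).mul isUnit_gHalf

/-- `a ⊗ 1`. -/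
def aOne (N : ℕ) [NeZero N] : Matrix (Fin N × Fin N) (Fin N × Fin N) ℂ :=
  aMat N ⊗ₖ (1 : Matrix (Fin N) (Fin N) ℂ)

lemma aOne_mul_eMat (α : Fin N × Fin N) :
    aOne N * eMat α = om N ((α.2 : ℕ) - (α.1 : ℕ)) • (eMat α * aOne N) := by
  rw [aOne, eMat, ← Matrix.mul_kronecker_mul, ← Matrix.mul_kronecker_mul, aMat_mul_iMat, one_mul,
    mul_one, Matrix.smul_kronecker]

/-! ### The vertex matrix -/

/-- The vertex matrix without its scalar prefactor. -/
def vMat (N : ℕ) [NeZero N] (μ τ ξ : ℂ) : Matrix (Fin N × Fin N) (Fin N × Fin N) ℂ :=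
  ∑ α : Fin N × Fin N, weight N μ τ α ξ • eMat α

lemma sum_smul_eMat_mul (c d : Fin N × Fin N → ℂ) :
    (∑ α, c α • eMat α) * (∑ β, d β • eMat β)
      = ∑ γ, (∑ α, chi α γ * (c α * d (γ - α))) • eMat γ := by
  simp only [Finset.sum_mul, Finset.mul_sum, Finset.sum_smul, Matrix.smul_mul, Matrix.mul_smul,
    eMat_mul, smul_smul]
  rw [Finset.sum_comm]
  conv_rhs => rw [Finset.sum_comm]
  refine Finset.sum_congr rfl fun α _ => ?_
  rw [← Equiv.sum_comp (Equiv.subRight α)]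
  refine Finset.sum_congr rfl fun γ _ => ?_
  simp only [Equiv.subRight_apply, add_sub_cancel, chi_sub_right_self]
  congr 1; ring

lemma vMat_mul (hτ : 0 < τ.im) (hμ : ∀ a b : ℤ, μ ≠ a + b * τ) (ξ : ℂ) :
    vMat N μ τ ξ * vMat N (-μ) τ ξ
      = unitCoeff N μ τ 0 ξ • (1 : Matrix (Fin N × Fin N) (Fin N × Fin N) ℂ) := by
  rw [vMat, vMat, sum_smul_eMat_mul, Finset.sum_eq_single 0, eMat_zero]
  · rfl
  · intro γ _ hγ
    have := unitCoeff_eq_zero hτ hμ hγ ξ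
    rw [unitCoeff] at this
    rw [this, zero_smul]
  · simp

lemma aOne_mul_vMat_add (μ τ ξ : ℂ) :
    aOne N * vMat N μ τ (ξ + (τ + 1))
      = ex (-τ - 2 * (ξ + μ / N)) • (vMat N μ τ ξ * aOne N) := by
  rw [vMat, vMat, Finset.mul_sum, Finset.sum_mul, Finset.smul_sum]
  refine Finset.sum_congr rfl fun α _ => ?_
  have h := weight_add_lattice (N := N) μ τ α ξ 1 1
  rw [show ((1 : ℤ) : ℂ) + ((1 : ℤ) : ℂ) * τ = τ + 1 by push_cast; ring] at h
  rw [h, Matrix.mul_smul, aOne_mul_eMat, smul_smul, Matrix.smul_mul, smul_smul]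
  congr 1
  have e : om N (1 * (α.1 : ℕ) - 1 * (α.2 : ℕ)) * om N ((α.2 : ℕ) - (α.1 : ℕ)) = 1 := by
    rw [← om_add, ← om_zero (N := N)]; congr 1; ring
  have e2 : ((1 : ℤ) : ℂ) - ((1 : ℤ) : ℂ) - ((1 : ℤ) : ℂ) ^ 2 * τ - 2 * ((1 : ℤ) : ℂ) * (ξ + μ / N)
    = -τ - 2 * (ξ + μ / N) := by push_cast; ring
  rw [e2]
  linear_combination ex (-τ - 2 * (ξ + μ / N)) * weight N μ τ α ξ * e

lemma vMat_add_int (μ τ ξ : ℂ) {k : ℤ} (hk : (N : ℤ) ∣ k) :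
    vMat N μ τ (ξ + k) = ex k • vMat N μ τ ξ := by
  rw [vMat, vMat, Finset.smul_sum]
  refine Finset.sum_congr rfl fun α _ => ?_
  have h := weight_add_lattice (N := N) μ τ α ξ k 0
  have e : om N (k * (α.1 : ℕ) - 0 * (α.2 : ℕ)) = 1 :=
    (om_eq_one_iff _).2 (by rw [zero_mul, sub_zero]; exact hk.mul_right _)
  rw [e] at h
  simp only [Int.cast_zero, zero_mul, add_zero, sub_zero, ne_eq, OfNat.ofNat_ne_zero,
    not_false_eq_true, zero_pow, mul_zero, mul_one] at h
  rw [h, smul_smul]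

/-! ### Crossing -/

/-- `A^{t₁} B^{t₁} = 1`, where `t₁` is the transposition in the first tensor factor. -/
def Crossed {n : Type} [Fintype n] [DecidableEq n] (A B : Matrix (n × n) (n × n) ℂ) : Prop :=
  ∀ j k m l : n, ∑ i, ∑ r, A (i, j) (k, r) * B (m, r) (i, l)
    = (1 : Matrix n n ℂ) m k * (1 : Matrix n n ℂ) j l

/-- Transposition in the first factor reverses the order there, and the phase of `I_β I_α` is
inverse to that of `I_α⁻¹ I_β⁻¹`. Crossing therefore involves the untwisted convolution. -/
lemma sum_eMat_mul_eMat (α β : Fin N × Fin N) (j k m l : Fin N) :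
    ∑ i, ∑ r, eMat α (i, j) (k, r) * eMat β (m, r) (i, l)
      = iMat N (α + β) m k * (iMat N (α + β))⁻¹ j l := by
  have h1 : ∑ i, iMat N β m i * iMat N α i k
      = om N ((β.1 : ℕ) * (α.2 : ℕ)) * iMat N (α + β) m k := by
    rw [← Matrix.mul_apply, iMat_mul, add_comm β α]; rfl
  have h2 : ∑ r, (iMat N α)⁻¹ j r * (iMat N β)⁻¹ r l
      = (om N ((β.1 : ℕ) * (α.2 : ℕ)))⁻¹ * (iMat N (α + β))⁻¹ j l := by
    rw [← Matrix.mul_apply, iMat_inv_mul]; rfl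
  have := om_ne_zero (N := N) ((β.1 : ℕ) * (α.2 : ℕ))
  calc _ = (∑ i, iMat N β m i * iMat N α i k) * ∑ r, (iMat N α)⁻¹ j r * (iMat N β)⁻¹ r l := by
        rw [Finset.sum_mul_sum]
        refine Finset.sum_congr rfl fun i _ => Finset.sum_congr rfl fun r _ => ?_
        simp only [eMat, Matrix.kroneckerMap_apply]; ring
    _ = _ := by rw [h1, h2]; field_simp

lemma sum_smul_eMat_crossed (c d : Fin N × Fin N → ℂ) (v : ℂ)
    (h : ∀ γ, ∑ α, c α * d (γ - α) = if γ = 0 then v else 0) (j k m l : Fin N) :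
    ∑ i, ∑ r, (∑ α, c α • eMat α) (i, j) (k, r) * (∑ β, d β • eMat β) (m, r) (i, l)
      = v * ((1 : Matrix (Fin N) (Fin N) ℂ) m k * (1 : Matrix (Fin N) (Fin N) ℂ) j l) := by
  simp only [Matrix.sum_apply, Matrix.smul_apply, smul_eq_mul, Finset.sum_mul_sum]
  calc _ = ∑ α, ∑ β, c α * d β * ∑ i, ∑ r, eMat α (i, j) (k, r) * eMat β (m, r) (i, l) := by
        simp only [Finset.mul_sum]
        rw [Finset.sum_congr rfl fun i _ => Finset.sum_comm, Finset.sum_comm]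
        refine Finset.sum_congr rfl fun α _ => ?_
        rw [Finset.sum_congr rfl fun i _ => Finset.sum_comm, Finset.sum_comm]
        refine Finset.sum_congr rfl fun β _ => Finset.sum_congr rfl fun i _ =>
          Finset.sum_congr rfl fun r _ => ?_
        ring
    _ = ∑ γ, (∑ α, c α * d (γ - α)) * (iMat N γ m k * (iMat N γ)⁻¹ j l) := by
        simp only [sum_eMat_mul_eMat, Finset.sum_mul]
        conv_rhs => rw [Finset.sum_comm]
        refine Finset.sum_congr rfl fun α _ => ?_
        rw [← Equiv.sum_comp (Equiv.subRight α)]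
        refine Finset.sum_congr rfl fun γ _ => ?_
        simp only [Equiv.subRight_apply, add_sub_cancel]
    _ = _ := by
        simp only [h]
        rw [Finset.sum_eq_single 0]
        · rw [if_pos rfl, iMat_zero, inv_one]
        · intro γ _ hγ; rw [if_neg hγ, zero_mul]
        · simp

end

/-! ### The scalar factor `κ` -/

/-- The double infinite product in additive notation. -/
def dpoch (σ ρ s : ℂ) : ℂ := poch₂ (ex (2 * s)) (ex (2 * σ)) (ex (2 * ρ))

/-- `Theta` in additive notation. -/
def thAdd (ρ s : ℂ) : ℂ := Theta (ex (2 * ρ)) (ex (2 * s))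

/-- `s` is not in `ℤ + ℤσ + ℤρ`. -/
def NotLattice (σ ρ s : ℂ) : Prop := ∀ a d e : ℤ, s ≠ a + d * σ + e * ρ

lemma NotLattice.neg {σ ρ s : ℂ} (h : NotLattice σ ρ s) : NotLattice σ ρ (-s) :=
  fun a d e hs => h (-a) (-d) (-e) (by push_cast; linear_combination -hs)

lemma NotLattice.shift {σ ρ s : ℂ} (h : NotLattice σ ρ s) {t : ℂ} (d e : ℤ)
    (ht : t = s + d * σ + e * ρ) : NotLattice σ ρ t :=
  fun a d' e' hs => h a (d' - d) (e' - e) (by push_cast; linear_combination hs - ht)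

lemma NotLattice.symm {σ ρ s : ℂ} (h : NotLattice σ ρ s) : NotLattice ρ σ s :=
  fun a d e hs => h a e d (by linear_combination hs)

section
variable {σ ρ : ℂ} (hσ : 0 < σ.im) (hρ : 0 < ρ.im)
include hρ

lemma poch_ne_zero_of_notLattice {s : ℂ} (h : NotLattice σ ρ s) :
    poch (ex (2 * s)) (ex (2 * ρ)) ≠ 0 := by
  refine poch_ne_zero (norm_ex_two_mul_lt_one hρ) fun n hn => ?_
  rw [← ex_nat_mul, ← ex_add, ex_eq_one_iff] at hn
  obtain ⟨m, hm⟩ := hn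
  exact h m 0 (-n) (by push_cast; linear_combination hm / 2)

lemma poch_self_ne_zero : poch (ex (2 * ρ)) (ex (2 * ρ)) ≠ 0 := by
  refine poch_ne_zero (norm_ex_two_mul_lt_one hρ) fun n hn => ?_
  rw [← pow_succ', ← ex_nat_mul] at hn
  have h1 : ‖ex (((n + 1 : ℕ) : ℂ) * (2 * ρ))‖ < 1 := norm_ex_lt_one (by
    rw [← ofReal_natCast, im_ofReal_mul, ← ofReal_ofNat, im_ofReal_mul]; positivity)
  rw [hn] at h1
  simp at h1

omit hρ in
lemma thAdd_eq (ρ s : ℂ) : thAdd ρ s = poch (ex (2 * s)) (ex (2 * ρ))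
    * poch (ex (2 * (ρ - s))) (ex (2 * ρ)) * poch (ex (2 * ρ)) (ex (2 * ρ)) := by
  rw [thAdd, Theta, mul_sub, sub_eq_add_neg, ex_add, ex_neg]

lemma thAdd_ne_zero {s : ℂ} (h : NotLattice σ ρ s) : thAdd ρ s ≠ 0 := by
  rw [thAdd_eq]
  exact mul_ne_zero (mul_ne_zero (poch_ne_zero_of_notLattice hρ h)
    (poch_ne_zero_of_notLattice hρ (h.neg.shift 0 1 (by push_cast; ring)))) (poch_self_ne_zero hρ)

lemma thAdd_add (s : ℂ) : thAdd ρ (s + ρ) = -ex (-(2 * s)) * thAdd ρ s := by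
  rw [thAdd, thAdd, mul_add, add_comm, ex_add,
    Theta_mul_self (norm_ex_two_mul_lt_one hρ) (ex_ne_zero _) (ex_ne_zero _), ex_neg]

omit hρ in
lemma thAdd_add_int (ρ s : ℂ) (k : ℤ) : thAdd ρ (s + k) = thAdd ρ s := by
  rw [thAdd, thAdd, mul_add, ex_add, ex_two_int, mul_one]

omit hρ in
lemma thAdd_add_one (ρ s : ℂ) : thAdd ρ (s + 1) = thAdd ρ s := by
  simpa using thAdd_add_int ρ s 1

include hσ

lemma dpoch_ne_zero {s : ℂ} (h : NotLattice σ ρ s) : dpoch σ ρ s ≠ 0 := by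
  refine poch₂_ne_zero (norm_ex_two_mul_lt_one hσ) (norm_ex_two_mul_lt_one hρ) fun n m hn => ?_
  rw [← ex_nat_mul, ← ex_nat_mul, ← ex_add, ← ex_add, ex_eq_one_iff] at hn
  obtain ⟨k, hk⟩ := hn
  exact h k (-n) (-m) (by push_cast; linear_combination hk / 2)

lemma dpoch_eq {s t : ℂ} (ht : t = s + σ) :
    dpoch σ ρ s = poch (ex (2 * s)) (ex (2 * ρ)) * dpoch σ ρ t := by
  rw [dpoch, dpoch, poch₂_eq_left (norm_ex_two_mul_lt_one hσ) (norm_ex_two_mul_lt_one hρ), ht,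
    mul_add, ex_add]

omit hσ hρ

lemma dpoch_comm (σ ρ s : ℂ) : dpoch σ ρ s = dpoch ρ σ s := poch₂_comm _ _ _

lemma dpoch_add_int (σ ρ s : ℂ) (k : ℤ) : dpoch σ ρ (s + k) = dpoch σ ρ s := by
  rw [dpoch, dpoch, mul_add, ex_add, ex_two_int, mul_one]

/-- `1/κ` in additive notation. -/
def kappaAdd (σ ρ μ ξ : ℂ) : ℂ :=
  dpoch σ ρ (ρ - ξ) * dpoch σ ρ (μ + ξ) * dpoch σ ρ (σ - ξ) * dpoch σ ρ (σ + ρ - μ + ξ)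
    / (dpoch σ ρ (ρ + ξ) * dpoch σ ρ (μ - ξ) * dpoch σ ρ (σ + ξ) * dpoch σ ρ (σ + ρ - μ - ξ))

/-- By this symmetry one shift formula serves twice: with `σ = τ` for quasi-periodicity and with `σ
= Nμ` for crossing. -/
lemma kappaAdd_comm (σ ρ μ ξ : ℂ) : kappaAdd σ ρ μ ξ = kappaAdd ρ σ μ ξ := by
  unfold kappaAdd
  simp only [dpoch_comm σ ρ]
  rw [add_comm σ ρ]
  ring

lemma kappaAdd_add_int (σ ρ μ ξ : ℂ) (k : ℤ) : kappaAdd σ ρ μ (ξ + k) = kappaAdd σ ρ μ ξ := by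
  have m : ∀ s, dpoch σ ρ (s - (ξ + k)) = dpoch σ ρ (s - ξ) := fun s => by
    rw [← dpoch_add_int σ ρ _ k]; congr 1; ring
  unfold kappaAdd
  simp only [m, ← add_assoc, dpoch_add_int]

lemma kappaAdd_add_one (σ ρ μ ξ : ℂ) : kappaAdd σ ρ μ (ξ + 1) = kappaAdd σ ρ μ ξ := by
  simpa using kappaAdd_add_int σ ρ μ ξ 1

include hσ hρ

lemma kappaAdd_ne_zero {μ ξ : ℂ} (h0 : NotLattice σ ρ ξ) (h1 : NotLattice σ ρ (μ + ξ))
    (h2 : NotLattice σ ρ (μ - ξ)) : kappaAdd σ ρ μ ξ ≠ 0 := by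
  have n1 := dpoch_ne_zero hσ hρ (h0.neg.shift (t := ρ - ξ) 0 1 (by push_cast; ring))
  have n2 := dpoch_ne_zero hσ hρ h1
  have n3 := dpoch_ne_zero hσ hρ (h0.neg.shift (t := σ - ξ) 1 0 (by push_cast; ring))
  have n4 := dpoch_ne_zero hσ hρ (h2.neg.shift (t := σ + ρ - μ + ξ) 1 1 (by push_cast; ring))
  have n5 := dpoch_ne_zero hσ hρ (h0.shift (t := ρ + ξ) 0 1 (by push_cast; ring))
  have n6 := dpoch_ne_zero hσ hρ h2
  have n7 := dpoch_ne_zero hσ hρ (h0.shift (t := σ + ξ) 1 0 (by push_cast; ring))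
  have n8 := dpoch_ne_zero hσ hρ (h1.neg.shift (t := σ + ρ - μ - ξ) 1 1 (by push_cast; ring))
  unfold kappaAdd
  positivity

/-- Under a shift by `σ` each of the eight double products gains or loses one row, a simple product
in the other modulus. The eight rows pair off, `s` with `ρ - s`, into four theta functions of
modulus `ρ`. -/
lemma kappaAdd_shift {μ ξ : ℂ} (h0 : NotLattice σ ρ ξ) (h1 : NotLattice σ ρ (μ + ξ))
    (h2 : NotLattice σ ρ (μ - ξ)) :
    kappaAdd σ ρ μ (ξ + σ) = kappaAdd σ ρ μ ξ
      * (thAdd ρ (-ξ) * thAdd ρ (ξ + σ) / (thAdd ρ (μ + ξ) * thAdd ρ (μ - ξ - σ))) := by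
  have n5 := dpoch_ne_zero hσ hρ (h0.shift (t := ρ + (ξ + σ)) 1 1 (by push_cast; ring))
  have n6 := dpoch_ne_zero hσ hρ h2
  have n7 := dpoch_ne_zero hσ hρ (h0.shift (t := σ + (ξ + σ)) 2 0 (by push_cast; ring))
  have n8 := dpoch_ne_zero hσ hρ (h1.neg.shift (t := σ + ρ - μ - ξ) 1 1 (by push_cast; ring))
  have p1 := poch_ne_zero_of_notLattice hρ (h0.shift (t := ρ + ξ) 0 1 (by push_cast; ring))
  have p2 := poch_ne_zero_of_notLattice hρ (h2.shift (t := μ - ξ - σ) (-1) 0 (by push_cast; ring))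
  have p3 := poch_ne_zero_of_notLattice hρ (h0.shift (t := ξ + σ) 1 0 (by push_cast; ring))
  have p4 := poch_ne_zero_of_notLattice hρ
    (h1.neg.shift (t := ρ - (μ + ξ)) 0 1 (by push_cast; ring))
  have p5 := poch_ne_zero_of_notLattice hρ h1
  have p6 := poch_ne_zero_of_notLattice hρ
    (h2.neg.shift (t := ρ - (μ - ξ - σ)) 1 1 (by push_cast; ring))
  have p0 := poch_self_ne_zero hρ
  have e1 := dpoch_eq hσ hρ (s := ρ - (ξ + σ)) (t := ρ - ξ) (by ring)
  have e2 := dpoch_eq hσ hρ (s := μ + ξ) (t := μ + (ξ + σ)) (by ring)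
  have e3 := dpoch_eq hσ hρ (s := -ξ) (t := σ - ξ) (by ring)
  have e4 := dpoch_eq hσ hρ (s := ρ - (μ - ξ - σ)) (t := σ + ρ - μ + (ξ + σ)) (by ring)
  have e5 := dpoch_eq hσ hρ (s := ρ + ξ) (t := ρ + (ξ + σ)) (by ring)
  have e6 := dpoch_eq hσ hρ (s := μ - ξ - σ) (t := μ - ξ) (by ring)
  have e7 := dpoch_eq hσ hρ (s := ξ + σ) (t := σ + (ξ + σ)) (by ring)
  have e8 := dpoch_eq hσ hρ (s := ρ - (μ + ξ)) (t := σ + ρ - μ - ξ) (by ring)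
  simp only [thAdd_eq]
  unfold kappaAdd
  rw [show σ - (ξ + σ) = -ξ by ring, show μ - (ξ + σ) = μ - ξ - σ by ring,
    show σ + ρ - μ - (ξ + σ) = ρ - (μ + ξ) by ring,
    show σ + ρ - μ + ξ = ρ - (μ - ξ - σ) by ring, show σ + ξ = ξ + σ by ring,
    e1, e2, e3, e4, e5, e6, e7, e8, show ρ - -ξ = ρ + ξ by ring]
  field_simp

end

lemma kappaInv_eq (N : ℕ) (μ τ ξ : ℂ) :
    kappaInv N (ex μ) (ex (2 * τ)) (ex (2 * ξ)) = kappaAdd τ (N * μ) μ ξ := by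
  have b : ex μ ^ (2 * N) = ex (2 * (N * μ)) := by
    rw [← ex_nat_mul]; congr 1; push_cast; ring
  have q2 : ex μ ^ 2 = ex (2 * μ) := by rw [← ex_nat_mul]; congr 1
  simp only [kappaInv, kappaAdd, dpoch, b, q2, ← ex_neg, ← ex_add]
  ring_nf

/-! ### The scalar factor of `R` -/

section
variable {N : ℕ} [NeZero N] {μ τ : ℂ}

lemma tauN_eq (N : ℕ) (μ ξ : ℂ) : tauN N μ (μ / 2 + ξ) = ex ((μ / 2 + ξ) * (2 / N - 2))
    * (thAdd (N * μ) (μ + ξ) / thAdd (N * μ) (-ξ)) := by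
  have b : ex μ ^ (2 * N) = ex (2 * (N * μ)) := by
    rw [← ex_nat_mul]; congr 1; push_cast; ring
  simp only [tauN, thAdd, b, ← ex_add]
  ring_nf

lemma tauN_eq' (N : ℕ) (μ ξ : ℂ) : tauN N μ (μ / 2 - ξ) = ex ((μ / 2 - ξ) * (2 / N - 2))
    * (thAdd (N * μ) (μ - ξ) / thAdd (N * μ) ξ) := by
  have := tauN_eq N μ (-ξ)
  rwa [neg_neg, ← sub_eq_add_neg, ← sub_eq_add_neg] at this

lemma tauTilde_eq (N : ℕ) (μ ξ : ℂ) : tauTilde N μ ξ = ex (μ * (2 / N - 2))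
    * (thAdd (N * μ) (μ - ξ) * thAdd (N * μ) (μ + ξ)
      / (thAdd (N * μ) ξ * thAdd (N * μ) (-ξ))) := by
  rw [tauTilde, tauN_eq, tauN_eq', show μ * (2 / (N : ℂ) - 2) = (μ / 2 - ξ) * (2 / N - 2)
    + (μ / 2 + ξ) * (2 / N - 2) by ring, ex_add]
  ring

/-- The scalar prefactor of `R`. -/
def rScal (N : ℕ) (μ τ ξ : ℂ) : ℂ :=
  ex (μ / 2 * (2 / N - 2)) * (thAdd (N * μ) (μ - ξ) / thAdd (N * μ) ξ)
    * kappaAdd τ (N * μ) μ ξ * (th τ μ / th τ (ξ + μ))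

lemma rMat_eq (μ τ ξ : ℂ) : rMat N μ τ ξ = rScal N μ τ ξ • vMat N μ τ ξ := by
  have e : rMat N μ τ ξ = (tauN N μ (μ / 2 - ξ) * (ex (ξ * (2 / N - 2))
      * kappaInv N (ex μ) (ex (2 * τ)) (ex (2 * ξ)) * (th τ μ / th τ (ξ + μ)))) • vMat N μ τ ξ := by
    rw [rMat, wMat, smul_smul]; rfl
  rw [e, tauN_eq', kappaInv_eq, rScal, show μ / 2 * (2 / (N : ℂ) - 2) = (μ / 2 - ξ) * (2 / N - 2)
    + ξ * (2 / N - 2) by ring, ex_add]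
  congr 1
  ring

lemma Regular.neg {ξ : ℂ} (h : Regular μ τ ξ) : Regular μ τ (-ξ) :=
  fun a b d hs => h (-a) (-b) (-d) (by push_cast; linear_combination -hs)

lemma Regular.shift {ξ t : ℂ} (h : Regular μ τ ξ) (a b d : ℤ)
    (ht : t = ξ + a + b * μ + d * τ) : Regular μ τ t :=
  fun a' b' d' hs => h (a' - a) (b' - b) (d' - d) (by push_cast; linear_combination hs - ht)

omit [NeZero N] in
lemma Regular.notLattice {ξ : ℂ} (h : Regular μ τ ξ) : NotLattice τ (N * μ) ξ :=
  fun a d e hs => h a (e * N) d (by push_cast; linear_combination hs)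

lemma Regular.th_ne_zero (hτ : 0 < τ.im) {ξ : ℂ} (h : Regular μ τ ξ) : th τ ξ ≠ 0 := fun h0 => by
  obtain ⟨a, b, hab⟩ := (th_eq_zero_iff hτ _).1 h0
  exact h a 0 b (by push_cast; linear_combination hab)

lemma im_nat_mul_pos (hμ : 0 < μ.im) : 0 < ((N : ℂ) * μ).im := by
  have : 0 < (N : ℝ) := by exact_mod_cast NeZero.pos N
  rw [← ofReal_natCast, im_ofReal_mul]
  positivity

lemma th_mu_ne_zero (hτ : 0 < τ.im) (hμ : ∀ a b : ℤ, μ ≠ a + b * τ) : th τ μ ≠ 0 := fun h0 => by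
  obtain ⟨a, b, hab⟩ := (th_eq_zero_iff hτ _).1 h0; exact hμ a b hab

lemma tauTilde_ne_zero (hμi : 0 < μ.im) {ξ : ℂ} (h : Regular μ τ ξ) : tauTilde N μ ξ ≠ 0 := by
  have hρ := im_nat_mul_pos (N := N) hμi
  have n1 := thAdd_ne_zero hρ (h.neg.shift (t := μ - ξ) 0 1 0 (by push_cast; ring)).notLattice
  have n2 := thAdd_ne_zero hρ (h.shift (t := μ + ξ) 0 1 0 (by push_cast; ring)).notLattice
  have n3 := thAdd_ne_zero hρ h.notLattice
  have n4 := thAdd_ne_zero hρ h.neg.notLattice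
  rw [tauTilde_eq]
  exact mul_ne_zero (ex_ne_zero _) (div_ne_zero (mul_ne_zero n1 n2) (mul_ne_zero n3 n4))

lemma rScal_ne_zero (hμi : 0 < μ.im) (hτ : 0 < τ.im) (hμ : ∀ a b : ℤ, μ ≠ a + b * τ) {ξ : ℂ}
    (h : Regular μ τ ξ) : rScal N μ τ ξ ≠ 0 := by
  have hρ := im_nat_mul_pos (N := N) hμi
  have r1 := h.neg.shift (t := μ - ξ) 0 1 0 (by push_cast; ring)
  have r2 := h.shift (t := μ + ξ) 0 1 0 (by push_cast; ring)
  have n1 := thAdd_ne_zero hρ r1.notLattice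
  have n3 := thAdd_ne_zero hρ h.notLattice
  have n4 := kappaAdd_ne_zero hτ hρ h.notLattice r2.notLattice r1.notLattice
  have n5 := th_mu_ne_zero hτ hμ
  have n6 := r2.th_ne_zero hτ
  rw [add_comm] at n6
  exact mul_ne_zero (mul_ne_zero (mul_ne_zero (ex_ne_zero _) (div_ne_zero n1 n3)) n4)
    (div_ne_zero n5 n6)

/-- The thetas of modulus `Nμ` produced by `κ`, together with the explicit ones in the prefactor,
form the theta quotient of `τ̃_N`. -/
lemma rScal_add_tau (hμi : 0 < μ.im) (hτ : 0 < τ.im) {ξ : ℂ} (h : Regular μ τ ξ) :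
    tauTilde N μ ξ * (rScal N μ τ (ξ + (τ + 1)) * ex (-τ - 2 * (ξ + μ / N))) = rScal N μ τ ξ := by
  have hN : (N : ℂ) ≠ 0 := NeZero.ne _
  have hρ := im_nat_mul_pos (N := N) hμi
  have r1 := h.neg.shift (t := μ - ξ) 0 1 0 (by push_cast; ring)
  have r2 := h.shift (t := μ + ξ) 0 1 0 (by push_cast; ring)
  have n1 := thAdd_ne_zero hρ r2.notLattice
  have n2 := thAdd_ne_zero hρ h.notLattice
  have n3 := thAdd_ne_zero hρ h.neg.notLattice
  have n4 := thAdd_ne_zero hρ (h.shift (t := ξ + τ) 0 0 1 (by push_cast; ring)).notLattice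
  have n5 := thAdd_ne_zero hρ (r1.shift (t := μ - ξ - τ) 0 0 (-1) (by push_cast; ring)).notLattice
  have n6 := r2.th_ne_zero hτ
  rw [add_comm] at n6
  have k := kappaAdd_shift hτ hρ h.notLattice r2.notLattice r1.notLattice
  have t1 : thAdd (N * μ) (μ - (ξ + (τ + 1))) = thAdd (N * μ) (μ - ξ - τ) := by
    rw [← thAdd_add_one]; congr 1; ring
  -- The exponent is split into the multiplier of the weights, centred at `ξ + μ/N`, and the
  -- difference `μ (2/N - 2)`, which is the exponential prefactor of `τ̃_N`.
  have t2 := th_add_lattice τ (ξ + μ) 1 1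
  rw [show ξ + μ + (((1 : ℤ) : ℂ) + ((1 : ℤ) : ℂ) * τ) = ξ + (τ + 1) + μ by push_cast; ring,
    show ((1 : ℤ) : ℂ) + ((1 : ℤ) : ℂ) - ((1 : ℤ) : ℂ) ^ 2 * τ - 2 * ((1 : ℤ) : ℂ) * (ξ + μ)
      = (-τ - 2 * (ξ + μ / N)) + μ * (2 / N - 2) + 2 * ((1 : ℤ) : ℂ) by push_cast; field_simp; ring,
    ex_add _ (2 * _), ex_two_int, mul_one, ex_add] at t2
  rw [tauTilde_eq, rScal, rScal, t1, t2, ← add_assoc ξ τ 1, thAdd_add_one, kappaAdd_add_one, k]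
  have x1 := ex_ne_zero (μ * (2 / N - 2))
  have x2 := ex_ne_zero (-τ - 2 * (ξ + μ / N))
  generalize ex (μ * (2 / N - 2)) = E1 at *
  generalize ex (-τ - 2 * (ξ + μ / N)) = E2 at *
  generalize ex (μ / 2 * (2 / N - 2)) = E3 at *
  field_simp

lemma rScal_add_mu (hμi : 0 < μ.im) (hτ : 0 < τ.im) {ξ : ℂ} (h : Regular μ τ ξ) :
    rScal N μ τ (ξ + N * μ) * (th τ (ξ + N * μ - μ) * th τ (ξ + N * μ + μ))
      = rScal N μ τ ξ * (th τ ξ * th τ (ξ + N * μ)) := by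
  have hρ := im_nat_mul_pos (N := N) hμi
  have r1 := h.neg.shift (t := μ - ξ) 0 1 0 (by push_cast; ring)
  have r2 := h.shift (t := μ + ξ) 0 1 0 (by push_cast; ring)
  have n2 := thAdd_ne_zero hρ h.notLattice
  have n6 := r2.th_ne_zero hτ
  have n7 := (h.shift (t := ξ + N * μ - μ) 0 (N - 1) 0 (by push_cast; ring)).th_ne_zero hτ
  have n8 := (h.shift (t := ξ + N * μ + μ) 0 (N + 1) 0 (by push_cast; ring)).th_ne_zero hτ
  have k := kappaAdd_shift hρ hτ (h.notLattice (N := N)).symm r2.notLattice.symm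
    r1.notLattice.symm
  rw [kappaAdd_comm, kappaAdd_comm (N * μ)] at k
  -- The shift of `κ` by `Nμ` gives product thetas of modulus `τ`, while the weights give series.
  -- The constant `C` relating them need not be known: it occurs twice above and twice below.
  obtain ⟨C, hC, hth⟩ := exists_th_eq_thetaProd hτ
  have tp : ∀ s, thAdd τ s = C⁻¹ * ex s * th τ s := fun s => by
    rw [hth, thetaProd, thAdd]
    have : ex s * ex (-s) = 1 := by rw [← ex_add, add_neg_cancel, ex_zero]
    field_simp
    linear_combination -(Theta (ex (2 * τ)) (ex (2 * s))) * this
  have o1 : th τ (-ξ) = -th τ ξ := th_neg τ ξ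
  have o2 : th τ (μ - ξ - N * μ) = -th τ (ξ + N * μ - μ) := by rw [← th_neg]; congr 1; ring
  rw [tp, tp, tp, tp, o1, o2] at k
  have a1 := thAdd_add hρ (μ - (ξ + N * μ))
  rw [show μ - (ξ + N * μ) + N * μ = μ - ξ by ring] at a1
  have a2 := thAdd_add hρ ξ
  rw [rScal, rScal, k, a1, a2, add_comm ξ μ]
  have x1 : ex (ξ + N * μ) * ex (-ξ) = ex (μ + ξ) * ex (μ - ξ - N * μ)
      * (ex (-(2 * (μ - (ξ + N * μ)))) * ex (-(2 * ξ))) := by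
    rw [← ex_add, ← ex_add, ← ex_add, ← ex_add]; congr 1; ring
  have y1 := ex_ne_zero (μ + ξ)
  have y2 := ex_ne_zero (μ - ξ - N * μ)
  have y3 := ex_ne_zero (-(2 * ξ))
  have y4 := ex_ne_zero (-(2 * (μ - (ξ + N * μ))))
  generalize ex (ξ + N * μ) = E1 at *
  generalize ex (-ξ) = E2 at *
  generalize ex (μ + ξ) = E3 at *
  generalize ex (μ - ξ - N * μ) = E4 at *
  generalize ex (-(2 * (μ - (ξ + N * μ)))) = E5 at *
  generalize ex (-(2 * ξ)) = E6 at *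
  generalize ex (μ / 2 * (2 / N - 2)) = E7 at *
  field_simp
  linear_combination -(E7 * thAdd (N * μ) (μ - (ξ + N * μ)) * kappaAdd τ (N * μ) μ ξ * th τ ξ
    * th τ (ξ + N * μ) * th τ μ) * x1

end

section
variable {N : ℕ} [NeZero N] {μ τ : ℂ}

/-! ### Properties of the matrix `R` -/

/-- The inverse of `R`. -/
def rInv (N : ℕ) [NeZero N] (μ τ ξ : ℂ) : Matrix (Fin N × Fin N) (Fin N × Fin N) ℂ :=
  (rScal N μ τ ξ * unitCoeff N μ τ 0 ξ)⁻¹ • vMat N (-μ) τ ξ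

lemma unitCoeff_zero_ne_zero (hN2 : 2 ≤ N) (hτ : 0 < τ.im) (hμ : ∀ a b : ℤ, μ ≠ a + b * τ) {ξ : ℂ}
    (h : Regular μ τ ξ) : unitCoeff N μ τ 0 ξ ≠ 0 := fun h0 => by
  have := unitCoeff_zero_mul hN2 hτ hμ ξ
  rw [h0, zero_mul, eq_comm, neg_eq_zero, mul_eq_zero] at this
  rcases this with h1 | h1
  · exact (h.shift (t := ξ - μ) 0 (-1) 0 (by push_cast; ring)).th_ne_zero hτ h1
  · exact (h.shift (t := ξ + μ) 0 1 0 (by push_cast; ring)).th_ne_zero hτ h1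

lemma rMat_mul_rInv (hN2 : 2 ≤ N) (hμi : 0 < μ.im) (hτ : 0 < τ.im)
    (hμ : ∀ a b : ℤ, μ ≠ a + b * τ) {ξ : ℂ} (h : Regular μ τ ξ) :
    rMat N μ τ ξ * rInv N μ τ ξ = 1 := by
  have n1 := rScal_ne_zero (N := N) hμi hτ hμ h
  have n2 := unitCoeff_zero_ne_zero hN2 hτ hμ h
  rw [rMat_eq, rInv, Matrix.smul_mul, Matrix.mul_smul, vMat_mul hτ hμ, smul_smul, smul_smul]
  rw [mul_comm (_ * _) (unitCoeff N μ τ 0 ξ), ← mul_assoc, mul_comm (unitCoeff N μ τ 0 ξ),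
    mul_inv_cancel₀ (mul_ne_zero n1 n2), one_smul]

lemma rInv_mul_rMat (hN2 : 2 ≤ N) (hμi : 0 < μ.im) (hτ : 0 < τ.im)
    (hμ : ∀ a b : ℤ, μ ≠ a + b * τ) {ξ : ℂ} (h : Regular μ τ ξ) :
    rInv N μ τ ξ * rMat N μ τ ξ = 1 :=
  mul_eq_one_comm.1 (rMat_mul_rInv hN2 hμi hτ hμ h)

lemma rMat_mul_aOne (hμi : 0 < μ.im) (hτ : 0 < τ.im) {ξ : ℂ} (h : Regular μ τ ξ) :
    rMat N μ τ ξ * aOne N = tauTilde N μ ξ • (aOne N * rMat N μ τ (ξ + (τ + 1))) := by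
  rw [rMat_eq, rMat_eq, Matrix.mul_smul, aOne_mul_vMat_add, smul_smul, smul_smul, Matrix.smul_mul,
    ← rScal_add_tau hμi hτ h, mul_assoc]

/-- When `N` divides `k` all characters are trivial; the common factor `ex k` of the weights is
cancelled by `th(ξ + μ)` in the denominator of the prefactor. -/
lemma rMat_add_int (μ τ ξ : ℂ) {k : ℤ} (hk : (N : ℤ) ∣ k) :
    rMat N μ τ (ξ + k) = rMat N μ τ ξ := by
  have t := th_add_lattice τ (ξ + μ) k 0
  simp only [Int.cast_zero, zero_mul, add_zero, ne_eq, OfNat.ofNat_ne_zero, not_false_eq_true,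
    zero_pow, mul_zero, sub_zero] at t
  have t1 : thAdd (N * μ) (μ - (ξ + k)) = thAdd (N * μ) (μ - ξ) := by
    rw [← thAdd_add_int _ _ k]; congr 1; ring
  rw [rMat_eq, rMat_eq, vMat_add_int μ τ ξ hk, smul_smul, rScal, rScal, thAdd_add_int,
    kappaAdd_add_int, t1, show ξ + k + μ = ξ + μ + k by ring, t]
  congr 1
  have := ex_ne_zero (k : ℂ)
  field_simp

lemma rInv_eq_of_rMat_eq {μ' τ' ξ ξ' : ℂ} (h : rMat N μ τ ξ = rMat N μ' τ' ξ')
    (h1 : rInv N μ τ ξ * rMat N μ τ ξ = 1) (h2 : rMat N μ' τ' ξ' * rInv N μ' τ' ξ' = 1) :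
    rInv N μ τ ξ = rInv N μ' τ' ξ' := by
  rw [h] at h1
  exact left_inv_eq_right_inv h1 h2

lemma crossed_rInv_rMat (hN2 : 2 ≤ N) (hμi : 0 < μ.im) (hτ : 0 < τ.im)
    (hμ : ∀ a b : ℤ, μ ≠ a + b * τ) {ξ : ℂ} (h : Regular μ τ ξ) :
    Crossed (rInv N μ τ (ξ + N * μ)) (rMat N μ τ ξ)
      ∧ Crossed (rMat N μ τ ξ) (rInv N μ τ (ξ + N * μ)) := by
  have h' : Regular μ τ (ξ + N * μ) := h.shift 0 N 0 (by push_cast; ring)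
  have n1 := rScal_ne_zero (N := N) hμi hτ hμ h
  have n1' := rScal_ne_zero (N := N) hμi hτ hμ h'
  have n2 := unitCoeff_zero_ne_zero hN2 hτ hμ h'
  have n3 := th_mu_ne_zero hτ hμ
  -- The scalars from the shift of `R`, from unitarity and from the crossing of the weights
  -- compensate exactly, so crossing holds with no extra factor.
  have hs : rScal N μ τ ξ * (rScal N μ τ (ξ + N * μ) * unitCoeff N μ τ 0 (ξ + N * μ))⁻¹
      * (-(th τ (ξ + N * μ) * th τ ξ) / th τ μ ^ 2) = 1 := by
    have e1 := rScal_add_mu (N := N) hμi hτ h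
    have e2 := unitCoeff_zero_mul hN2 hτ hμ (ξ + N * μ)
    field_simp
    linear_combination e1 - rScal N μ τ (ξ + N * μ) * e2
  have hc := fun γ => crossCoeff_eq (N := N) hτ hμ h γ
  set v := -(th τ (ξ + N * μ) * th τ ξ) / th τ μ ^ 2 with hv
  set r' := (rScal N μ τ (ξ + N * μ) * unitCoeff N μ τ 0 (ξ + N * μ))⁻¹ with hr'
  constructor
  · intro j k m l
    have := sum_smul_eMat_crossed (fun α => weight N (-μ) τ α (ξ + N * μ))
      (fun α => weight N μ τ α ξ) v hc j k m l
    rw [rMat_eq, rInv, ← hr']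
    simp only [Matrix.smul_apply, smul_eq_mul]
    rw [← vMat, ← vMat] at this
    calc _ = rScal N μ τ ξ * r' * ∑ i, ∑ r, vMat N (-μ) τ (ξ + N * μ) (i, j) (k, r)
          * vMat N μ τ ξ (m, r) (i, l) := by
          simp only [Finset.mul_sum]
          refine Finset.sum_congr rfl fun i _ => Finset.sum_congr rfl fun r _ => ?_
          ring
      _ = _ := by rw [this, ← mul_assoc, hs, one_mul]
  · intro j k m l
    have := sum_smul_eMat_crossed (fun α => weight N μ τ α ξ)
      (fun α => weight N (-μ) τ α (ξ + N * μ)) v (fun γ => by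
        rw [← hc γ, crossCoeff, ← Equiv.sum_comp (Equiv.subLeft γ)]
        refine Finset.sum_congr rfl fun α _ => ?_
        simp only [Equiv.subLeft_apply, sub_sub_cancel]
        ring) j k m l
    rw [rMat_eq, rInv, ← hr']
    simp only [Matrix.smul_apply, smul_eq_mul]
    rw [← vMat, ← vMat] at this
    calc _ = rScal N μ τ ξ * r' * ∑ i, ∑ r, vMat N μ τ ξ (i, j) (k, r)
          * vMat N (-μ) τ (ξ + N * μ) (m, r) (i, l) := by
          simp only [Finset.mul_sum]
          refine Finset.sum_congr rfl fun i _ => Finset.sum_congr rfl fun r _ => ?_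
          ring
      _ = _ := by rw [this, ← mul_assoc, hs, one_mul]

/-! ### The functions `F` -/

lemma fNat_eq_prod_range (N : ℕ) (μ τ : ℂ) (n : ℕ) (ξ : ℂ) :
    fNat N μ τ n ξ = ∏ s ∈ Finset.range n, tauTilde N μ (ξ - ((s + 1 : ℕ) : ℂ) * (τ + 1)) := by
  rw [fNat, Finset.range_eq_Ico,
    Finset.prod_Ico_add' (fun s : ℕ => tauTilde N μ (ξ - (s : ℂ) * (τ + 1))) 0 n 1]
  rfl

lemma fInt_zero (N : ℕ) (μ τ ξ : ℂ) : fInt N μ τ 0 ξ = 1 := by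
  show fNat N μ τ 0 ξ = 1
  simp [fNat]

lemma fInt_neg_nat (N : ℕ) (μ τ ξ : ℂ) (n : ℕ) :
    fInt N μ τ (-n) ξ = (fNat N μ τ n (ξ + n * (τ + 1)))⁻¹ := by
  cases n with
  | zero => simp [fInt_zero, fNat]
  | succ n => rfl

lemma Regular.gammaShift {ξ : ℂ} (h : Regular μ τ ξ) (ℓ : ℤ) : Regular μ τ (ξ + gammaShift τ ℓ) :=
  h.shift (-ℓ) 0 (-ℓ) (by rw [EllipticGLN.gammaShift]; push_cast; ring)

/-- A single recursion valid for every integer replaces the two cases of the definition. -/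
lemma fInt_add_one (hμi : 0 < μ.im) {ξ : ℂ} (h : Regular μ τ ξ) (ℓ : ℤ) :
    fInt N μ τ (ℓ + 1) ξ = tauTilde N μ (ξ + gammaShift τ (ℓ + 1)) * fInt N μ τ ℓ ξ := by
  obtain ⟨n, rfl | rfl⟩ : ∃ n : ℕ, ℓ = n ∨ ℓ = -(n + 1 : ℕ) := by
    rcases ℓ with n | n
    · exact ⟨n, Or.inl rfl⟩
    · exact ⟨n, Or.inr rfl⟩
  · show fNat N μ τ (n + 1) ξ = _ * fNat N μ τ n ξ
    rw [fNat_eq_prod_range, fNat_eq_prod_range, Finset.prod_range_succ, mul_comm]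
    congr 2
    rw [gammaShift]; push_cast; ring
  -- For `ℓ = -(n + 1)`, the factor `s = 1` of the inverted product sits at `ξ + n(τ + 1)` and
  -- cancels `τ̃_N`; the other factors are those of `F(-n, z)`, reindexed.
  · have ne := tauTilde_ne_zero (N := N) hμi (h.gammaShift (-(n : ℤ)))
    rw [show (-((n + 1 : ℕ) : ℤ) + 1) = -(n : ℤ) by push_cast; ring, fInt_neg_nat, fInt_neg_nat,
      fNat_eq_prod_range, fNat_eq_prod_range, Finset.prod_range_succ', mul_inv]
    have e : tauTilde N μ (ξ + ((n + 1 : ℕ) : ℂ) * (τ + 1) - ((0 + 1 : ℕ) : ℂ) * (τ + 1))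
        = tauTilde N μ (ξ + gammaShift τ (-(n : ℤ))) := by
      congr 1; rw [gammaShift]; push_cast; ring
    rw [e, mul_left_comm, mul_inv_cancel₀ ne, mul_one]
    congr 1
    refine Finset.prod_congr rfl fun s _ => ?_
    congr 1; push_cast; ring

lemma fInt_ne_zero (hμi : 0 < μ.im) {ξ : ℂ} (h : Regular μ τ ξ) (ℓ : ℤ) :
    fInt N μ τ ℓ ξ ≠ 0 := by
  induction ℓ using Int.induction_on with
  | zero => rw [fInt_zero]; exact one_ne_zero
  | succ n ih =>
    rw [fInt_add_one hμi h]
    exact mul_ne_zero (tauTilde_ne_zero hμi (h.gammaShift _)) ih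
  | pred n ih =>
    have := fInt_add_one (N := N) hμi h (-n - 1)
    rw [sub_add_cancel] at this
    rw [this] at ih
    exact right_ne_zero_of_mul ih

/-- The theta multipliers of numerator and denominator have the same product. This periodicity makes
the extra shift by `q^N` in `S` invisible in the exchange function. -/
lemma tauTilde_add_mu (hμi : 0 < μ.im) (ξ : ℂ) :
    tauTilde N μ (ξ + N * μ) = tauTilde N μ ξ := by
  have hρ := im_nat_mul_pos (N := N) hμi
  have a1 := thAdd_add hρ (μ - (ξ + N * μ))
  rw [show μ - (ξ + N * μ) + N * μ = μ - ξ by ring] at a1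
  have a2 := thAdd_add hρ ξ
  have a3 := thAdd_add hρ (μ + ξ)
  rw [add_assoc] at a3
  have a4 := thAdd_add hρ (-(ξ + N * μ))
  rw [show -(ξ + N * μ) + N * μ = -ξ by ring] at a4
  have x1 : ex (-(2 * (μ - (ξ + N * μ)))) * ex (-(2 * ξ))
      = ex (-(2 * (μ + ξ))) * ex (-(2 * -(ξ + N * μ))) := by
    rw [← ex_add, ← ex_add]; congr 1; ring
  rw [tauTilde_eq, tauTilde_eq, a1, a2, a3, a4]
  have y1 := ex_ne_zero (-(2 * (μ - (ξ + N * μ))))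
  have y2 := ex_ne_zero (-(2 * ξ))
  have y3 := ex_ne_zero (-(2 * (μ + ξ)))
  have y4 := ex_ne_zero (-(2 * -(ξ + N * μ)))
  congr 1
  generalize ex (-(2 * (μ - (ξ + N * μ)))) = e₁ at *
  generalize ex (-(2 * ξ)) = e₂ at *
  generalize ex (-(2 * (μ + ξ))) = e₃ at *
  generalize ex (-(2 * -(ξ + N * μ))) = e₄ at *
  rw [← eq_div_iff y2] at x1
  rw [x1]
  field_simp

lemma fInt_sub_mu (hμi : 0 < μ.im) (τ : ℂ) (ℓ : ℤ) (ξ : ℂ) :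
    fInt N μ τ ℓ (ξ - N * μ) = fInt N μ τ ℓ ξ := by
  have hn : ∀ n ξ, fNat N μ τ n (ξ - N * μ) = fNat N μ τ n ξ := fun n ξ => by
    unfold fNat
    refine Finset.prod_congr rfl fun s _ => ?_
    rw [← tauTilde_add_mu hμi]; congr 1; ring
  rcases ℓ with n | n
  · exact hn n ξ
  · simp only [fInt]
    rw [← hn _ (ξ + _)]
    congr 2; ring

/-! ### Iterated quasi-periodicity -/

/-- `a^ℓ ⊗ 1`. -/
def aPow (N : ℕ) [NeZero N] (ℓ : ℤ) : Matrix (Fin N × Fin N) (Fin N × Fin N) ℂ :=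
  (aMat N ^ ℓ) ⊗ₖ (1 : Matrix (Fin N) (Fin N) ℂ)

lemma aPow_zero : aPow N 0 = 1 := by rw [aPow, zpow_zero, Matrix.one_kronecker_one]

lemma aPow_add (ℓ m : ℤ) : aPow N (ℓ + m) = aPow N ℓ * aPow N m := by
  rw [aPow, aPow, aPow, ← Matrix.mul_kronecker_mul, one_mul,
    Matrix.zpow_add ((Matrix.isUnit_iff_isUnit_det _).1 isUnit_aMat)]

lemma aPow_one : aPow N 1 = aOne N := by rw [aPow, aOne, zpow_one]

lemma aPow_neg_mul (ℓ : ℤ) : aPow N (-ℓ) * aPow N ℓ = 1 := by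
  rw [← aPow_add, neg_add_cancel, aPow_zero]

lemma aPow_mul_neg (ℓ : ℤ) : aPow N ℓ * aPow N (-ℓ) = 1 := by
  rw [← aPow_add, add_neg_cancel, aPow_zero]

lemma rMat_mul_aPow (hμi : 0 < μ.im) (hτ : 0 < τ.im) {ξ : ℂ} (h : Regular μ τ ξ) (ℓ : ℤ) :
    rMat N μ τ (ξ + gammaShift τ ℓ) * aPow N ℓ = fInt N μ τ ℓ ξ • (aPow N ℓ * rMat N μ τ ξ) := by
  have step : ∀ ℓ : ℤ, rMat N μ τ (ξ + gammaShift τ (ℓ + 1)) * aPow N (ℓ + 1)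
      = tauTilde N μ (ξ + gammaShift τ (ℓ + 1))
        • (aOne N * (rMat N μ τ (ξ + gammaShift τ ℓ) * aPow N ℓ)) := fun ℓ => by
    rw [add_comm ℓ 1, aPow_add, aPow_one, ← mul_assoc, add_comm 1 ℓ,
      rMat_mul_aOne hμi hτ (h.gammaShift _), Matrix.smul_mul, mul_assoc,
      show ξ + gammaShift τ (ℓ + 1) + (τ + 1) = ξ + gammaShift τ ℓ by
        simp only [gammaShift]; push_cast; ring]
  -- One step is stated as an equivalence, using that `a ⊗ 1` is invertible and `τ̃_N` nonzero, so
  -- that the induction also runs to negative `ℓ`.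
  have up : ∀ ℓ : ℤ, rMat N μ τ (ξ + gammaShift τ ℓ) * aPow N ℓ
      = fInt N μ τ ℓ ξ • (aPow N ℓ * rMat N μ τ ξ) ↔
      rMat N μ τ (ξ + gammaShift τ (ℓ + 1)) * aPow N (ℓ + 1)
      = fInt N μ τ (ℓ + 1) ξ • (aPow N (ℓ + 1) * rMat N μ τ ξ) := fun ℓ => by
    have ne := tauTilde_ne_zero (N := N) hμi (h.gammaShift (ℓ + 1))
    have e : fInt N μ τ (ℓ + 1) ξ • (aPow N (ℓ + 1) * rMat N μ τ ξ)
        = tauTilde N μ (ξ + gammaShift τ (ℓ + 1))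
          • (aOne N * (fInt N μ τ ℓ ξ • (aPow N ℓ * rMat N μ τ ξ))) := by
      rw [fInt_add_one hμi h, Matrix.mul_smul, smul_smul, add_comm ℓ 1, aPow_add, aPow_one,
        mul_assoc]
    rw [step, e]
    constructor
    · intro h; rw [h]
    · intro h
      have h1 := smul_right_injective _ ne h
      have h2 := congrArg (aPow N (-1) * ·) h1
      simp only [← mul_assoc (aPow N (-1)), ← aPow_one, aPow_neg_mul, one_mul] at h2
      exact h2
  induction ℓ using Int.induction_on with
  | zero => simp [gammaShift, aPow_zero, fInt_zero]
  | succ n ih => exact (up _).1 ih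
  | pred n ih =>
    refine (up _).2 ?_
    rw [sub_add_cancel]
    exact ih

lemma aPow_mul_rMat (hμi : 0 < μ.im) (hτ : 0 < τ.im) {ξ : ℂ} (h : Regular μ τ ξ) (ℓ : ℤ) :
    aPow N ℓ * rMat N μ τ ξ
      = (fInt N μ τ ℓ ξ)⁻¹ • (rMat N μ τ (ξ + gammaShift τ ℓ) * aPow N ℓ) := by
  rw [rMat_mul_aPow hμi hτ h, smul_smul, inv_mul_cancel₀ (fInt_ne_zero hμi h ℓ), one_smul]

lemma rMat_mul_aPow_neg (hμi : 0 < μ.im) (hτ : 0 < τ.im) {ξ : ℂ} (h : Regular μ τ ξ) (ℓ : ℤ) :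
    rMat N μ τ ξ * aPow N (-ℓ)
      = (fInt N μ τ ℓ ξ)⁻¹ • (aPow N (-ℓ) * rMat N μ τ (ξ + gammaShift τ ℓ)) := by
  have := congrArg (fun X => aPow N (-ℓ) * X * aPow N (-ℓ)) (aPow_mul_rMat (N := N) hμi hτ h ℓ)
  simp only [Matrix.mul_smul, Matrix.smul_mul] at this
  rw [← mul_assoc (aPow N (-ℓ)) (aPow N ℓ), aPow_neg_mul, one_mul] at this
  rw [this, mul_assoc, mul_assoc (rMat N μ τ (ξ + gammaShift τ ℓ)), aPow_mul_neg, mul_one]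

lemma aPow_mul_rInv (hN2 : 2 ≤ N) (hμi : 0 < μ.im) (hτ : 0 < τ.im)
    (hμ : ∀ a b : ℤ, μ ≠ a + b * τ) {ξ : ℂ} (h : Regular μ τ ξ) (ℓ : ℤ) :
    aPow N ℓ * rInv N μ τ ξ = fInt N μ τ ℓ ξ • (rInv N μ τ (ξ + gammaShift τ ℓ) * aPow N ℓ) := by
  have := congrArg (fun X => rInv N μ τ (ξ + gammaShift τ ℓ) * X * rInv N μ τ ξ)
    (rMat_mul_aPow (N := N) hμi hτ h ℓ)
  simp only [Matrix.mul_smul, Matrix.smul_mul] at this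
  rw [← mul_assoc (rInv N μ τ (ξ + gammaShift τ ℓ)) (rMat N μ τ _),
    rInv_mul_rMat hN2 hμi hτ hμ (h.gammaShift ℓ), one_mul] at this
  rw [this, mul_assoc, mul_assoc (aPow N ℓ), rMat_mul_rInv hN2 hμi hτ hμ h, mul_one]

lemma rInv_mul_aPow_neg (hN2 : 2 ≤ N) (hμi : 0 < μ.im) (hτ : 0 < τ.im)
    (hμ : ∀ a b : ℤ, μ ≠ a + b * τ) {ξ : ℂ} (h : Regular μ τ ξ) (ℓ : ℤ) :
    rInv N μ τ ξ * aPow N (-ℓ)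
      = fInt N μ τ ℓ ξ • (aPow N (-ℓ) * rInv N μ τ (ξ + gammaShift τ ℓ)) := by
  have := congrArg (fun X => aPow N (-ℓ) * X * aPow N (-ℓ))
    (aPow_mul_rInv hN2 hμi hτ hμ h ℓ)
  simp only [Matrix.mul_smul, Matrix.smul_mul] at this
  rw [← mul_assoc (aPow N (-ℓ)) (aPow N ℓ), aPow_neg_mul, one_mul] at this
  rw [this, mul_assoc, mul_assoc (rInv N μ τ (ξ + gammaShift τ ℓ)), aPow_mul_neg, mul_one]

end

/-! ### Matrices over a noncommutative algebra -/

section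
variable {n : Type} [Fintype n] [DecidableEq n] {A : Type} [Ring A] [Algebra ℂ A]

omit [DecidableEq n] in
lemma scal_mul (M M' : Matrix n n ℂ) : scal A (M * M') = scal A M * scal A M' :=
  Matrix.map_mul

omit [Fintype n] in
lemma scal_one : scal A (1 : Matrix n n ℂ) = 1 :=
  Matrix.map_one _ (map_zero _) (map_one _)

omit [Fintype n] [DecidableEq n] in
lemma scal_smul (c : ℂ) (M : Matrix n n ℂ) : scal A (c • M) = c • scal A M := by
  ext i j
  simp [scal, Algebra.smul_def]

/-- `X ⊗ 1`. -/
def lef (X : Matrix n n A) : Matrix (n × n) (n × n) A := X ⊗ₖ (1 : Matrix n n A)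

/-- `1 ⊗ Y`. -/
def rig (Y : Matrix n n A) : Matrix (n × n) (n × n) A := (1 : Matrix n n A) ⊗ₖ Y

omit [Algebra ℂ A] in
lemma lef_mul (X Y : Matrix n n A) : lef (X * Y) = lef X * lef Y := by
  ext ⟨i, j⟩ ⟨k, l⟩
  simp only [lef, Matrix.kroneckerMap_apply, Matrix.mul_apply, Fintype.sum_prod_type,
    Matrix.one_apply]
  simp

omit [Fintype n] [Algebra ℂ A] in
lemma lef_one : lef (1 : Matrix n n A) = 1 := Matrix.one_kronecker_one

omit [Fintype n] in
lemma lef_scal (M : Matrix n n ℂ) :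
    lef (scal A M) = scal A (M ⊗ₖ (1 : Matrix n n ℂ)) := by
  ext ⟨i, j⟩ ⟨k, l⟩
  simp only [lef, scal, Matrix.kroneckerMap_apply, Matrix.map_apply, Matrix.one_apply, map_mul]
  split_ifs <;> simp

/-- Over a noncommutative algebra `X ⊗ 1` and `1 ⊗ Y` need not commute; they do here because the
entries of the first are central. -/
lemma lef_scal_mul_rig (M : Matrix n n ℂ) (Y : Matrix n n A) :
    lef (scal A M) * rig Y = rig Y * lef (scal A M) := by
  ext ⟨i, j⟩ ⟨k, l⟩
  simp only [lef, rig, scal, Matrix.kroneckerMap_apply, Matrix.map_apply, Matrix.mul_apply,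
    Fintype.sum_prod_type, Matrix.one_apply]
  simp [Algebra.commutes]

/-- The trace over the first tensor factor. -/
def ptr (M : Matrix (n × n) (n × n) A) : Matrix n n A := Matrix.of fun j l => ∑ i, M (i, j) (i, l)

omit [DecidableEq n] in
lemma ptr_smul (c : ℂ) (M : Matrix (n × n) (n × n) A) : ptr (c • M) = c • ptr M := by
  ext j l
  simp [ptr, Finset.smul_sum]

omit [Algebra ℂ A] in
lemma ptr_rig_mul (Y : Matrix n n A) (M : Matrix (n × n) (n × n) A) :
    ptr (rig Y * M) = Y * ptr M := by
  ext j l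
  simp only [ptr, rig, Matrix.of_apply, Matrix.mul_apply, Fintype.sum_prod_type,
    Matrix.kroneckerMap_apply, Matrix.one_apply]
  simp only [ite_mul, one_mul, zero_mul, Finset.sum_ite_irrel, Finset.sum_const_zero,
    Finset.sum_ite_eq, Finset.mem_univ, if_true, Finset.mul_sum]
  rw [Finset.sum_comm]

omit [Algebra ℂ A] in
lemma ptr_mul_rig (M : Matrix (n × n) (n × n) A) (Y : Matrix n n A) :
    ptr (M * rig Y) = ptr M * Y := by
  ext j l
  simp only [ptr, rig, Matrix.of_apply, Matrix.mul_apply, Fintype.sum_prod_type,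
    Matrix.kroneckerMap_apply, Matrix.one_apply]
  simp only [ite_mul, one_mul, zero_mul, mul_ite, mul_zero, Finset.sum_ite_irrel,
    Finset.sum_const_zero, Finset.sum_ite_eq', Finset.mem_univ, if_true, Finset.sum_mul]
  rw [Finset.sum_comm]

/-- The scalar matrix with entry `x`. -/
abbrev dg (n : Type) [DecidableEq n] {A : Type} [Ring A] (x : A) : Matrix n n A :=
  Matrix.diagonal fun _ => x

omit [Algebra ℂ A] in
lemma ptr_lef (X : Matrix n n A) : ptr (lef X) = dg n X.trace := by
  ext j l
  simp only [ptr, lef, Matrix.of_apply, Matrix.kroneckerMap_apply, Matrix.one_apply,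
    Matrix.diagonal_apply, Matrix.trace, Matrix.diag_apply]
  split_ifs <;> simp

/-- Scalars slide past the entries of `X`, and the coefficient of `X k m` in the entry `(j, l)` is
exactly the sum in the definition of `Crossed`; it selects `k = m` and `j = l`. -/
lemma ptr_crossed {P Q : Matrix (n × n) (n × n) ℂ} (h : Crossed P Q) (X : Matrix n n A) :
    ptr (scal A P * lef X * scal A Q) = dg n X.trace := by
  ext j l
  have e : ∀ i, (scal A P * lef X * scal A Q) (i, j) (i, l)
      = ∑ m, ∑ k, ∑ r, algebraMap ℂ A (P (i, j) (k, r) * Q (m, r) (i, l)) * X k m := by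
    intro i
    simp only [Matrix.mul_apply, Fintype.sum_prod_type, lef, scal, Matrix.map_apply,
      Matrix.kroneckerMap_apply, Matrix.one_apply, mul_ite, mul_one, mul_zero,
      Finset.sum_ite_eq', Finset.mem_univ, if_true, Finset.sum_mul]
    refine Finset.sum_congr rfl fun m _ => ?_
    rw [Finset.sum_comm]
    refine Finset.sum_congr rfl fun k _ => Finset.sum_congr rfl fun r _ => ?_
    rw [map_mul, mul_assoc, mul_assoc, Algebra.commutes (Q (m, r) (i, l))]
  simp only [ptr, Matrix.of_apply, e]
  rw [Finset.sum_comm]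
  have e2 : ∀ m, ∑ i, ∑ k, ∑ r, algebraMap ℂ A (P (i, j) (k, r) * Q (m, r) (i, l)) * X k m
      = ∑ k, algebraMap ℂ A (∑ i, ∑ r, P (i, j) (k, r) * Q (m, r) (i, l)) * X k m := by
    intro m
    rw [Finset.sum_comm]
    refine Finset.sum_congr rfl fun k _ => ?_
    simp only [map_sum, Finset.sum_mul]
  simp only [e2, h j _ _ l, Matrix.one_apply, Matrix.diagonal_apply, Matrix.trace,
    Matrix.diag_apply]
  split_ifs <;> simp

lemma dg_mul_scal (x : A) (M : Matrix n n ℂ) : dg n x * scal A M = scal A M * dg n x := by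
  ext i j
  rw [Matrix.diagonal_mul, Matrix.mul_diagonal]
  exact (Algebra.commutes _ _).symm

omit [Algebra ℂ A] in
lemma trace_dg_mul (x : A) (M : Matrix n n A) : (dg n x * M).trace = x * M.trace := by
  simp only [Matrix.trace, Matrix.diag_apply, Matrix.diagonal_mul, Finset.mul_sum]

omit [Algebra ℂ A] in
lemma trace_mul_dg (x : A) (M : Matrix n n A) : (M * dg n x).trace = M.trace * x := by
  simp only [Matrix.trace, Matrix.diag_apply, Matrix.mul_diagonal, Finset.sum_mul]

end

/-! ### Exchange relations in an abstract algebra -/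

section
variable {S : Type*} [Ring S] [Algebra ℂ S]

omit [Algebra ℂ S] in
lemma exchange_inv {r ri l li k rs rsi : S} (h : r * l * k = k * l * rs) (h1 : ri * r = 1)
    (h2 : rs * rsi = 1) (h3 : li * l = 1) (h4 : l * li = 1) : li * ri * k = k * rsi * li := by
  have e1 : l * k = ri * k * l * rs := by
    calc l * k = ri * r * l * k := by rw [h1, one_mul]
      _ = ri * (r * l * k) := by simp only [mul_assoc]
      _ = _ := by rw [h]; simp only [mul_assoc]
  calc li * ri * k = li * (ri * k * l * rs) * rsi * li := by
        simp only [mul_assoc]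
        rw [← mul_assoc rs, h2, one_mul, h4, mul_one]
    _ = k * rsi * li := by rw [← e1, ← mul_assoc li, h3, one_mul]

/-- The roles are `l = L₁(z₁)`, `k = L₂(z₂)`, `li' = L₁(γz₁)⁻¹`, `r = R`, `rs = R*`. Inserting `ri *
r` before `l` makes the relation applicable; then `ri` passes left through `a` and `rs` right
through `b`, and the relation for the inverse brings `k` to the front. -/
lemma exchange_trace_first {r ri l li' ri' k rs rsi' rs'' a b : S} {F G : ℂ}
    (h : r * l * k = k * l * rs) (h1 : ri * r = 1)
    (h' : li' * ri' * k = k * rsi' * li') (ha : a * ri = F • (ri' * a))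
    (hb : rs * b = G • (b * rs'')) (hak : a * k = k * a) (hbk : b * k = k * b) :
    li' * a * l * b * k = (F * G) • (k * (rsi' * (li' * a * l * b) * rs'')) := by
  calc li' * a * l * b * k = li' * a * (l * k) * b := by simp only [mul_assoc, hbk]
    _ = li' * a * (ri * r * (l * k)) * b := by rw [h1, one_mul]
    _ = li' * (a * ri) * (r * l * k) * b := by simp only [mul_assoc]
    _ = F • (li' * ri' * (a * k) * l * (rs * b)) := by
        rw [h, ha]; simp only [mul_assoc, mul_smul_comm, smul_mul_assoc]
    _ = (F * G) • ((li' * ri' * k) * a * l * b * rs'') := by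
        rw [hb, hak]; simp only [mul_assoc, mul_smul_comm, smul_smul]
    _ = _ := by rw [h']; simp only [mul_assoc]

/-- For `S` the inverse stands last, so `k` travels from left to right and `rs * rsi` is inserted
after `l`. The matrices left around the traced product are now of type `R`, not `R*`. -/
lemma exchange_trace_second {r l lo' ro' k rs rsi rsi'' r'' a b : S} {F G : ℂ}
    (h : r * l * k = k * l * rs) (h1 : rs * rsi = 1)
    (h' : lo' * ro' * k = k * rsi'' * lo') (ha : a * r = F • (r'' * a))
    (hb : rsi * b = G • (b * rsi'')) (hak : a * k = k * a) (hbk : b * k = k * b) :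
    k * (a * l * b * lo') = (F * G) • (r'' * (a * l * b * lo') * ro' * k) := by
  calc k * (a * l * b * lo') = a * (k * l * rs) * rsi * b * lo' := by
        simp only [mul_assoc]
        rw [← mul_assoc rs, h1, one_mul, ← mul_assoc k, ← hak]
        simp only [mul_assoc]
    _ = (a * r) * l * k * (rsi * b) * lo' := by rw [← h]; simp only [mul_assoc]
    _ = (F * G) • (r'' * a * l * (k * b) * rsi'' * lo') := by
        rw [ha, hb, mul_comm F G]; simp only [mul_assoc, mul_smul_comm, smul_mul_assoc, smul_smul]
    _ = (F * G) • (r'' * a * l * b * (k * rsi'' * lo')) := by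
        rw [← hbk]; simp only [mul_assoc]
    _ = _ := by rw [← h']; simp only [mul_assoc]

end

/-! ### The elliptic algebra -/

section
variable {N : ℕ} [NeZero N] {μ τ c : ℂ}

lemma map_scal {n : Type} (f : Free N →ₐ[ℂ] EllAlg N μ τ c) (M : Matrix n n ℂ) :
    (scal (Free N) M).map f = scal (EllAlg N μ τ c) M := by
  ext i j; simp [scal]

lemma map_lef (f : Free N →ₐ[ℂ] EllAlg N μ τ c) (X : Matrix (Fin N) (Fin N) (Free N)) :
    (X ⊗ₖ (1 : Matrix (Fin N) (Fin N) (Free N))).map f = lef (X.map f) := by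
  ext ⟨i, j⟩ ⟨k, l⟩
  simp only [Matrix.map_apply, lef, Matrix.kroneckerMap_apply, Matrix.one_apply, map_mul]
  split_ifs <;> simp

lemma map_rig (f : Free N →ₐ[ℂ] EllAlg N μ τ c) (X : Matrix (Fin N) (Fin N) (Free N)) :
    ((1 : Matrix (Fin N) (Fin N) (Free N)) ⊗ₖ X).map f = rig (X.map f) := by
  ext ⟨i, j⟩ ⟨k, l⟩
  simp only [Matrix.map_apply, rig, Matrix.kroneckerMap_apply, Matrix.one_apply, map_mul]
  split_ifs <;> simp

lemma rll (ξ₁ ξ₂ : ℂ) (h : Regular μ τ (ξ₁ - ξ₂)) (hs : Regular μ (tauStar μ τ c) (ξ₁ - ξ₂)) :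
    scal (EllAlg N μ τ c) (rMat N μ τ (ξ₁ - ξ₂)) * lef (LMat N μ τ c ξ₁) * rig (LMat N μ τ c ξ₂)
      = rig (LMat N μ τ c ξ₂) * lef (LMat N μ τ c ξ₁)
        * scal (EllAlg N μ τ c) (rMat N μ (tauStar μ τ c) (ξ₁ - ξ₂)) := by
  have key := Matrix.ext fun i j =>
    RingQuot.mkAlgHom_rel ℂ (Rel.rll (N := N) (μ := μ) (τ := τ) (c := c) ξ₁ ξ₂ h hs i j)
  set f := RingQuot.mkAlgHom ℂ (Rel N μ τ c) with hf
  have key' : (_ : Matrix _ _ _).map f = (_ : Matrix _ _ _).map f := key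
  rw [Matrix.map_mul, Matrix.map_mul, Matrix.map_mul, Matrix.map_mul, map_scal, map_scal,
    map_lef, map_rig] at key'
  exact key'

lemma LMat_mul_LInvMat (ξ : ℂ) : LMat N μ τ c ξ * LInvMat N μ τ c ξ = 1 := by
  have key := Matrix.ext fun i j =>
    RingQuot.mkAlgHom_rel ℂ (Rel.mul_inv (N := N) (μ := μ) (τ := τ) (c := c) ξ i j)
  have key' : (_ : Matrix _ _ _).map (RingQuot.mkAlgHom ℂ (Rel N μ τ c)) =
    (_ : Matrix _ _ _).map (RingQuot.mkAlgHom ℂ (Rel N μ τ c)) := key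
  rw [Matrix.map_mul, Matrix.map_one _ (map_zero _) (map_one _)] at key'
  exact key'

lemma LInvMat_mul_LMat (ξ : ℂ) : LInvMat N μ τ c ξ * LMat N μ τ c ξ = 1 := by
  have key := Matrix.ext fun i j =>
    RingQuot.mkAlgHom_rel ℂ (Rel.inv_mul (N := N) (μ := μ) (τ := τ) (c := c) ξ i j)
  have key' : (_ : Matrix _ _ _).map (RingQuot.mkAlgHom ℂ (Rel N μ τ c)) =
    (_ : Matrix _ _ _).map (RingQuot.mkAlgHom ℂ (Rel N μ τ c)) := key
  rw [Matrix.map_mul, Matrix.map_one _ (map_zero _) (map_one _)] at key'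
  exact key'

end

section
variable {N : ℕ} [NeZero N] {μ τ c : ℂ}

/-! ### Exchange relations of the trace operators with the generators -/

lemma Generic.shift {ξ t : ℂ} (h : Generic μ τ c ξ) (a b d e : ℤ)
    (ht : t = ξ + a + b * μ + d * τ + e * tauStar μ τ c) : Generic μ τ c t := by
  intro a' b' d' e' h'
  refine h (a' - a) (b' - b) (d' - d) (e' - e) ?_
  push_cast
  linear_combination h' - ht

lemma Generic.regular {ξ : ℂ} (h : Generic μ τ c ξ) : Regular μ τ ξ := fun a b d h' =>
  h a b d 0 (by rw [h']; push_cast; ring)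

lemma Generic.regular_star {ξ : ℂ} (h : Generic μ τ c ξ) : Regular μ (tauStar μ τ c) ξ :=
  fun a b d h' => h a b 0 d (by rw [h']; push_cast; ring)

lemma Generic.add_gammaShift {ξ : ℂ} (h : Generic μ τ c ξ) (ℓ : ℤ) :
    Generic μ τ c (ξ + gammaShift τ ℓ) :=
  h.shift (-ℓ) 0 (-ℓ) 0 (by rw [gammaShift]; push_cast; ring)

lemma scal_aPow (ℓ : ℤ) : scal (EllAlg N μ τ c) (aPow N ℓ) = lef (scal _ (aMat N ^ ℓ)) :=
  (lef_scal _).symm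

lemma scal_mul_eq_one {A B : Matrix (Fin N × Fin N) (Fin N × Fin N) ℂ} (h : A * B = 1) :
    scal (EllAlg N μ τ c) A * scal _ B = 1 := by rw [← scal_mul, h, scal_one]

lemma lef_mul_eq_one {X Y : Matrix (Fin N) (Fin N) (EllAlg N μ τ c)} (h : X * Y = 1) :
    lef X * lef Y = 1 := by rw [← lef_mul, h, lef_one]

/-- The exchange relation of `L₁(z₁)⁻¹` with `L₂(z₂)`. -/
lemma rll_inv (hN : 2 ≤ N) (hA : Admissible μ τ c) {ξ₁ ξ₂ : ℂ} (h : Generic μ τ c (ξ₁ - ξ₂)) :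
    lef (LInvMat N μ τ c ξ₁) * scal _ (rInv N μ τ (ξ₁ - ξ₂)) * rig (LMat N μ τ c ξ₂)
      = rig (LMat N μ τ c ξ₂) * scal _ (rInv N μ (tauStar μ τ c) (ξ₁ - ξ₂))
        * lef (LInvMat N μ τ c ξ₁) :=
  exchange_inv (rll ξ₁ ξ₂ h.regular h.regular_star)
    (scal_mul_eq_one (rInv_mul_rMat hN hA.im_mu hA.im_tau hA.mu_ne h.regular))
    (scal_mul_eq_one (rMat_mul_rInv hN hA.im_mu hA.im_tauStar hA.mu_ne_star h.regular_star))
    (lef_mul_eq_one (LInvMat_mul_LMat ξ₁)) (lef_mul_eq_one (LMat_mul_LInvMat ξ₁))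

lemma rInv_add_int (hN : 2 ≤ N) (hμi : 0 < μ.im) (hτ : 0 < τ.im)
    (hμ : ∀ a b : ℤ, μ ≠ a + b * τ) {ξ : ℂ} (h : Regular μ τ ξ) {k : ℤ} (hk : (N : ℤ) ∣ k) :
    rInv N μ τ (ξ + k) = rInv N μ τ ξ :=
  rInv_eq_of_rMat_eq (rMat_add_int μ τ ξ hk)
    (rInv_mul_rMat hN hμi hτ hμ (h.shift k 0 0 (by push_cast; ring)))
    (rMat_mul_rInv hN hμi hτ hμ h)

/-- The scalar `F(ℓ, z) / F*(ℓ', z)`. -/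
def fRatio (N : ℕ) (μ τ c : ℂ) (ℓ ℓ' : ℤ) (ξ : ℂ) : ℂ :=
  fInt N μ τ ℓ ξ * (fInt N μ (tauStar μ τ c) ℓ' ξ)⁻¹

lemma fRatio_ne_zero (hμi : 0 < μ.im) {ξ : ℂ} (h : Generic μ τ c ξ) (ℓ ℓ' : ℤ) :
    fRatio N μ τ c ℓ ℓ' ξ ≠ 0 :=
  mul_ne_zero (fInt_ne_zero hμi h.regular ℓ) (inv_ne_zero (fInt_ne_zero hμi h.regular_star ℓ'))

lemma fRatio_sub_mu (hμi : 0 < μ.im) (ℓ ℓ' : ℤ) (ξ : ℂ) :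
    fRatio N μ τ c ℓ ℓ' (ξ - N * μ) = fRatio N μ τ c ℓ ℓ' ξ := by
  rw [fRatio, fRatio, fInt_sub_mu hμi, fInt_sub_mu hμi]

omit [NeZero N] in
lemma exchangeF_eq (ℓ ℓ' m : ℤ) (ξ : ℂ) :
    exchangeF N μ τ c ℓ ℓ' m ξ
      = fRatio N μ τ c ℓ ℓ' ξ * (fRatio N μ τ c ℓ ℓ' (ξ - gammaShift τ m))⁻¹ := by
  rw [exchangeF, fRatio, fRatio, mul_inv, inv_inv, div_eq_mul_inv, div_eq_mul_inv]
  ring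

lemma opT_mul_LMat (hN : 2 ≤ N) (hA : Admissible μ τ c) {ℓ ℓ' : ℤ}
    (hs : OnSurface N μ τ c ℓ ℓ') {ξ₁ ξ₂ : ℂ} (h : Generic μ τ c (ξ₁ - ξ₂)) :
    dg (Fin N) (opT N μ τ c ℓ ℓ' ξ₁) * LMat N μ τ c ξ₂
      = fRatio N μ τ c ℓ ℓ' (ξ₁ - ξ₂) • (LMat N μ τ c ξ₂ * dg (Fin N) (opT N μ τ c ℓ ℓ' ξ₁)) := by
  obtain ⟨k, -, hk, hsurf⟩ := hs
  have e' : ξ₁ + gammaShift τ ℓ - ξ₂ = ξ₁ - ξ₂ + gammaShift τ ℓ := by ring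
  have h' : Generic μ τ c (ξ₁ + gammaShift τ ℓ - ξ₂) := e' ▸ h.add_gammaShift ℓ
  have hx : Regular μ (tauStar μ τ c) (ξ₁ - ξ₂ + gammaShift (tauStar μ τ c) ℓ') :=
    h.regular_star.gammaShift ℓ'
  have inv := rll_inv hN hA h'
  -- Here the surface enters: it rewrites the argument of `R*⁻¹` as that of the remaining `R*`
  -- shifted by `Nμ`, the discrepancy `k` being a period.
  have er : rInv N μ (tauStar μ τ c) (ξ₁ + gammaShift τ ℓ - ξ₂)
      = rInv N μ (tauStar μ τ c) (ξ₁ - ξ₂ + gammaShift (tauStar μ τ c) ℓ' + N * μ) := by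
    rw [← rInv_add_int hN hA.im_mu hA.im_tauStar hA.mu_ne_star
      (ξ := ξ₁ - ξ₂ + gammaShift (tauStar μ τ c) ℓ' + N * μ)
      (hx.shift 0 N 0 (by push_cast; ring)) hk]
    congr 1
    rw [hsurf]; ring
  rw [er, e'] at inv
  have ha := aPow_mul_rInv hN hA.im_mu hA.im_tau hA.mu_ne h.regular ℓ
  have hb := rMat_mul_aPow_neg (N := N) hA.im_mu hA.im_tauStar h.regular_star ℓ'
  have key := exchange_trace_first (rll ξ₁ ξ₂ h.regular h.regular_star)
    (scal_mul_eq_one (rInv_mul_rMat hN hA.im_mu hA.im_tau hA.mu_ne h.regular)) inv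
    (a := lef (scal _ (aMat N ^ ℓ))) (b := lef (scal _ (aMat N ^ (-ℓ'))))
    (by rw [← scal_aPow, ← scal_mul, ha, scal_smul, scal_mul])
    (by rw [← scal_aPow, ← scal_mul, hb, scal_smul, scal_mul])
    (lef_scal_mul_rig _ _) (lef_scal_mul_rig _ _)
  rw [← lef_mul, ← lef_mul, ← lef_mul] at key
  have key2 := congrArg ptr key
  rw [ptr_smul, ptr_mul_rig, ptr_rig_mul, ptr_lef,
    ptr_crossed (crossed_rInv_rMat hN hA.im_mu hA.im_tauStar hA.mu_ne_star hx).1] at key2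
  exact key2

lemma opS_mul_LMat (hN : 2 ≤ N) (hA : Admissible μ τ c) {ℓ ℓ' : ℤ}
    (hs : OnSurface N μ τ c (-ℓ) (-ℓ')) {ξ₁ ξ₂ : ℂ} (h : Generic μ τ c (ξ₁ - ξ₂)) :
    dg (Fin N) (opS N μ τ c ℓ ℓ' ξ₁) * LMat N μ τ c ξ₂
      = fRatio N μ τ c ℓ ℓ' (ξ₁ - ξ₂) • (LMat N μ τ c ξ₂ * dg (Fin N) (opS N μ τ c ℓ ℓ' ξ₁)) := by
  obtain ⟨k, -, hk, hsurf⟩ := hs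
  have e' : ξ₁ - gammaShift τ (-ℓ) + N * μ - ξ₂ = ξ₁ - ξ₂ + gammaShift τ ℓ + N * μ := by
    simp only [gammaShift]; push_cast; ring
  have h' : Generic μ τ c (ξ₁ - gammaShift τ (-ℓ) + N * μ - ξ₂) :=
    e' ▸ (h.add_gammaShift ℓ).shift 0 N 0 0 (by push_cast; ring)
  have hx : Regular μ τ (ξ₁ - ξ₂ + gammaShift τ ℓ) := h.regular.gammaShift ℓ
  have inv := rll_inv hN hA h'
  -- The surface with indices `-ℓ, -ℓ'` absorbs the shift by `Nμ` on the starred side, where the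
  -- argument must match the one obtained by moving `R*⁻¹` past `a^{-ℓ'}`. On the unstarred side the
  -- shift remains, as crossing requires.
  have er : rInv N μ (tauStar μ τ c) (ξ₁ - gammaShift τ (-ℓ) + N * μ - ξ₂)
      = rInv N μ (tauStar μ τ c) (ξ₁ - ξ₂ + gammaShift (tauStar μ τ c) ℓ') := by
    rw [← rInv_add_int hN hA.im_mu hA.im_tauStar hA.mu_ne_star h'.regular_star hk]
    congr 1
    rw [hsurf]
    simp only [gammaShift]; push_cast; ring
  rw [er, e'] at inv
  have ha := aPow_mul_rMat (N := N) hA.im_mu hA.im_tau h.regular ℓ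
  have hb := rInv_mul_aPow_neg hN hA.im_mu hA.im_tauStar hA.mu_ne_star h.regular_star ℓ'
  have key := exchange_trace_second (rll ξ₁ ξ₂ h.regular h.regular_star)
    (scal_mul_eq_one (rMat_mul_rInv hN hA.im_mu hA.im_tauStar hA.mu_ne_star h.regular_star)) inv
    (a := lef (scal _ (aMat N ^ ℓ))) (b := lef (scal _ (aMat N ^ (-ℓ'))))
    (by rw [← scal_aPow, ← scal_mul, ha, scal_smul, scal_mul])
    (by rw [← scal_aPow, ← scal_mul, hb, scal_smul, scal_mul])
    (lef_scal_mul_rig _ _) (lef_scal_mul_rig _ _)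
  rw [← lef_mul, ← lef_mul, ← lef_mul] at key
  have key2 := congrArg ptr key
  rw [ptr_smul, ptr_mul_rig, ptr_rig_mul, ptr_lef,
    ptr_crossed (crossed_rInv_rMat hN hA.im_mu hA.im_tau hA.mu_ne hx).2] at key2
  -- The relation comes with `L` on the left, so its scalar is the inverse of the one wanted.
  have key3 : LMat N μ τ c ξ₂ * dg (Fin N) (opS N μ τ c ℓ ℓ' ξ₁)
      = ((fInt N μ τ ℓ (ξ₁ - ξ₂))⁻¹ * fInt N μ (tauStar μ τ c) ℓ' (ξ₁ - ξ₂))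
        • (dg (Fin N) (opS N μ τ c ℓ ℓ' ξ₁) * LMat N μ τ c ξ₂) := key2
  have n1 := fInt_ne_zero (N := N) hA.im_mu h.regular ℓ
  have n2 := fInt_ne_zero (N := N) hA.im_mu h.regular_star ℓ'
  rw [key3, smul_smul, fRatio]
  convert (one_smul ℂ _).symm using 2
  field_simp

/-! ### Exchange relations of the trace operators -/

lemma mul_inv_exchange {S : Type*} [Ring S] [Algebra ℂ S] {d l li : S} {f : ℂ} (hf : f ≠ 0)
    (h : d * l = f • (l * d)) (h1 : l * li = 1) (h2 : li * l = 1) :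
    d * li = f⁻¹ • (li * d) := by
  have : li * d = f • (d * li) := by
    calc li * d = li * (d * l) * li := by rw [mul_assoc, mul_assoc d, h1, mul_one]
      _ = f • (li * l * d * li) := by
        rw [h]; simp only [mul_smul_comm, smul_mul_assoc, mul_assoc]
      _ = _ := by rw [h2, one_mul]
  rw [this, smul_smul, inv_mul_cancel₀ hf, one_smul]

variable {x : EllAlg N μ τ c} {f : ℂ → ℂ} {ξ₁ : ℂ}

lemma mul_LInvMat (hf : ∀ ξ, Generic μ τ c ξ → f ξ ≠ 0)
    (hx : ∀ ξ₂, Generic μ τ c (ξ₁ - ξ₂) →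
      dg (Fin N) x * LMat N μ τ c ξ₂ = f (ξ₁ - ξ₂) • (LMat N μ τ c ξ₂ * dg (Fin N) x))
    {ξ₂ : ℂ} (h : Generic μ τ c (ξ₁ - ξ₂)) :
    dg (Fin N) x * LInvMat N μ τ c ξ₂
      = (f (ξ₁ - ξ₂))⁻¹ • (LInvMat N μ τ c ξ₂ * dg (Fin N) x) :=
  mul_inv_exchange (hf _ h) (hx ξ₂ h) (LMat_mul_LInvMat ξ₂) (LInvMat_mul_LMat ξ₂)

/-- Only the scalar exchange of `x` with every `L` matters. Passing `L(γz₂)⁻¹` gives `f⁻¹` at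
`γ⁻¹z₁/z₂`, passing `L(z₂)` gives `f` at `z₁/z₂`, and the powers of `a` are scalar matrices. -/
lemma mul_opT (hf : ∀ ξ, Generic μ τ c ξ → f ξ ≠ 0)
    (hx : ∀ ξ₂, Generic μ τ c (ξ₁ - ξ₂) →
      dg (Fin N) x * LMat N μ τ c ξ₂ = f (ξ₁ - ξ₂) • (LMat N μ τ c ξ₂ * dg (Fin N) x))
    {ξ₂ : ℂ} (h : Generic μ τ c (ξ₁ - ξ₂)) (m m' : ℤ) :
    x * opT N μ τ c m m' ξ₂
      = (f (ξ₁ - ξ₂) * (f (ξ₁ - ξ₂ - gammaShift τ m))⁻¹) • (opT N μ τ c m m' ξ₂ * x) := by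
  have e : ξ₁ - (ξ₂ + gammaShift τ m) = ξ₁ - ξ₂ - gammaShift τ m := by ring
  have hi := mul_LInvMat hf hx (ξ₂ := ξ₂ + gammaShift τ m)
    (h.shift m 0 m 0 (by rw [gammaShift]; push_cast; ring))
  rw [e] at hi
  rw [opT, ← trace_dg_mul, ← trace_mul_dg, ← Matrix.trace_smul]
  congr 1
  rw [← mul_assoc, ← mul_assoc, ← mul_assoc, hi]
  simp only [Matrix.smul_mul]
  rw [mul_assoc (LInvMat N μ τ c _) (dg (Fin N) x), dg_mul_scal]
  simp only [mul_assoc]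
  rw [← mul_assoc (dg (Fin N) x) (LMat N μ τ c ξ₂), hx ξ₂ h]
  simp only [Matrix.smul_mul, Matrix.mul_smul, smul_smul]
  rw [mul_assoc (LMat N μ τ c ξ₂), dg_mul_scal, mul_comm (f (ξ₁ - ξ₂))]

lemma mul_opS (hf : ∀ ξ, Generic μ τ c ξ → f ξ ≠ 0)
    (hx : ∀ ξ₂, Generic μ τ c (ξ₁ - ξ₂) →
      dg (Fin N) x * LMat N μ τ c ξ₂ = f (ξ₁ - ξ₂) • (LMat N μ τ c ξ₂ * dg (Fin N) x))
    (hp : ∀ ξ, f (ξ - N * μ) = f ξ)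
    {ξ₂ : ℂ} (h : Generic μ τ c (ξ₁ - ξ₂)) (m m' : ℤ) :
    x * opS N μ τ c m m' ξ₂
      = (f (ξ₁ - ξ₂) * (f (ξ₁ - ξ₂ - gammaShift τ m))⁻¹) • (opS N μ τ c m m' ξ₂ * x) := by
  have e : ξ₁ - (ξ₂ - gammaShift τ (-m) + N * μ) = ξ₁ - ξ₂ - gammaShift τ m - N * μ := by
    simp only [gammaShift]; push_cast; ring
  have hi := mul_LInvMat hf hx (ξ₂ := ξ₂ - gammaShift τ (-m) + N * μ)
    (h.shift m (-N) m 0 (by rw [gammaShift]; push_cast; ring))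
  rw [e, hp] at hi
  rw [opS, ← trace_dg_mul, ← trace_mul_dg, ← Matrix.trace_smul]
  congr 1
  rw [← mul_assoc, ← mul_assoc, ← mul_assoc, dg_mul_scal]
  rw [mul_assoc (scal _ _) (dg (Fin N) x), hx ξ₂ h]
  simp only [Matrix.smul_mul, Matrix.mul_smul, mul_assoc]
  rw [← mul_assoc (dg (Fin N) x) (scal _ _), dg_mul_scal]
  simp only [mul_assoc]
  rw [hi]
  simp only [Matrix.mul_smul, smul_smul]

end

/-! ### Intersections of surfaces -/

lemma ne_add_mul_of_one_lt {μ τ : ℂ} (hμ : 0 < μ.im) {t : ℝ} (ht : 1 < t)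
    (hτ : τ.im = t * μ.im) (a b : ℤ) : μ ≠ a + b * τ := by
  intro h
  have h1 := congrArg Complex.im h
  simp only [add_im, intCast_im, zero_add, mul_im, intCast_re, zero_mul, add_zero, hτ] at h1
  have h2 : (b : ℝ) * t = 1 := by
    refine mul_right_cancel₀ hμ.ne' ?_
    linear_combination -h1
  have hb : 0 < b := by
    by_contra hb
    have : (b : ℝ) ≤ 0 := by exact_mod_cast not_lt.1 hb
    nlinarith
  have : (1 : ℝ) ≤ b := by exact_mod_cast hb
  nlinarith

/-- With `τ + 1 = tμ` every term of the surface equation is a multiple of `μ`, and it becomes `(ℓ' -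
ℓ) t = c ℓ' + N`. Admissibility follows from `t > 1` and `t - c > 1` on imaginary parts. -/
lemma exists_infinite_inter_surfaces {N : ℕ} (hN : 2 ≤ N) (c : ℚ) :
    ∃ D : Set (ℤ × ℤ), D.Infinite ∧
      ∀ μ : ℂ, 0 < μ.im → ∃ τ : ℂ, Admissible μ τ c ∧
        ∀ d ∈ D, OnSurface N μ τ c d.1 d.2 := by
  set a : ℤ := c.num with ha
  set b : ℤ := (c.den : ℤ) with hb
  have hb0 : 0 < b := Int.natCast_pos.2 c.den_pos
  -- Writing `c = a/b` and `ℓ' = b m`, one needs `t` to divide `a m + N`. For this `t`, the choice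
  -- `m = 2aN + tn` gives `a m + N = t (1 + an)`, whence `ℓ = ℓ' - (1 + an)`. The square also makes
  -- `t` exceed `c + 1` whatever the sign of `c`.
  set t : ℤ := N * (1 + 2 * a ^ 2) with ht
  have hN' : (2 : ℤ) ≤ N := by exact_mod_cast hN
  have ht2 : 2 ≤ t := by nlinarith [sq_nonneg a]
  have hta : a + 1 < t := by nlinarith [sq_nonneg (a - 1), sq_nonneg a]
  have hcb : (c : ℂ) * b = a := by
    have : c * c.den = c.num := Rat.mul_den_eq_num c
    rw [hb, ha]; exact_mod_cast congrArg (Rat.cast : ℚ → ℂ) this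
  have hct : (c : ℝ) + 1 < t := by
    have h1 : (c : ℝ) * b = a := by
      have : c * c.den = c.num := Rat.mul_den_eq_num c
      rw [hb, ha]; exact_mod_cast congrArg (Rat.cast : ℚ → ℝ) this
    have h2 : (1 : ℝ) ≤ b := by exact_mod_cast hb0
    have h3 : (a : ℝ) + 1 < t := by exact_mod_cast hta
    have h4 : (2 : ℝ) ≤ t := by exact_mod_cast ht2
    by_contra hcon
    push Not at hcon
    nlinarith
  refine ⟨Set.range fun n : ℤ => (b * (2 * a * N + t * n) - (1 + a * n), b * (2 * a * N + t * n)),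
    Set.infinite_range_of_injective ?_, ?_⟩
  · intro n n' h
    have h1 := (Prod.ext_iff.1 h).2
    have h2 := mul_left_cancel₀ hb0.ne' h1
    exact mul_left_cancel₀ (show t ≠ 0 by lia) (add_left_cancel h2)
  · intro μ hμ
    have i1 : (t * μ - 1 : ℂ).im = (t : ℝ) * μ.im := by simp
    have i2 : (tauStar μ (t * μ - 1) c).im = ((t : ℝ) - c) * μ.im := by
      simp [tauStar]; ring
    have ht' : (1 : ℝ) < t := by exact_mod_cast (show 1 < t by lia)
    refine ⟨t * μ - 1, ⟨hμ, ?_, ?_, ?_, ?_⟩, ?_⟩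
    · rw [i1]; exact mul_pos (by linarith) hμ
    · rw [i2]; exact mul_pos (by linarith) hμ
    · exact ne_add_mul_of_one_lt hμ ht' i1
    · exact ne_add_mul_of_one_lt hμ (by linarith) i2
    · rintro _ ⟨n, rfl⟩
      refine ⟨0, dvd_zero _, dvd_zero _, ?_⟩
      have htc : (t : ℂ) = N * (1 + 2 * a ^ 2) := by rw [ht]; push_cast; ring
      simp only [gammaShift, tauStar]
      push_cast
      have e : (c : ℂ) * (b * (2 * a * N + t * n)) = a * (2 * a * N + t * n) := by
        rw [← mul_assoc, hcb]
      linear_combination (-μ) * e + μ * htc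

end EllipticGLN

end

open EllipticGLN in
theorem proposition5p2 (N : ℕ) [NeZero N] (hN : 2 ≤ N) :
    (∀ c : ℚ, ∃ D : Set (ℤ × ℤ), D.Infinite ∧
      ∀ μ : ℂ, 0 < μ.im → ∃ τ : ℂ, Admissible μ τ c ∧
        ∀ d ∈ D, OnSurface N μ τ c d.1 d.2) ∧
    (∀ μ τ c : ℂ, Admissible μ τ c → ∀ (ℓ ℓ' m m' : ℤ) (ξ₁ ξ₂ : ℂ),
      Generic μ τ c (ξ₁ - ξ₂) →
      (OnSurface N μ τ c ℓ ℓ' → OnSurface N μ τ c m m' →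
        opT N μ τ c ℓ ℓ' ξ₁ * opT N μ τ c m m' ξ₂ =
          exchangeF N μ τ c ℓ ℓ' m (ξ₁ - ξ₂) •
            (opT N μ τ c m m' ξ₂ * opT N μ τ c ℓ ℓ' ξ₁)) ∧
      (OnSurface N μ τ c (-ℓ) (-ℓ') → OnSurface N μ τ c (-m) (-m') →
        opS N μ τ c ℓ ℓ' ξ₁ * opS N μ τ c m m' ξ₂ =
          exchangeF N μ τ c ℓ ℓ' m (ξ₁ - ξ₂) •
            (opS N μ τ c m m' ξ₂ * opS N μ τ c ℓ ℓ' ξ₁)) ∧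
      (OnSurface N μ τ c ℓ ℓ' → OnSurface N μ τ c (-m) (-m') →
        opT N μ τ c ℓ ℓ' ξ₁ * opS N μ τ c m m' ξ₂ =
          exchangeF N μ τ c ℓ ℓ' m (ξ₁ - ξ₂) •
            (opS N μ τ c m m' ξ₂ * opT N μ τ c ℓ ℓ' ξ₁))) := by
  refine ⟨fun c => exists_infinite_inter_surfaces hN c, ?_⟩
  intro μ τ c hA ℓ ℓ' m m' ξ₁ ξ₂ h
  have hf := fun ξ (hξ : Generic μ τ c ξ) => fRatio_ne_zero (N := N) (ξ := ξ) hA.im_mu hξ ℓ ℓ'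
  have hp := fRatio_sub_mu (N := N) (τ := τ) (c := c) hA.im_mu ℓ ℓ'
  rw [exchangeF_eq]
  -- In the three cases the left operator exchanges with every `L` through the same scalar `F / F*`;
  -- only the shape of the right operator distinguishes the arguments.
  exact ⟨fun h1 _ => mul_opT hf (fun _ => opT_mul_LMat hN hA h1) h m m',
    fun h1 _ => mul_opS hf (fun _ => opS_mul_LMat hN hA h1) hp h m m',
    fun h1 _ => mul_opS hf (fun _ => opT_mul_LMat hN hA h1) hp h m m'⟩
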